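/- The model of computation is the (deterministic) word RAM with unit-cost arithmetic, comparison, bitwise and shift operations on words and uniform programs; words have $O(n)$ bits for $k$-SAT on $n$ variables, and $O(\log N)$ bits for inputs that consist of $N$ vectors. The Strong Exponential Time Hypothesis (SETH) states: for every $\varepsilon>0$ there is an integer $k\ge 3$ such that $k$-SAT on $n$ variables (deciding whether a given set of clauses, each with $k$ literals, is satisfiable) cannot be solved in time $O(2^{(1-\varepsilon)n})$. Assume SETH. Then there are functions $d:\mathbb N\to\mathbb N$ with $d(N)=N^{o(1)}$ and $c:\mathbb N\to\mathbb R$ with $c(N)=2^{(\log_2 N)^{1-o(1)}}$ (as $N\to\infty$) such that for every constant $\varepsilon>0$ the following holds. Consider any algorithm that, given two sets $A,B\subseteq\{-1,1\}^{d}$ with $|A|=|B|=N\ge 1$ and $d=d(N)$, runs in time $O(N^{2-\varepsilon})$ and approximates $$\mathrm{OPT}(A,B)=\max_{a\in A,\ b\in B}|a\cdot b|$$ within a factor $f(N)$, that is, outputs a natural number $L$ with $L\le \mathrm{OPT}(A,B)\le f(N)\cdot L$. Then $f(N)\ge c(N)$ for infinitely many $N$. -/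

import Mathlib

open Filter Topology

/-! ### The word RAM

A unit-cost random access machine with words of `w` bits. Programs are uniform and structured
(sequencing, branching, loops); up to a constant factor, which depends on the program only, this is
the same as straight-line code with jumps. -/

namespace WordRAM

/-- Unit-cost word operations. -/
inductive Op
  | add | sub | mul | div | mod | eq | lt | and | or | xor | shl | shr

/-- The value of a word operation; subtraction is truncated at `0`, and `x / 0 = 0`. -/
def Op.eval : Op → ℕ → ℕ → ℕ
  | .add, x, y => x + y
  | .sub, x, y => x - y
  | .mul, x, y => x * y
  | .div, x, y => x / y
  | .mod, x, y => x % y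
  | .eq, x, y => if x = y then 1 else 0
  | .lt, x, y => if x < y then 1 else 0
  | .and, x, y => x &&& y
  | .or, x, y => x ||| y
  | .xor, x, y => x ^^^ y
  | .shl, x, y => x <<< y
  | .shr, x, y => x >>> y

/-- Programs. Registers are numbered (a program mentions only finitely many of them); in addition
there is a random access memory, which is addressed through registers. -/
inductive Prog
  /-- do nothing -/
  | skip
  /-- `R[r] := v` -/
  | const (r v : ℕ)
  /-- `R[r] := R[s] o R[t]` -/
  | op (o : Op) (r s t : ℕ)
  /-- `R[r] := M[R[s]]` -/
  | load (r s : ℕ)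
  /-- `M[R[r]] := R[s]` -/
  | store (r s : ℕ)
  /-- `p; q` -/
  | seq (p q : Prog)
  /-- `if R[r] ≠ 0 then p else q` -/
  | ite (r : ℕ) (p q : Prog)
  /-- `while R[r] ≠ 0 do p` -/
  | loop (r : ℕ) (p : Prog)

/-- A configuration: the contents of the registers and of the memory. -/
structure State where
  reg : ℕ → ℕ
  mem : ℕ → ℕ

/-- Write the value `v` into register `r`. -/
def State.setReg (σ : State) (r v : ℕ) : State :=
  { σ with reg := Function.update σ.reg r v }

/-- Write the value `v` into memory cell `a`. -/
def State.setMem (σ : State) (a v : ℕ) : State :=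
  { σ with mem := Function.update σ.mem a v }

/-- `Exec w p σ t τ`: on a machine with `w`-bit words, the program `p`, started in `σ`, halts in `τ`
after exactly `t` steps. Each elementary instruction and each evaluation of a branching or loop
condition is one step. Only values below `2 ^ w` can be put into a register (hence only such values
can be stored, and only such addresses used): a program that would exceed this bound does not
halt. -/
inductive Exec (w : ℕ) : Prog → State → ℕ → State → Prop
  | skip (σ : State) : Exec w .skip σ 1 σ
  | const (σ : State) (r v : ℕ) (hv : v < 2 ^ w) :
      Exec w (.const r v) σ 1 (σ.setReg r v)
  | op (σ : State) (o : Op) (r s t : ℕ) (hv : o.eval (σ.reg s) (σ.reg t) < 2 ^ w) :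
      Exec w (.op o r s t) σ 1 (σ.setReg r (o.eval (σ.reg s) (σ.reg t)))
  | load (σ : State) (r s : ℕ) (hv : σ.mem (σ.reg s) < 2 ^ w) :
      Exec w (.load r s) σ 1 (σ.setReg r (σ.mem (σ.reg s)))
  | store (σ : State) (r s : ℕ) :
      Exec w (.store r s) σ 1 (σ.setMem (σ.reg r) (σ.reg s))
  | seq {p q : Prog} {σ τ υ : State} {t u : ℕ} (hp : Exec w p σ t τ) (hq : Exec w q τ u υ) :
      Exec w (.seq p q) σ (t + u) υ
  | ite_true {p q : Prog} {r : ℕ} {σ τ : State} {t : ℕ} (hr : σ.reg r ≠ 0)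
      (hp : Exec w p σ t τ) : Exec w (.ite r p q) σ (t + 1) τ
  | ite_false {p q : Prog} {r : ℕ} {σ τ : State} {t : ℕ} (hr : σ.reg r = 0)
      (hq : Exec w q σ t τ) : Exec w (.ite r p q) σ (t + 1) τ
  | loop_done {p : Prog} {r : ℕ} {σ : State} (hr : σ.reg r = 0) :
      Exec w (.loop r p) σ 1 σ
  | loop_step {p : Prog} {r : ℕ} {σ τ υ : State} {t u : ℕ} (hr : σ.reg r ≠ 0)
      (hp : Exec w p σ t τ) (hl : Exec w (.loop r p) τ u υ) :
      Exec w (.loop r p) σ (t + u + 1) υ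

/-- The initial configuration: the input is in the memory, from address `0` on; everything else
is `0`. -/
def initState (input : List ℕ) : State where
  reg := fun _ => 0
  mem := fun a => input.getD a 0

/-- On a machine with `w`-bit words, the program `p` halts on `input` after `t` steps, with the word
`out` in register `0`. -/
def Computes (w : ℕ) (p : Prog) (input : List ℕ) (t out : ℕ) : Prop :=
  ∃ τ : State, Exec w p (initState input) t τ ∧ τ.reg 0 = out

end WordRAM

/-! ### `k`-SAT and the Strong Exponential Time Hypothesis -/

/-- A clause with `k` literals over the variables `0, …, n - 1`; the literal `(x, true)` is the
variable `x`, the literal `(x, false)` is its negation. Literals may be repeated in a clause. -/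
abbrev KClause (k n : ℕ) := Fin k → Fin n × Bool

/-- A `k`-CNF formula: a set of clauses, given as a list without repetitions. (Hence there are at
most `(2 * n) ^ k` clauses.) -/
structure KCNF (k n : ℕ) where
  clauses : List (KClause k n)
  nodup : clauses.Nodup

/-- The formula has a satisfying assignment. -/
def KCNF.Satisfiable {k n : ℕ} (φ : KCNF k n) : Prop :=
  ∃ x : Fin n → Bool, ∀ C ∈ φ.clauses, ∃ j : Fin k, x (C j).1 = (C j).2

/-- The input of a `k`-SAT algorithm: `n`, the number of clauses, and then the literals of all
clauses, with the number `2 * x + 1` for the variable `x` and `2 * x` for its negation. -/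
def KCNF.encode {k n : ℕ} (φ : KCNF k n) : List ℕ :=
  n :: φ.clauses.length ::
    (φ.clauses.map fun C => List.ofFn fun j => 2 * ((C j).1 : ℕ) + (C j).2.toNat).flatten

/-- The program `p` solves `k`-SAT on `n` variables in time `O(2 ^ ((1 - ε) * n))`, on a word RAM
with words of `O(n)` bits. -/
def SolvesKSATInTime (k : ℕ) (ε : ℝ) (p : WordRAM.Prog) : Prop :=
  ∃ (c : ℕ) (C : ℝ), ∀ (n : ℕ) (φ : KCNF k n), ∃ t out : ℕ,
    WordRAM.Computes (c * (n + 1)) p φ.encode t out ∧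
    (t : ℝ) ≤ C * (2 : ℝ) ^ ((1 - ε) * (n : ℝ)) ∧
    (out = 1 ↔ φ.Satisfiable)

/-- The Strong Exponential Time Hypothesis: for every `ε > 0` there is `k ≥ 3` such that `k`-SAT on
`n` variables cannot be solved in time `O(2 ^ ((1 - ε) * n))`. -/
def SETH : Prop :=
  ∀ ε : ℝ, 0 < ε → ∃ k : ℕ, 3 ≤ k ∧ ¬ ∃ p : WordRAM.Prog, SolvesKSATInTime k ε p

/-! ### Maximum inner product over `{-1, 1}` -/

/-- The inner product of two vectors in `{-1, 1}^d`; the type of signs `-1, 1` is `ℤˣ`. -/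
def signedIP {d : ℕ} (a b : Fin d → ℤˣ) : ℤ :=
  ∑ k, (a k : ℤ) * (b k : ℤ)

/-- The maximum of `|a · b|` over the pairs of a vector `a` of the first family and a vector `b` of
the second one. -/
def maxAbsIP {N d : ℕ} (A B : Fin N → Fin d → ℤˣ) : ℕ :=
  Finset.univ.sup fun p : Fin N × Fin N => (signedIP (A p.1) (B p.2)).natAbs

/-- All entries of a family of sign vectors, vector after vector, with the word `1` for the sign `1`
and the word `0` for the sign `-1`. -/
def encodeSigns {N d : ℕ} (A : Fin N → Fin d → ℤˣ) : List ℕ :=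
  (List.ofFn fun i => List.ofFn fun k => if A i k = 1 then 1 else 0).flatten

/-- The input of a maximum inner product algorithm: `N`, `d`, the vectors of `A`, those of `B`. -/
def encodeMaxIP {N d : ℕ} (A B : Fin N → Fin d → ℤˣ) : List ℕ :=
  N :: d :: (encodeSigns A ++ encodeSigns B)

/-- The program `p` runs in time `O(N ^ (2 - ε))`, on a word RAM with words of `O(log N)` bits, and
computes `max |a · b|` with approximation factor `f N`, over all instances that consist of two sets
`A` and `B` (listed in any order, without repetitions) of `N ≥ 1` vectors each in
`{-1, 1}^(d N)`: its output `out` satisfies `OPT / f N ≤ out ≤ OPT`. -/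
def ApproximatesMaxIPInTime (d : ℕ → ℕ) (ε : ℝ) (f : ℕ → ℝ) (p : WordRAM.Prog) : Prop :=
  ∃ (c : ℕ) (C : ℝ), ∀ N : ℕ, 1 ≤ N → ∀ A B : Fin N → Fin (d N) → ℤˣ,
    Function.Injective A → Function.Injective B → ∃ t out : ℕ,
      WordRAM.Computes (c * (Nat.log 2 N + 1)) p (encodeMaxIP A B) t out ∧
      (t : ℝ) ≤ C * (N : ℝ) ^ (2 - ε) ∧
      out ≤ maxAbsIP A B ∧ (maxAbsIP A B : ℝ) ≤ f N * (out : ℝ)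

/-! ### Executions on the word RAM: word length and counting loops -/

namespace WordRAM

/-! A fast approximation algorithm with a factor below the claimed gap for all large N is turned
into a k-SAT algorithm that contradicts SETH.

Split the variables into two halves of at most h = ⌈n/2⌉ variables. The N = 2^h assignments α, β of
the halves index the two families of vectors. With `missA` and `missB` recording which clauses a
half fails to satisfy, (α, β) satisfies the formula iff ∑ missA · missB over the clauses is 0. It
remains to turn "zero or nonzero" into a large multiplicative gap, in dimension N^{o(1)}.

(1) Sparsification. Clauses are sets of literals, and an assignment is a set X of true literals that
must hit all of them. If many minimal sets share a heart H, then X either hits H, which is added, or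
hits all petals, which are added. Always treating a least flower keeps the number of added sets
under control (`IsRun.card_added_le`, `IsRun.sum_numAdded_le`), so petals are added in only O(h /
log² h) steps (`IsRun.card_petalSteps_le`). The positions of these steps can be guessed in 2^{o(h)}
ways, and one of the guesses preserves a given solution (`exists_bits`). What remains has h ·
polylog(h) minimal clauses (`card_minF_le`).

(2) Merlin–Arthur protocol. The clauses are put into T blocks of length L = h / log² h. In each
block the players form polynomials over a field with q > h² elements, arranged such that the
coefficient of degree L in the sum of the products is the inner product. Merlin sends a polynomial
of degree at most 2L whose coefficient of degree L is 0; there are 2^{o(h)} of them. If the inner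
product is 0, the right one agrees with the true polynomial at all q points; otherwise any of them
agrees at 2L points or fewer (`Protocol.complete`, `Protocol.sound`).

(3) Signs. A coordinate cell is a point x together with a possible message of the first player. Four
signs per cell, taken from orthogonal characters, make the inner product equal to 4 times the number
of accepting points (`SignVec.sum_neg`). The R-th tensor power raises this to the R-th power
(`SignVec.sum_tensor`), so the two cases are (4q)^R and at most (8L)^R, a gap of at least 2^R since
4L ≤ q. With R = h^{1-o(1)} the dimension is still 2^{o(h)}.

The program for k-SAT loops over all guesses and all of Merlin's polynomials, writes down the
instance, and calls the given algorithm. This costs 2^{o(h)} · N^{2-ε}, which is O(2^{(1-ε/4)n})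
when ε ≤ 1.

All of this is carried out on the word RAM. `Fam.Comp` (polynomial time functions on words of linear
length) and `Fam.Does` (programs changing the memory) are closed under the usual constructions, so
that programs need not be written out by hand. -/

theorem Exec.mono_word {w w' : ℕ} (h : w ≤ w') {p : Prog} {σ τ : State} {t : ℕ}
    (e : Exec w p σ t τ) : Exec w' p σ t τ := by
  have hp : 2 ^ w ≤ 2 ^ w' := Nat.pow_le_pow_right two_pos h
  induction e with
  | skip => exact .skip _
  | const _ _ _ hv => exact .const _ _ _ (hv.trans_le hp)
  | op _ _ _ _ _ hv => exact .op _ _ _ _ _ (hv.trans_le hp)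
  | load _ _ _ hv => exact .load _ _ _ (hv.trans_le hp)
  | store => exact .store _ _ _
  | seq _ _ ih₁ ih₂ => exact .seq ih₁ ih₂
  | ite_true hr _ ih => exact .ite_true hr ih
  | ite_false hr _ ih => exact .ite_false hr ih
  | loop_done hr => exact .loop_done hr
  | loop_step hr _ _ ih₁ ih₂ => exact .loop_step hr ih₁ ih₂

@[simp] theorem State.setReg_reg_self (σ : State) (r v : ℕ) : (σ.setReg r v).reg r = v := by
  simp [State.setReg]

theorem State.setReg_reg_of_ne (σ : State) {r s : ℕ} (v : ℕ) (h : s ≠ r) :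
    (σ.setReg r v).reg s = σ.reg s := by
  simp [State.setReg, h]

@[simp] theorem State.setReg_mem (σ : State) (r v : ℕ) : (σ.setReg r v).mem = σ.mem := rfl

@[simp] theorem State.setMem_reg (σ : State) (r v : ℕ) : (σ.setMem r v).reg = σ.reg := rfl

theorem State.setMem_mem (σ : State) (r v : ℕ) :
    (σ.setMem r v).mem = Function.update σ.mem r v := rfl

/-- The counting loop `for R[i] := 0 to R[b] - 1 do body`; the register `c` holds the loop
condition. -/
def forProg (i b c : ℕ) (body : Prog) : Prog :=
  .seq (.const i 0) (.seq (.op .lt c i b) (.loop c (.seq body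
    (.seq (.const c 1) (.seq (.op .add i i c) (.op .lt c i b))))))

/-- The loop itself writes only the counter and the condition register, hence the demand `hI` that
the invariant ignore these two. A round costs the body, three instructions and one test; the start
and the last test cost 3. -/
theorem exec_forProg {w i b c B T : ℕ} {body : Prog} (hib : i ≠ b) (hic : i ≠ c) (hbc : b ≠ c)
    (hB : B < 2 ^ w) (hw : 0 < w) (I : ℕ → State → Prop)
    (hI : ∀ j σ v, I j σ → I j (σ.setReg i v) ∧ I j (σ.setReg c v))
    (hbody : ∀ j < B, ∀ σ, I j σ → σ.reg i = j → σ.reg b = B → ∃ t τ, Exec w body σ t τ ∧ t ≤ T ∧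
      τ.reg i = j ∧ τ.reg b = B ∧ I (j + 1) τ)
    (σ : State) (h0 : I 0 σ) (hb : σ.reg b = B) :
    ∃ t τ, Exec w (forProg i b c body) σ t τ ∧ I B τ ∧ t ≤ B * (T + 4) + 3 := by
  have h1 : 1 < 2 ^ w := Nat.one_lt_two_pow hw.ne'
  -- Induction on the number `m` of remaining rounds, with the condition register already up to
  -- date.
  have key : ∀ m j, j + m = B → ∀ σ, I j σ → σ.reg i = j → σ.reg b = B →
      σ.reg c = (if j < B then 1 else 0) →
      ∃ t τ, Exec w (.loop c (.seq body
        (.seq (.const c 1) (.seq (.op .add i i c) (.op .lt c i b))))) σ t τ ∧ I B τ ∧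
        t ≤ m * (T + 4) + 1 := by
    intro m
    induction m with
    | zero =>
      intro j hj σ hIj hi hb hc
      obtain rfl : j = B := by simpa using hj
      exact ⟨1, σ, .loop_done (by simpa using hc), hIj, by simp⟩
    | succ m ih =>
      intro j hj σ hIj hi hb hc
      have hjB : j < B := by omega
      obtain ⟨t, τ, he, ht, hi', hb', hI'⟩ := hbody j hjB σ hIj hi hb
      set τ₁ := τ.setReg c 1 with hτ₁
      have e₁ : Exec w (.const c 1) τ 1 τ₁ := .const _ _ _ h1
      have hi₁ : τ₁.reg i = j := by rw [hτ₁, State.setReg_reg_of_ne _ _ hic, hi']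
      have hc₁ : τ₁.reg c = 1 := by simp [hτ₁]
      have hb₁ : τ₁.reg b = B := by rw [hτ₁, State.setReg_reg_of_ne _ _ hbc, hb']
      set τ₂ := τ₁.setReg i (j + 1) with hτ₂
      have e₂ : Exec w (.op .add i i c) τ₁ 1 τ₂ := by
        have := Exec.op (w := w) τ₁ .add i i c
          (by simp only [Op.eval, hi₁, hc₁]; omega)
        simpa only [Op.eval, hi₁, hc₁] using this
      have hi₂ : τ₂.reg i = j + 1 := by simp [hτ₂]
      have hb₂ : τ₂.reg b = B := by rw [hτ₂, State.setReg_reg_of_ne _ _ hib.symm, hb₁]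
      set τ₃ := τ₂.setReg c (if j + 1 < B then 1 else 0) with hτ₃
      have e₃ : Exec w (.op .lt c i b) τ₂ 1 τ₃ := by
        have := Exec.op (w := w) τ₂ .lt c i b
          (by simp only [Op.eval]; split_ifs <;> omega)
        simpa only [Op.eval, hi₂, hb₂] using this
      obtain ⟨u, υ, hu, hIu, hut⟩ := ih (j + 1) (by omega) τ₃
        ((hI _ _ _ ((hI _ _ _ ((hI _ _ _ hI').2)).1)).2)
        (by rw [hτ₃, State.setReg_reg_of_ne _ _ hic, hi₂])
        (by rw [hτ₃, State.setReg_reg_of_ne _ _ hbc, hb₂]) (by simp [hτ₃])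
      refine ⟨(t + (1 + (1 + 1))) + u + 1, υ,
        .loop_step (by simp [hc, hjB]) (.seq he (.seq e₁ (.seq e₂ e₃))) hu, hIu, ?_⟩
      have : (m + 1) * (T + 4) = m * (T + 4) + (T + 4) := by ring
      omega
  set σ₁ := σ.setReg i 0 with hσ₁
  have hb₁ : σ₁.reg b = B := by rw [hσ₁, State.setReg_reg_of_ne _ _ hib.symm, hb]
  have hi₁ : σ₁.reg i = 0 := by simp [hσ₁]
  set σ₂ := σ₁.setReg c (if 0 < B then 1 else 0) with hσ₂
  have e₂ : Exec w (.op .lt c i b) σ₁ 1 σ₂ := by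
    have := Exec.op (w := w) σ₁ .lt c i b (by simp only [Op.eval]; split_ifs <;> omega)
    simpa only [Op.eval, hi₁, hb₁] using this
  obtain ⟨u, υ, hu, hIu, hut⟩ := key B 0 (by simp) σ₂ ((hI _ _ _ ((hI _ _ _ h0).1)).2)
    (by rw [hσ₂, State.setReg_reg_of_ne _ _ hic, hi₁])
    (by rw [hσ₂, State.setReg_reg_of_ne _ _ hbc, hb₁]) (by simp [hσ₂])
  exact ⟨1 + (1 + u), υ, .seq (.const _ _ _ (by omega)) (.seq e₂ hu), hIu, by omega⟩

/-! ### Families of configurations -/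

/-- A family of situations in which a piece of a program is run: the values of finitely many
variables, which are kept in registers, the contents of the memory, and a size, in terms of which
word length and running time are measured. -/
structure Fam where
  Idx : Type
  size : Idx → ℕ
  arity : ℕ
  var : Idx → ℕ → ℕ
  mem : Idx → ℕ → ℕ

namespace Fam

/-- The configuration `σ` realizes the situation `a`, with the variables in the registers
`loc 0, loc 1, …`. -/
def Holds (Γ : Fam) (loc : ℕ → ℕ) (a : Γ.Idx) (σ : State) : Prop :=
  (∀ i < Γ.arity, σ.reg (loc i) = Γ.var a i) ∧ σ.mem = Γ.mem a

/-- Values that fit into `O(size)` bits. -/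
def ExpB (Γ : Fam) (f : Γ.Idx → ℕ) : Prop :=
  ∃ C : ℕ, ∀ a, f a < 2 ^ (C * (Γ.size a + 1))

/-- Values that are polynomially bounded in the size. -/
def PolyB (Γ : Fam) (f : Γ.Idx → ℕ) : Prop :=
  ∃ C : ℕ, ∀ a, f a ≤ (Γ.size a + 2) ^ C

/-- `p` computes `f` into register `K` in polynomial time, and has no effect on smaller registers
and on the memory. -/
def Evals (Γ : Fam) (K : ℕ) (loc : ℕ → ℕ) (p : Prog) (C : ℕ) (f : Γ.Idx → ℕ) : Prop :=
  ∀ a σ, Γ.Holds loc a σ → ∃ t τ, Exec (C * (Γ.size a + 1)) p σ t τ ∧ τ.reg K = f a ∧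
    (∀ r < K, τ.reg r = σ.reg r) ∧ τ.mem = σ.mem ∧ t ≤ (Γ.size a + 2) ^ C

/-- The function `f` is computable in polynomial time on words of `O(size)` bits. -/
def Comp (Γ : Fam) (f : Γ.Idx → ℕ) : Prop :=
  Γ.ExpB f ∧ ∀ K loc, (∀ i < Γ.arity, loc i < K) → ∃ p C, Γ.Evals K loc p C f

/-- `p` makes the memory satisfy `Q`, in time `tm` up to a polynomial factor, and has no effect on
registers below `K`. -/
def Runs (Γ : Fam) (K : ℕ) (loc : ℕ → ℕ) (p : Prog) (C : ℕ) (tm : Γ.Idx → ℕ)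
    (Q : Γ.Idx → (ℕ → ℕ) → Prop) : Prop :=
  ∀ a σ, Γ.Holds loc a σ → ∃ t τ, Exec (C * (Γ.size a + 1)) p σ t τ ∧
    (∀ r < K, τ.reg r = σ.reg r) ∧ Q a τ.mem ∧ t ≤ (Γ.size a + 2) ^ C * tm a

/-- There is a program that makes the memory satisfy `Q`, in time `tm` up to a polynomial factor. -/
def Does (Γ : Fam) (tm : Γ.Idx → ℕ) (Q : Γ.Idx → (ℕ → ℕ) → Prop) : Prop :=
  ∀ K loc, (∀ i < Γ.arity, loc i < K) → ∃ p C, Γ.Runs K loc p C tm Q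

/-- Situations of `Γ` with additional data. -/
abbrev pull (Γ : Fam) {α : Type} (π : α → Γ.Idx) : Fam where
  Idx := α
  size a := Γ.size (π a)
  arity := Γ.arity
  var a := Γ.var (π a)
  mem a := Γ.mem (π a)

/-- An additional variable. -/
abbrev push (Γ : Fam) (v : Γ.Idx → ℕ) : Fam where
  Idx := Γ.Idx
  size := Γ.size
  arity := Γ.arity + 1
  var a i := if i < Γ.arity then Γ.var a i else v a
  mem := Γ.mem

/-- The body of a loop over `i < b`. -/
abbrev loop (Γ : Fam) (b : Γ.Idx → ℕ) : Fam :=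
  (Γ.pull (fun p : {p : Γ.Idx × ℕ // p.2 < b p.1} => p.1.1)).push fun p => p.1.2

/-- The situations after a change of the memory. -/
abbrev withMem (Γ : Fam) (Q : Γ.Idx → (ℕ → ℕ) → Prop) : Fam where
  Idx := {p : Γ.Idx × (ℕ → ℕ) // Q p.1 p.2}
  size p := Γ.size p.1.1
  arity := Γ.arity
  var p := Γ.var p.1.1
  mem p := p.1.2

variable {Γ : Fam}

theorem push_var_of_lt (v : Γ.Idx → ℕ) (a : Γ.Idx) {i : ℕ} (hi : i < Γ.arity) :
    (Γ.push v).var a i = Γ.var a i := if_pos hi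

theorem push_var_arity (v : Γ.Idx → ℕ) (a : Γ.Idx) : (Γ.push v).var a Γ.arity = v a :=
  if_neg (lt_irrefl _)

theorem word_mono {C D : ℕ} (h : C ≤ D) (s : ℕ) : C * (s + 1) ≤ D * (s + 1) :=
  Nat.mul_le_mul_right _ h

theorem time_mono {C D : ℕ} (h : C ≤ D) (s : ℕ) : (s + 2) ^ C ≤ (s + 2) ^ D :=
  Nat.pow_le_pow_right (by omega) h

theorem one_le_time (C s : ℕ) : 1 ≤ (s + 2) ^ C := Nat.one_le_pow _ _ (by omega)

theorem two_mul_time_le (C s : ℕ) : 2 * (s + 2) ^ C ≤ (s + 2) ^ (C + 1) := by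
  rw [pow_succ, mul_comm]
  exact Nat.mul_le_mul_left _ (by omega)

theorem ExpB.le {f g : Γ.Idx → ℕ} (h : Γ.ExpB g) (hfg : ∀ a, f a ≤ g a) : Γ.ExpB f :=
  let ⟨C, hC⟩ := h
  ⟨C, fun a => (hfg a).trans_lt (hC a)⟩

theorem ExpB.mono {f : Γ.Idx → ℕ} {C D : ℕ} (h : ∀ a, f a < 2 ^ (C * (Γ.size a + 1)))
    (hCD : C ≤ D) (a : Γ.Idx) : f a < 2 ^ (D * (Γ.size a + 1)) :=
  (h a).trans_le (Nat.pow_le_pow_right two_pos (word_mono hCD _))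

theorem ExpB.const (v : ℕ) : Γ.ExpB fun _ => v :=
  ⟨v, fun _ => Nat.lt_two_pow_self.trans_le
    (Nat.pow_le_pow_right two_pos (Nat.le_mul_of_pos_right _ (by omega)))⟩

theorem ExpB.mul {f g : Γ.Idx → ℕ} (hf : Γ.ExpB f) (hg : Γ.ExpB g) :
    Γ.ExpB fun a => f a * g a := by
  obtain ⟨C, hC⟩ := hf
  obtain ⟨D, hD⟩ := hg
  refine ⟨C + D, fun a => ?_⟩
  rw [add_mul, pow_add]
  exact Nat.mul_lt_mul'' (hC a) (hD a)

theorem ExpB.add {f g : Γ.Idx → ℕ} (hf : Γ.ExpB f) (hg : Γ.ExpB g) :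
    Γ.ExpB fun a => f a + g a := by
  obtain ⟨C, hC⟩ := hf
  obtain ⟨D, hD⟩ := hg
  refine ⟨C + D + 1, fun a => ?_⟩
  have h1 := ExpB.mono hC (show C ≤ C + D by omega) a
  have h2 := ExpB.mono hD (show D ≤ C + D by omega) a
  calc f a + g a < 2 ^ ((C + D) * (Γ.size a + 1)) * 2 := by omega
    _ = 2 ^ ((C + D) * (Γ.size a + 1) + 1) := by rw [pow_succ]
    _ ≤ 2 ^ ((C + D + 1) * (Γ.size a + 1)) := by
      apply Nat.pow_le_pow_right two_pos
      nlinarith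

theorem PolyB.le {f g : Γ.Idx → ℕ} (h : Γ.PolyB g) (hfg : ∀ a, f a ≤ g a) : Γ.PolyB f :=
  let ⟨C, hC⟩ := h
  ⟨C, fun a => (hfg a).trans (hC a)⟩

theorem PolyB.const (v : ℕ) : Γ.PolyB fun _ => v :=
  ⟨v, fun _ => Nat.lt_two_pow_self.le.trans (Nat.pow_le_pow_left (by omega) _)⟩

theorem PolyB.size : Γ.PolyB Γ.size := ⟨1, fun a => by rw [pow_one]; omega⟩

theorem PolyB.mul {f g : Γ.Idx → ℕ} (hf : Γ.PolyB f) (hg : Γ.PolyB g) :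
    Γ.PolyB fun a => f a * g a := by
  obtain ⟨C, hC⟩ := hf
  obtain ⟨D, hD⟩ := hg
  exact ⟨C + D, fun a => by rw [pow_add]; exact Nat.mul_le_mul (hC a) (hD a)⟩

theorem PolyB.add {f g : Γ.Idx → ℕ} (hf : Γ.PolyB f) (hg : Γ.PolyB g) :
    Γ.PolyB fun a => f a + g a := by
  obtain ⟨C, hC⟩ := hf
  obtain ⟨D, hD⟩ := hg
  refine ⟨C + D + 1, fun a => ?_⟩
  have h1 := time_mono (show C ≤ C + D by omega) (Γ.size a)
  have h2 := time_mono (show D ≤ C + D by omega) (Γ.size a)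
  have := two_mul_time_le (C + D) (Γ.size a)
  have := hC a
  have := hD a
  dsimp only
  omega

theorem PolyB.pow {f : Γ.Idx → ℕ} (hf : Γ.PolyB f) (m : ℕ) : Γ.PolyB fun a => f a ^ m := by
  obtain ⟨C, hC⟩ := hf
  exact ⟨C * m, fun a => by rw [pow_mul]; exact Nat.pow_le_pow_left (hC a) _⟩

/-- From `s + 2 ≤ 2 ^ (s + 1)`. Hence polynomially bounded values always fit into words of linear
length. -/
theorem time_lt_two_pow (C s : ℕ) : (s + 2) ^ C < 2 ^ ((2 * C + 1) * (s + 1)) := by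
  have h : s + 2 ≤ 2 ^ (s + 1) := Nat.lt_two_pow_self (n := s + 1)
  calc (s + 2) ^ C ≤ (2 ^ (s + 1)) ^ C := Nat.pow_le_pow_left h _
    _ = 2 ^ ((s + 1) * C) := by rw [pow_mul]
    _ < 2 ^ ((2 * C + 1) * (s + 1)) := by
      apply Nat.pow_lt_pow_right (by omega)
      nlinarith

theorem PolyB.expB {f : Γ.Idx → ℕ} (hf : Γ.PolyB f) : Γ.ExpB f := by
  obtain ⟨C, hC⟩ := hf
  exact ⟨2 * C + 1, fun a => (hC a).trans_lt (time_lt_two_pow _ _)⟩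

theorem ExpB.two_pow {f : Γ.Idx → ℕ} {C : ℕ} (h : ∀ a, f a ≤ C * (Γ.size a + 1)) :
    Γ.ExpB fun a => 2 ^ f a :=
  ⟨C + 1, fun a => Nat.pow_lt_pow_right (by omega) (by have := h a; nlinarith)⟩

/-! ### Closure properties of `Comp` -/

theorem Comp.expB {f : Γ.Idx → ℕ} (h : Γ.Comp f) : Γ.ExpB f := h.1

theorem Comp.congr {f g : Γ.Idx → ℕ} (h : Γ.Comp f) (hfg : ∀ a, g a = f a) : Γ.Comp g := by
  obtain rfl : g = f := funext hfg
  exact h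

theorem Comp.const (v : ℕ) : Γ.Comp fun _ => v := by
  obtain ⟨C, hC⟩ := ExpB.const (Γ := Γ) v
  refine ⟨⟨C, hC⟩, fun K loc _ => ⟨.const K v, C, fun a σ _ => ⟨1, _, .const _ _ _ (hC a), ?_⟩⟩⟩
  exact ⟨by simp, fun r hr => State.setReg_reg_of_ne _ _ hr.ne, rfl, one_le_time _ _⟩

/-- Registers serve as a stack: the first operand stays in `K` while the second one is computed into
`K + 1`, because an evaluation leaves all registers below its target alone. -/
theorem Comp.op (o : Op) {f g : Γ.Idx → ℕ} (hf : Γ.Comp f) (hg : Γ.Comp g)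
    (hB : Γ.ExpB fun a => o.eval (f a) (g a)) : Γ.Comp fun a => o.eval (f a) (g a) := by
  refine ⟨hB, fun K loc hloc => ?_⟩
  obtain ⟨p, C, hp⟩ := hf.2 K loc hloc
  obtain ⟨q, D, hq⟩ := hg.2 (K + 1) loc fun i hi => (hloc i hi).trans (by omega)
  obtain ⟨E, hE⟩ := hB
  refine ⟨.seq p (.seq q (.op o K K (K + 1))), C + D + E + 2, fun a σ hσ => ?_⟩
  obtain ⟨t, τ, h1, h2, h3, h4, h5⟩ := hp a σ hσ
  obtain ⟨u, υ, k1, k2, k3, k4, k5⟩ := hq a τ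
    ⟨fun i hi => (h3 _ (hloc i hi)).trans (hσ.1 i hi), h4.trans hσ.2⟩
  have hK : υ.reg K = f a := (k3 K (by omega)).trans h2
  have e3 : Exec ((C + D + E + 2) * (Γ.size a + 1)) (.op o K K (K + 1)) υ 1
      (υ.setReg K (o.eval (f a) (g a))) := by
    have := Exec.op (w := (C + D + E + 2) * (Γ.size a + 1)) υ o K K (K + 1)
      (by rw [hK, k2]; exact ExpB.mono hE (by omega) a)
    rwa [hK, k2] at this
  refine ⟨_, _, .seq (h1.mono_word (word_mono (by omega) _))
    (.seq (k1.mono_word (word_mono (by omega) _)) e3), by simp, fun r hr => ?_, ?_, ?_⟩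
  · rw [State.setReg_reg_of_ne _ _ hr.ne, k3 r (by omega), h3 r hr]
  · exact k4.trans h4
  · have h1 := time_mono (show C ≤ C + D + E by omega) (Γ.size a)
    have h2 := time_mono (show D ≤ C + D + E by omega) (Γ.size a)
    have h3 := two_mul_time_le (C + D + E) (Γ.size a)
    have h4 := two_mul_time_le (C + D + E + 1) (Γ.size a)
    have h5 := one_le_time (C + D + E) (Γ.size a)
    rw [show C + D + E + 2 = C + D + E + 1 + 1 by ring]
    omega

theorem Comp.load {f : Γ.Idx → ℕ} (hf : Γ.Comp f) (hB : Γ.ExpB fun a => Γ.mem a (f a)) :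
    Γ.Comp fun a => Γ.mem a (f a) := by
  refine ⟨hB, fun K loc hloc => ?_⟩
  obtain ⟨p, C, hp⟩ := hf.2 K loc hloc
  obtain ⟨E, hE⟩ := hB
  refine ⟨.seq p (.load K K), C + E + 1, fun a σ hσ => ?_⟩
  obtain ⟨t, τ, h1, h2, h3, h4, h5⟩ := hp a σ hσ
  have hm : τ.mem (τ.reg K) = Γ.mem a (f a) := by rw [h4, hσ.2, h2]
  refine ⟨_, _, .seq (h1.mono_word (word_mono (by omega) _))
    (.load _ _ _ (by rw [hm]; exact ExpB.mono hE (by omega) a)), by simp [hm], fun r hr => ?_,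
    h4, ?_⟩
  · rw [State.setReg_reg_of_ne _ _ hr.ne, h3 r hr]
  · have h1 := time_mono (show C ≤ C + E by omega) (Γ.size a)
    have h3 := two_mul_time_le (C + E) (Γ.size a)
    have h5 := one_le_time (C + E) (Γ.size a)
    omega

theorem Comp.ite {c f g : Γ.Idx → ℕ} (hc : Γ.Comp c) (hf : Γ.Comp f) (hg : Γ.Comp g) :
    Γ.Comp fun a => if c a ≠ 0 then f a else g a := by
  refine ⟨(hf.1.add hg.1).le fun a => by split_ifs <;> omega, fun K loc hloc => ?_⟩
  obtain ⟨p, C, hp⟩ := hc.2 K loc hloc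
  obtain ⟨q, D, hq⟩ := hf.2 K loc hloc
  obtain ⟨r, E, hr⟩ := hg.2 K loc hloc
  refine ⟨.seq p (.ite K q r), C + D + E + 2, fun a σ hσ => ?_⟩
  obtain ⟨t, τ, h1, h2, h3, h4, h5⟩ := hp a σ hσ
  have hτ : Γ.Holds loc a τ := ⟨fun i hi => (h3 _ (hloc i hi)).trans (hσ.1 i hi), h4.trans hσ.2⟩
  have i1 := time_mono (show C ≤ C + D + E by omega) (Γ.size a)
  have i2 := time_mono (show D ≤ C + D + E by omega) (Γ.size a)
  have i3 := time_mono (show E ≤ C + D + E by omega) (Γ.size a)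
  have i4 := two_mul_time_le (C + D + E) (Γ.size a)
  have i5 := two_mul_time_le (C + D + E + 1) (Γ.size a)
  have i6 := one_le_time (C + D + E) (Γ.size a)
  by_cases h : c a = 0
  · obtain ⟨u, υ, k1, k2, k3, k4, k5⟩ := hr a τ hτ
    refine ⟨_, _, .seq (h1.mono_word (word_mono (by omega) _))
      (.ite_false (h2.trans h) (k1.mono_word (word_mono (by omega) _))), by simp [h, k2],
      fun r hr => (k3 r hr).trans (h3 r hr), k4.trans h4, ?_⟩
    rw [show C + D + E + 2 = C + D + E + 1 + 1 by ring]
    omega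
  · obtain ⟨u, υ, k1, k2, k3, k4, k5⟩ := hq a τ hτ
    refine ⟨_, _, .seq (h1.mono_word (word_mono (by omega) _))
      (.ite_true (by rwa [h2]) (k1.mono_word (word_mono (by omega) _))), by simp [h, k2],
      fun r hr => (k3 r hr).trans (h3 r hr), k4.trans h4, ?_⟩
    rw [show C + D + E + 2 = C + D + E + 1 + 1 by ring]
    omega

theorem Comp.pull {f : Γ.Idx → ℕ} (hf : Γ.Comp f) {α : Type} (π : α → Γ.Idx) :
    (Γ.pull π).Comp fun a => f (π a) := by
  obtain ⟨⟨D, hD⟩, hf⟩ := hf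
  refine ⟨⟨D, fun a => hD (π a)⟩, fun K loc hloc => ?_⟩
  obtain ⟨p, C, hp⟩ := hf K loc hloc
  exact ⟨p, C, fun a σ hσ => hp (π a) σ hσ⟩

theorem Comp.push {f : Γ.Idx → ℕ} (hf : Γ.Comp f) (v : Γ.Idx → ℕ) : (Γ.push v).Comp f := by
  refine ⟨hf.1, fun K loc hloc => ?_⟩
  obtain ⟨p, C, hp⟩ := hf.2 K loc fun i hi => hloc i (hi.trans (Nat.lt_succ_self _))
  refine ⟨p, C, fun a σ hσ => hp a σ ⟨fun i hi => ?_, hσ.2⟩⟩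
  rw [hσ.1 i (hi.trans (Nat.lt_succ_self _))]
  exact push_var_of_lt v a hi

theorem Comp.var {i : ℕ} (hi : i < Γ.arity) (hB : Γ.ExpB fun a => Γ.var a i) :
    Γ.Comp fun a => Γ.var a i := by
  obtain ⟨C, hC⟩ := hB
  -- The bitwise `or` of a register with itself serves as a move instruction.
  refine ⟨⟨C, hC⟩, fun K loc _ => ⟨.op .or K (loc i) (loc i), C, fun a σ hσ => ?_⟩⟩
  have hv : Op.or.eval (σ.reg (loc i)) (σ.reg (loc i)) = Γ.var a i := by
    simp [Op.eval, hσ.1 i hi]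
  refine ⟨1, _, .op _ _ _ _ _ (by rw [hv]; exact hC a), by simp [hv],
    fun r hr => State.setReg_reg_of_ne _ _ hr.ne, rfl, one_le_time _ _⟩

theorem Comp.push_var {v : Γ.Idx → ℕ} (hB : Γ.ExpB v) : (Γ.push v).Comp v := by
  have h : ∀ a, v a = (Γ.push v).var a Γ.arity := fun a => (push_var_arity v a).symm
  exact (Comp.var (Γ := Γ.push v) (i := Γ.arity) (Nat.lt_succ_self _)
    (hB.le fun a => (h a).ge)).congr h

theorem Comp.loop_var {b : Γ.Idx → ℕ} (hb : Γ.ExpB b) : (Γ.loop b).Comp fun p => p.1.2 := by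
  obtain ⟨C, hC⟩ := hb
  exact Comp.push_var ⟨C, fun p => (p.2.le).trans_lt (hC p.1.1)⟩

theorem Comp.lift {f : Γ.Idx → ℕ} (hf : Γ.Comp f) (b : Γ.Idx → ℕ) :
    (Γ.loop b).Comp fun p => f p.1.1 := (hf.pull _).push _

theorem Holds.congr {loc : ℕ → ℕ} {K : ℕ} (hloc : ∀ i < Γ.arity, loc i < K) {a : Γ.Idx}
    {σ τ : State} (h : Γ.Holds loc a σ) (hr : ∀ r < K, τ.reg r = σ.reg r) (hm : τ.mem = σ.mem) :
    Γ.Holds loc a τ :=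
  ⟨fun i hi => (hr _ (hloc i hi)).trans (h.1 i hi), hm.trans h.2⟩

/-- Primitive recursion with polynomially many rounds. The accumulator is an additional variable
whose value is known to be `F a i`, so the step only has to be correct, and to fit into words, on
values that really occur. Sums, counting, quantifiers, search and powers all reduce to this. -/
theorem Comp.fold {b : Γ.Idx → ℕ} (hb : Γ.Comp b) (hbP : Γ.PolyB b) (F : Γ.Idx → ℕ → ℕ)
    (h0 : Γ.Comp fun a => F a 0)
    (hs : ((Γ.loop b).push fun p => F p.1.1 p.1.2).Comp fun p => F p.1.1 (p.1.2 + 1)) :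
    Γ.Comp fun a => F a (b a) := by
  obtain ⟨⟨C₀, hC₀⟩, h0⟩ := h0
  obtain ⟨⟨C₁, hC₁⟩, hs⟩ := hs
  constructor
  -- The final value is the initial one, or the result of the last step; both have linear length.
  · refine ⟨C₀ + C₁, fun a => ?_⟩
    dsimp only
    rcases h : b a with _ | m
    · exact (hC₀ a).trans_le (Nat.pow_le_pow_right two_pos (word_mono (Nat.le_add_right _ C₁) _))
    · have h2 := (hC₁ ⟨(a, m), by simp [h]⟩).trans_le
        (Nat.pow_le_pow_right two_pos (word_mono (Nat.le_add_left _ C₀) _))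
      exact h2
  intro K loc hloc
  obtain ⟨⟨Cb, hCb⟩, hb⟩ := hb
  obtain ⟨Cp, hCp⟩ := hbP
  obtain ⟨p₀, D₀, hp₀⟩ := h0 K loc hloc
  obtain ⟨pb, Db, hpb⟩ := hb (K + 2) loc fun i hi => (hloc i hi).trans (by omega)
  -- `K` holds the accumulator, `K + 1` the counter, `K + 2` and `K + 3` the bound and the
  -- condition; the step works from `K + 4` on.
  set loc' : ℕ → ℕ := fun i =>
    if i < Γ.arity then loc i else if i = Γ.arity then K + 1 else K with hloc'
  obtain ⟨ps, Ds, hps⟩ := hs (K + 4) loc' (by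
    intro i hi
    simp only [hloc']
    split_ifs with h1 h2
    · exact (hloc i h1).trans (by omega)
    · omega
    · omega)
  set E := D₀ + Db + Ds + Cb + Cp + C₀ + C₁ + 1 with hE
  refine ⟨.seq p₀ (.seq pb (forProg (K + 1) (K + 2) (K + 3)
    (.seq ps (.op .or K (K + 4) (K + 4))))), 2 * E + 6, fun a σ hσ => ?_⟩
  obtain ⟨t₀, τ₀, e₀, hr₀, hk₀, hm₀, ht₀⟩ := hp₀ a σ hσ
  have hτ₀ := hσ.congr hloc hk₀ hm₀
  obtain ⟨tb, τb, eb, hrb, hkb, hmb, htb⟩ := hpb a τ₀ hτ₀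
  set w := (2 * E + 6) * (Γ.size a + 1) with hw
  obtain ⟨t, τ, e, hI, ht⟩ := exec_forProg (w := w) (i := K + 1) (b := K + 2) (c := K + 3)
    (B := b a) (T := (Γ.size a + 2) ^ Ds + 1) (body := .seq ps (.op .or K (K + 4) (K + 4)))
    (by omega) (by omega) (by omega) (ExpB.mono hCb (by omega) a) (by positivity)
    (fun j τ => j ≤ b a → τ.reg K = F a j ∧ (∀ r < K, τ.reg r = σ.reg r) ∧ τ.mem = σ.mem)
    (by
      intro j τ v h
      constructor <;> intro hj <;> obtain ⟨h1, h2, h3⟩ := h hj <;>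
        refine ⟨?_, fun r hr => ?_, h3⟩ <;> rw [State.setReg_reg_of_ne _ _ (by omega)]
      · exact h1
      · exact h2 r hr
      · exact h1
      · exact h2 r hr)
    (by
      intro j hj τ h hi hbτ
      obtain ⟨h1, h2, h3⟩ := h hj.le
      obtain ⟨u, υ, k1, k2, k3, k4, k5⟩ := hps ⟨(a, j), hj⟩ τ (by
        refine ⟨fun i hi' => ?_, h3.trans hσ.2⟩
        rcases Nat.lt_trichotomy i Γ.arity with c | c | c
        · have e1 : loc' i = loc i := if_pos c
          rw [e1, h2 _ (hloc i c), hσ.1 i c]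
          simp [c, show i < Γ.arity + 1 by omega]
        · have e1 : loc' i = K + 1 := by simp [hloc', c]
          rw [e1, hi, c]
          simp
        · obtain rfl : i = Γ.arity + 1 := by
            have : i < Γ.arity + 1 + 1 := hi'
            omega
          have e1 : loc' (Γ.arity + 1) = K := by simp [hloc']
          rw [e1, h1]
          simp)
      have hv : Op.or.eval (υ.reg (K + 4)) (υ.reg (K + 4)) = F a (j + 1) := by
        simp [Op.eval, k2]
      refine ⟨_, _, .seq (k1.mono_word (word_mono (by omega) _)) (.op _ _ _ _ _ (by
        rw [hv]
        exact (hC₁ ⟨(a, j), hj⟩).trans_le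
          (Nat.pow_le_pow_right two_pos (word_mono (by omega) _)))), ?_, ?_, ?_, ?_⟩
      · exact Nat.add_le_add_right k5 _
      · rw [State.setReg_reg_of_ne _ _ (by omega), k3 _ (by omega), hi]
      · rw [State.setReg_reg_of_ne _ _ (by omega), k3 _ (by omega), hbτ]
      · intro _
        refine ⟨by simp [hv], fun r hr => ?_, k4.trans h3⟩
        rw [State.setReg_reg_of_ne _ _ hr.ne, k3 _ (by omega), h2 r hr])
    τb (fun _ => ⟨(hkb K (by omega)).trans hr₀,
      fun r hr => (hkb r (by omega)).trans (hk₀ r hr), hmb.trans hm₀⟩) hrb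
  obtain ⟨h1, h2, h3⟩ := hI le_rfl
  refine ⟨_, _, .seq (e₀.mono_word (word_mono (by omega) _))
    (.seq (eb.mono_word (word_mono (by omega) _)) e), h1, h2, h3, ?_⟩
  have i0 := ht₀.trans (time_mono (show D₀ ≤ E by omega) (Γ.size a))
  have i1 := htb.trans (time_mono (show Db ≤ E by omega) (Γ.size a))
  have i2 := time_mono (show Ds ≤ E by omega) (Γ.size a)
  have i3 := (hCp a).trans (time_mono (show Cp ≤ E by omega) (Γ.size a))
  have i4 := one_le_time E (Γ.size a)
  have i5 : b a * ((Γ.size a + 2) ^ Ds + 1 + 4) ≤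
      (Γ.size a + 2) ^ E * (6 * (Γ.size a + 2) ^ E) := Nat.mul_le_mul i3 (by omega)
  have i6 : (Γ.size a + 2) ^ (2 * E + 6) =
      (Γ.size a + 2) ^ E * (Γ.size a + 2) ^ E * (Γ.size a + 2) ^ 6 := by ring
  have i7 : 64 ≤ (Γ.size a + 2) ^ 6 := by
    calc 64 = 2 ^ 6 := by norm_num
      _ ≤ _ := Nat.pow_le_pow_left (by omega) _
  rw [i6]
  generalize (Γ.size a + 2) ^ E = X at *
  have i8 : X ≤ X * X := Nat.le_mul_of_pos_right _ (by omega)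
  have i9 : X * X * 64 ≤ X * X * (Γ.size a + 2) ^ 6 := Nat.mul_le_mul_left _ i7
  have i10 : X * (6 * X) = 6 * (X * X) := by ring
  omega

/-! ### Rules for programs that change the memory -/

theorem Does.weaken {tm tm' : Γ.Idx → ℕ} {Q Q' : Γ.Idx → (ℕ → ℕ) → Prop} (h : Γ.Does tm Q)
    (ht : ∀ a, tm a ≤ tm' a) (hQ : ∀ a μ, Q a μ → Q' a μ) : Γ.Does tm' Q' := fun K loc hloc => by
  obtain ⟨p, C, hp⟩ := h K loc hloc
  refine ⟨p, C, fun a σ hσ => ?_⟩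
  obtain ⟨t, τ, h1, h2, h3, h4⟩ := hp a σ hσ
  exact ⟨t, τ, h1, h2, hQ _ _ h3, h4.trans (Nat.mul_le_mul_left _ (ht a))⟩

theorem Does.store {x v : Γ.Idx → ℕ} (hx : Γ.Comp x) (hv : Γ.Comp v) :
    Γ.Does (fun _ => 1) fun a μ => μ = Function.update (Γ.mem a) (x a) (v a) := by
  intro K loc hloc
  obtain ⟨p, C, hp⟩ := hx.2 K loc hloc
  obtain ⟨q, D, hq⟩ := hv.2 (K + 1) loc fun i hi => (hloc i hi).trans (by omega)
  refine ⟨.seq p (.seq q (.store K (K + 1))), C + D + 2, fun a σ hσ => ?_⟩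
  obtain ⟨t, τ, h1, h2, h3, h4, h5⟩ := hp a σ hσ
  obtain ⟨u, υ, k1, k2, k3, k4, k5⟩ := hq a τ (hσ.congr hloc h3 h4)
  refine ⟨_, _, .seq (h1.mono_word (word_mono (by omega) _))
    (.seq (k1.mono_word (word_mono (by omega) _)) (.store _ _ _)), fun r hr => ?_, ?_, ?_⟩
  · exact (k3 r (by omega)).trans (h3 r hr)
  · rw [State.setMem_mem, k4, h4, hσ.2, k3 K (by omega), h2, k2]
  · have h1 := time_mono (show C ≤ C + D by omega) (Γ.size a)
    have h2 := time_mono (show D ≤ C + D by omega) (Γ.size a)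
    have h3 := two_mul_time_le (C + D) (Γ.size a)
    have h4 := two_mul_time_le (C + D + 1) (Γ.size a)
    have h5 := one_le_time (C + D) (Γ.size a)
    rw [show C + D + 2 = C + D + 1 + 1 by ring, mul_one]
    omega

/-- The second program is analysed in situations that carry the intermediate memory and a proof of
`Q`, so that what the first program guarantees is at hand there. -/
theorem Does.seq {tm₁ tm₂ : Γ.Idx → ℕ} {Q : Γ.Idx → (ℕ → ℕ) → Prop}
    {Q' : (Γ.withMem Q).Idx → (ℕ → ℕ) → Prop}
    (h₁ : Γ.Does tm₁ Q) (h₂ : (Γ.withMem Q).Does (fun p => tm₂ p.1.1) Q') :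
    Γ.Does (fun a => tm₁ a + tm₂ a) fun a μ => ∃ ν, ∃ h : Q a ν, Q' ⟨(a, ν), h⟩ μ := by
  intro K loc hloc
  obtain ⟨p, C, hp⟩ := h₁ K loc hloc
  obtain ⟨q, D, hq⟩ := h₂ K loc hloc
  refine ⟨.seq p q, C + D, fun a σ hσ => ?_⟩
  obtain ⟨t, τ, h1, h2, h3, h4⟩ := hp a σ hσ
  obtain ⟨u, υ, k1, k2, k3, k4⟩ := hq ⟨(a, τ.mem), h3⟩ τ
    ⟨fun i hi => (h2 _ (hloc i hi)).trans (hσ.1 i hi), rfl⟩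
  refine ⟨_, _, .seq (h1.mono_word (word_mono (by omega) _))
    (k1.mono_word (word_mono (by omega) _)), fun r hr => (k2 r hr).trans (h2 r hr),
    ⟨τ.mem, h3, k3⟩, ?_⟩
  rw [mul_add]
  exact Nat.add_le_add (h4.trans (Nat.mul_le_mul_right _ (time_mono (by omega) _)))
    (k4.trans (Nat.mul_le_mul_right _ (time_mono (by omega) _)))

theorem Does.letVar {v tm : Γ.Idx → ℕ} {Q : Γ.Idx → (ℕ → ℕ) → Prop} (hv : Γ.Comp v)
    (htm : ∀ a, 1 ≤ tm a) (h : (Γ.push v).Does tm Q) : Γ.Does tm Q := by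
  intro K loc hloc
  obtain ⟨p, C, hp⟩ := hv.2 K loc hloc
  obtain ⟨q, D, hq⟩ := h (K + 1) (fun i => if i < Γ.arity then loc i else K) (by
    intro i _
    split_ifs with h1
    · exact (hloc i h1).trans (by omega)
    · omega)
  refine ⟨.seq p q, C + D + 1, fun a σ hσ => ?_⟩
  obtain ⟨t, τ, h1, h2, h3, h4, h5⟩ := hp a σ hσ
  obtain ⟨u, υ, k1, k2, k3, k4⟩ := hq a τ (by
    refine ⟨fun i hi => ?_, h4.trans hσ.2⟩
    dsimp only
    split_ifs with c
    · exact (h3 _ (hloc i c)).trans (hσ.1 i c)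
    · exact h2)
  refine ⟨_, _, .seq (h1.mono_word (word_mono (by omega) _))
    (k1.mono_word (word_mono (by omega) _)), fun r hr => (k2 r (by omega)).trans (h3 r hr),
    k3, ?_⟩
  have i1 := time_mono (show C ≤ C + D by omega) (Γ.size a)
  have i2 := k4.trans (Nat.mul_le_mul_right (tm a)
    (time_mono (show D ≤ C + D by omega) (Γ.size a)))
  have i3 := Nat.mul_le_mul_right (tm a) (two_mul_time_le (C + D) (Γ.size a))
  have i4 := Nat.le_mul_of_pos_right ((Γ.size a + 2) ^ (C + D)) (htm a)
  rw [mul_assoc] at i3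
  omega

theorem Does.cond {c tm : Γ.Idx → ℕ} {Q : Γ.Idx → (ℕ → ℕ) → Prop} (hc : Γ.Comp c)
    (htm : ∀ a, 1 ≤ tm a)
    (h₁ : (Γ.pull (fun a : {a // c a ≠ 0} => a.1)).Does (fun a => tm a.1) fun a => Q a.1)
    (h₂ : (Γ.pull (fun a : {a // c a = 0} => a.1)).Does (fun a => tm a.1) fun a => Q a.1) :
    Γ.Does tm Q := by
  intro K loc hloc
  obtain ⟨p, C, hp⟩ := hc.2 K loc hloc
  obtain ⟨q, D, hq⟩ := h₁ K loc hloc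
  obtain ⟨r, E, hr⟩ := h₂ K loc hloc
  refine ⟨.seq p (.ite K q r), C + D + E + 2, fun a σ hσ => ?_⟩
  obtain ⟨t, τ, h1, h2, h3, h4, h5⟩ := hp a σ hσ
  have hτ := hσ.congr hloc h3 h4
  have i1 := time_mono (show C ≤ C + D + E by omega) (Γ.size a)
  have i2 := Nat.mul_le_mul_right (tm a) (time_mono (show D ≤ C + D + E by omega) (Γ.size a))
  have i3 := Nat.mul_le_mul_right (tm a) (time_mono (show E ≤ C + D + E by omega) (Γ.size a))
  have i4 := Nat.mul_le_mul_right (tm a) (two_mul_time_le (C + D + E) (Γ.size a))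
  have i5 := Nat.mul_le_mul_right (tm a) (two_mul_time_le (C + D + E + 1) (Γ.size a))
  have i6 := Nat.le_mul_of_pos_right ((Γ.size a + 2) ^ (C + D + E)) (htm a)
  have i7 := one_le_time (C + D + E) (Γ.size a)
  rw [mul_assoc] at i4 i5
  by_cases h : c a = 0
  · obtain ⟨u, υ, k1, k2, k3, k4⟩ := hr ⟨a, h⟩ τ hτ
    refine ⟨_, _, .seq (h1.mono_word (word_mono (by omega) _))
      (.ite_false (h2.trans h) (k1.mono_word (word_mono (by omega) _))),
      fun r hr => (k2 r hr).trans (h3 r hr), k3, ?_⟩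
    rw [show C + D + E + 2 = C + D + E + 1 + 1 by ring]
    dsimp only at k4
    omega
  · obtain ⟨u, υ, k1, k2, k3, k4⟩ := hq ⟨a, h⟩ τ hτ
    refine ⟨_, _, .seq (h1.mono_word (word_mono (by omega) _))
      (.ite_true (by rwa [h2]) (k1.mono_word (word_mono (by omega) _))),
      fun r hr => (k2 r hr).trans (h3 r hr), k3, ?_⟩
    rw [show C + D + E + 2 = C + D + E + 1 + 1 by ring]
    dsimp only at k4
    omega

/-- The body of a loop over `i < b` that keeps the invariant `Inv`. -/
abbrev memLoop (Γ : Fam) (b : Γ.Idx → ℕ) (Inv : Γ.Idx → ℕ → (ℕ → ℕ) → Prop) : Fam :=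
  (Γ.loop b).withMem fun p μ => Inv p.1.1 p.1.2 μ

/-- The body is required to work from every memory that satisfies the invariant. Registers keep no
information from one round to the next, except for the variables and the counter. -/
theorem Does.forLoop {b tm : Γ.Idx → ℕ} (hb : Γ.Comp b) (Inv : Γ.Idx → ℕ → (ℕ → ℕ) → Prop)
    (h0 : ∀ a, Inv a 0 (Γ.mem a))
    (hs : (Γ.memLoop b Inv).Does (fun p => tm p.1.1.1.1)
      fun p μ => Inv p.1.1.1.1 (p.1.1.1.2 + 1) μ) :
    Γ.Does (fun a => b a * tm a + b a + 1) fun a μ => Inv a (b a) μ := by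
  intro K loc hloc
  obtain ⟨⟨Cb, hCb⟩, hb⟩ := hb
  obtain ⟨pb, Db, hpb⟩ := hb (K + 1) loc fun i hi => (hloc i hi).trans (by omega)
  set loc' : ℕ → ℕ := fun i => if i < Γ.arity then loc i else K with hloc'
  obtain ⟨ps, Ds, hps⟩ := hs (K + 3) loc' (by
    intro i hi
    simp only [hloc']
    split_ifs with h1
    · exact (hloc i h1).trans (by omega)
    · omega)
  set E := Db + Ds + Cb with hE
  refine ⟨.seq pb (forProg K (K + 1) (K + 2) ps), E + 3, fun a σ hσ => ?_⟩
  obtain ⟨tb, τb, eb, hrb, hkb, hmb, htb⟩ := hpb a σ hσ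
  obtain ⟨t, τ, e, hI, ht⟩ := exec_forProg (w := (E + 3) * (Γ.size a + 1)) (i := K) (b := K + 1)
    (c := K + 2) (B := b a) (T := (Γ.size a + 2) ^ Ds * tm a) (body := ps)
    (by omega) (by omega) (by omega) (ExpB.mono hCb (by omega) a) (by positivity)
    (fun j τ => j ≤ b a → (∀ r < K, τ.reg r = σ.reg r) ∧ Inv a j τ.mem)
    (by
      intro j τ v h
      constructor <;> intro hj <;> obtain ⟨h1, h2⟩ := h hj <;>
        refine ⟨fun r hr => ?_, h2⟩ <;> rw [State.setReg_reg_of_ne _ _ (by omega)]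
      · exact h1 r hr
      · exact h1 r hr)
    (by
      intro j hj τ h hi hbτ
      obtain ⟨h1, h2⟩ := h hj.le
      obtain ⟨u, υ, k1, k2, k3, k4⟩ := hps ⟨(⟨(a, j), hj⟩, τ.mem), h2⟩ τ (by
        refine ⟨fun i hi' => ?_, rfl⟩
        simp only [hloc']
        split_ifs with c1
        · exact (h1 _ (hloc i c1)).trans (hσ.1 i c1)
        · exact hi)
      exact ⟨u, υ, k1.mono_word (word_mono (by omega) _), k4, (k2 _ (by omega)).trans hi,
        (k2 _ (by omega)).trans hbτ, fun _ =>
          ⟨fun r hr => (k2 r (by omega)).trans (h1 r hr), k3⟩⟩)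
    τb (fun _ => ⟨fun r hr => hkb r (by omega), by
      rw [hmb, hσ.2]
      exact h0 a⟩) hrb
  obtain ⟨h1, h2⟩ := hI le_rfl
  refine ⟨_, _, .seq (eb.mono_word (word_mono (by omega) _)) e, h1, h2, ?_⟩
  have i1 := htb.trans (time_mono (show Db ≤ E by omega) (Γ.size a))
  have i2 := time_mono (show Ds ≤ E by omega) (Γ.size a)
  have i4 := one_le_time E (Γ.size a)
  have i6 : (Γ.size a + 2) ^ (E + 3) = (Γ.size a + 2) ^ E * (Γ.size a + 2) ^ 3 := by ring
  have i7 : 8 ≤ (Γ.size a + 2) ^ 3 := by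
    calc 8 = 2 ^ 3 := by norm_num
      _ ≤ _ := Nat.pow_le_pow_left (by omega) _
  have i8 : b a * ((Γ.size a + 2) ^ Ds * tm a + 4) ≤
      b a * ((Γ.size a + 2) ^ E * tm a + 4) :=
    Nat.mul_le_mul_left _ (Nat.add_le_add_right (Nat.mul_le_mul_right _ i2) _)
  rw [i6]
  generalize (Γ.size a + 2) ^ E = X at *
  have i9 : X * 8 * (b a * tm a + b a + 1) ≤
      X * (Γ.size a + 2) ^ 3 * (b a * tm a + b a + 1) :=
    Nat.mul_le_mul_right _ (Nat.mul_le_mul_left _ i7)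
  have i10 : b a ≤ X * b a := Nat.le_mul_of_pos_left _ i4
  nlinarith [Nat.zero_le (X * (b a * tm a))]

end Fam
end WordRAM

/-! ### Decidable predicates, bounded quantifiers, search and powers -/

namespace WordRAM

/-- The indicator of a proposition. -/
noncomputable def ind (p : Prop) : ℕ := open Classical in if p then 1 else 0

theorem ind_of {p : Prop} (h : p) : ind p = 1 := if_pos h
theorem ind_of_not {p : Prop} (h : ¬p) : ind p = 0 := if_neg h
theorem ind_le_one (p : Prop) : ind p ≤ 1 := by unfold ind; split_ifs <;> omega
theorem ind_ne_zero {p : Prop} : ind p ≠ 0 ↔ p := by unfold ind; split_ifs <;> simp_all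
theorem ind_eq_zero {p : Prop} : ind p = 0 ↔ ¬p := by unfold ind; split_ifs <;> simp_all
theorem ind_eq_one {p : Prop} : ind p = 1 ↔ p := by unfold ind; split_ifs <;> simp_all
theorem ind_eq_ite {p : Prop} [Decidable p] : ind p = if p then 1 else 0 := by
  unfold ind; congr

/-- The least `i < X` with `P i`, or `X` if there is none. -/
noncomputable def firstIdx (P : ℕ → Prop) (X : ℕ) : ℕ :=
  ∑ i ∈ Finset.range X, ind (∀ j < i + 1, ¬P j)

theorem firstIdx_eq_of_forall {P : ℕ → Prop} {X : ℕ} (h : ∀ i < X, ¬P i) : firstIdx P X = X := by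
  unfold firstIdx
  rw [Finset.sum_congr rfl fun i hi => ind_of fun j hj => h j ?_]
  · simp
  · have := Finset.mem_range.1 hi
    omega

/-- The summands are 1 exactly below the first witness. As a sum, a search needs no early exit from
a loop. -/
theorem firstIdx_spec {P : ℕ → Prop} {X i : ℕ} (hi : i < X) (hP : P i) :
    firstIdx P X < X ∧ P (firstIdx P X) ∧ ∀ j < firstIdx P X, ¬P j := by
  classical
  have hex : ∃ i, P i := ⟨i, hP⟩
  have h : firstIdx P X = Nat.find hex := by
    unfold firstIdx
    have : (Finset.range X).filter (fun i => ∀ j < i + 1, ¬P j) = Finset.range (Nat.find hex) := by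
      ext m
      have hle : Nat.find hex ≤ i := Nat.find_min' hex hP
      simp only [Finset.mem_filter, Finset.mem_range, Nat.lt_find_iff, Nat.lt_succ_iff]
      constructor
      · exact fun h => h.2
      · intro h
        refine ⟨?_, h⟩
        by_contra hm
        exact h i (by omega) hP
    rw [← Finset.card_range (Nat.find hex), ← this, Finset.card_filter]
    exact Finset.sum_congr rfl fun i _ => ind_eq_ite
  rw [h]
  exact ⟨(Nat.find_min' hex hP).trans_lt hi, Nat.find_spec hex, fun j hj => Nat.find_min hex hj⟩

namespace Fam

variable {Γ : Fam}

/-- A predicate that is decidable in polynomial time. -/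
def CompP (Γ : Fam) (P : Γ.Idx → Prop) : Prop := Γ.Comp fun a => ind (P a)

theorem CompP.congr {P Q : Γ.Idx → Prop} (h : Γ.CompP P) (hPQ : ∀ a, Q a ↔ P a) : Γ.CompP Q := by
  obtain rfl : Q = P := funext fun a => propext (hPQ a)
  exact h

theorem ExpB.lift {f : Γ.Idx → ℕ} (hf : Γ.ExpB f) (b : Γ.Idx → ℕ) :
    (Γ.loop b).ExpB fun p => f p.1.1 :=
  let ⟨C, hC⟩ := hf
  ⟨C, fun a => hC a.1.1⟩

theorem PolyB.lift {f : Γ.Idx → ℕ} (hf : Γ.PolyB f) (b : Γ.Idx → ℕ) :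
    (Γ.loop b).PolyB fun p => f p.1.1 :=
  let ⟨C, hC⟩ := hf
  ⟨C, fun a => hC a.1.1⟩

theorem Comp.add {f g : Γ.Idx → ℕ} (hf : Γ.Comp f) (hg : Γ.Comp g) :
    Γ.Comp fun a => f a + g a := Comp.op .add hf hg (hf.1.add hg.1)

theorem Comp.mul {f g : Γ.Idx → ℕ} (hf : Γ.Comp f) (hg : Γ.Comp g) :
    Γ.Comp fun a => f a * g a := Comp.op .mul hf hg (hf.1.mul hg.1)

theorem Comp.sub {f g : Γ.Idx → ℕ} (hf : Γ.Comp f) (hg : Γ.Comp g) :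
    Γ.Comp fun a => f a - g a := Comp.op .sub hf hg (hf.1.le fun _ => Nat.sub_le _ _)

theorem Comp.div {f g : Γ.Idx → ℕ} (hf : Γ.Comp f) (hg : Γ.Comp g) :
    Γ.Comp fun a => f a / g a := Comp.op .div hf hg (hf.1.le fun _ => Nat.div_le_self _ _)

theorem Comp.mod {f g : Γ.Idx → ℕ} (hf : Γ.Comp f) (hg : Γ.Comp g) :
    Γ.Comp fun a => f a % g a := Comp.op .mod hf hg (hf.1.le fun _ => Nat.mod_le _ _)

theorem ExpB.ind (P : Γ.Idx → Prop) : Γ.ExpB fun a => WordRAM.ind (P a) :=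
  (ExpB.const 1).le fun _ => ind_le_one _

theorem CompP.eq {f g : Γ.Idx → ℕ} (hf : Γ.Comp f) (hg : Γ.Comp g) :
    Γ.CompP fun a => f a = g a := by
  refine (Comp.op .eq hf hg ((ExpB.const 1).le fun a => ?_)).congr fun a => ?_
  · simp only [Op.eval]; split_ifs <;> omega
  · simp only [Op.eval, ind_eq_ite]

theorem CompP.lt {f g : Γ.Idx → ℕ} (hf : Γ.Comp f) (hg : Γ.Comp g) :
    Γ.CompP fun a => f a < g a := by
  refine (Comp.op .lt hf hg ((ExpB.const 1).le fun a => ?_)).congr fun a => ?_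
  · simp only [Op.eval]; split_ifs <;> omega
  · simp only [Op.eval, ind_eq_ite]

theorem CompP.not {P : Γ.Idx → Prop} (h : Γ.CompP P) : Γ.CompP fun a => ¬P a := by
  refine (Comp.sub (Comp.const 1) h).congr fun a => ?_
  unfold ind
  split_ifs <;> simp_all

theorem CompP.le {f g : Γ.Idx → ℕ} (hf : Γ.Comp f) (hg : Γ.Comp g) :
    Γ.CompP fun a => f a ≤ g a :=
  (CompP.lt hg hf).not.congr fun _ => not_lt.symm

theorem CompP.and {P Q : Γ.Idx → Prop} (hP : Γ.CompP P) (hQ : Γ.CompP Q) :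
    Γ.CompP fun a => P a ∧ Q a := by
  refine (Comp.mul hP hQ).congr fun a => ?_
  unfold ind
  split_ifs <;> simp_all

theorem CompP.or {P Q : Γ.Idx → Prop} (hP : Γ.CompP P) (hQ : Γ.CompP Q) :
    Γ.CompP fun a => P a ∨ Q a :=
  (hP.not.and hQ.not).not.congr fun _ => by tauto

theorem CompP.imp {P Q : Γ.Idx → Prop} (hP : Γ.CompP P) (hQ : Γ.CompP Q) :
    Γ.CompP fun a => P a → Q a :=
  (hP.and hQ.not).not.congr fun _ => by tauto

theorem CompP.iff {P Q : Γ.Idx → Prop} (hP : Γ.CompP P) (hQ : Γ.CompP Q) :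
    Γ.CompP fun a => P a ↔ Q a :=
  ((hP.imp hQ).and (hQ.imp hP)).congr fun _ => by tauto

theorem CompP.comp {P : Γ.Idx → Prop} (hP : Γ.CompP P) : Γ.Comp fun a => ind (P a) := hP

theorem CompP.ite {P : Γ.Idx → Prop} {f g : Γ.Idx → ℕ} [∀ a, Decidable (P a)] (hP : Γ.CompP P)
    (hf : Γ.Comp f) (hg : Γ.Comp g) : Γ.Comp fun a => if P a then f a else g a := by
  refine (Comp.ite hP hf hg).congr fun a => ?_
  simp only [ne_eq, ind_eq_zero, not_not]

theorem ExpB.sum {b : Γ.Idx → ℕ} (hb : Γ.ExpB b) {g : Γ.Idx → ℕ → ℕ}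
    (hg : (Γ.loop b).ExpB fun p => g p.1.1 p.1.2) :
    Γ.ExpB fun a => ∑ j ∈ Finset.range (b a), g a j := by
  obtain ⟨C, hC⟩ := hg
  have h2 : Γ.ExpB fun a => 2 ^ (C * (Γ.size a + 1)) := ExpB.two_pow (C := C) fun a => le_rfl
  refine (hb.mul h2).le fun a => ?_
  calc ∑ j ∈ Finset.range (b a), g a j
      ≤ ∑ j ∈ Finset.range (b a), 2 ^ (C * (Γ.size a + 1)) :=
        Finset.sum_le_sum fun j hj => (hC ⟨(a, j), Finset.mem_range.1 hj⟩).le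
    _ = b a * 2 ^ (C * (Γ.size a + 1)) := by simp

theorem Comp.sum {b : Γ.Idx → ℕ} (hb : Γ.Comp b) (hbP : Γ.PolyB b) {g : Γ.Idx → ℕ → ℕ}
    (hg : (Γ.loop b).Comp fun p => g p.1.1 p.1.2) :
    Γ.Comp fun a => ∑ j ∈ Finset.range (b a), g a j := by
  have hB := ExpB.sum hb.1 hg.1
  refine Comp.fold hb hbP (fun a i => ∑ j ∈ Finset.range i, g a j)
    ((Comp.const 0).congr fun a => by simp) ?_
  have hv : ((Γ.loop b).push fun p => ∑ j ∈ Finset.range p.1.2, g p.1.1 j).Comp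
      fun p => ∑ j ∈ Finset.range p.1.2, g p.1.1 j := by
    refine Comp.push_var ((hB.lift b).le fun p => ?_)
    exact Finset.sum_le_sum_of_subset (Finset.range_mono p.2.le)
  exact (hv.add (hg.push _)).congr fun p => Finset.sum_range_succ _ _

theorem Comp.count {b : Γ.Idx → ℕ} (hb : Γ.Comp b) (hbP : Γ.PolyB b) {P : Γ.Idx → ℕ → Prop}
    [∀ a, DecidablePred (P a)] (hP : (Γ.loop b).CompP fun p => P p.1.1 p.1.2) :
    Γ.Comp fun a => ((Finset.range (b a)).filter (P a)).card := by
  refine (Comp.sum hb hbP (g := fun a i => ind (P a i)) hP).congr fun a => ?_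
  rw [Finset.card_filter]
  exact Finset.sum_congr rfl fun i _ => ind_eq_ite.symm

theorem CompP.bex {b : Γ.Idx → ℕ} (hb : Γ.Comp b) (hbP : Γ.PolyB b) {P : Γ.Idx → ℕ → Prop}
    (hP : (Γ.loop b).CompP fun p => P p.1.1 p.1.2) :
    Γ.CompP fun a => ∃ i < b a, P a i := by
  classical
  refine (CompP.lt (Comp.const 0) (Comp.count hb hbP hP)).congr fun a => ?_
  rw [Finset.card_pos]
  constructor
  · rintro ⟨i, hi, h⟩
    exact ⟨i, by simp [hi, h]⟩
  · rintro ⟨i, hi⟩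
    simp only [Finset.mem_filter, Finset.mem_range] at hi
    exact ⟨i, hi⟩

theorem CompP.ball {b : Γ.Idx → ℕ} (hb : Γ.Comp b) (hbP : Γ.PolyB b) {P : Γ.Idx → ℕ → Prop}
    (hP : (Γ.loop b).CompP fun p => P p.1.1 p.1.2) :
    Γ.CompP fun a => ∀ i < b a, P a i :=
  (CompP.bex hb hbP (P := fun a i => ¬P a i) hP.not).not.congr fun _ => by push Not; rfl

theorem Comp.firstIdx {b : Γ.Idx → ℕ} (hb : Γ.Comp b) (hbP : Γ.PolyB b) {P : Γ.Idx → ℕ → Prop}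
    (hP : (Γ.loop b).CompP fun p => P p.1.1 p.1.2) :
    Γ.Comp fun a => WordRAM.firstIdx (P a) (b a) := by
  have hi : (Γ.loop b).Comp fun p => p.1.2 := Comp.loop_var hb.1
  have h1 : (Γ.loop b).CompP fun p => ∀ j < p.1.2 + 1, ¬P p.1.1 j := by
    refine CompP.ball (hi.add (Comp.const 1)) ((hbP.lift b).le fun p => p.2) ?_
    -- The program for `P` expects one counter, but here two loops are nested. It is reused with its
    -- counter placed in the register of the inner one, skipping the outer one.
    obtain ⟨hE, hc⟩ := hP.not
    refine ⟨ExpB.ind _, fun K loc hloc => ?_⟩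
    set loc' : ℕ → ℕ := fun i => if i < Γ.arity then loc i else loc (Γ.arity + 1) with hloc'
    obtain ⟨p, C, hp⟩ := hc K loc' (by
      intro i _
      simp only [hloc']
      split_ifs with h1
      · exact hloc i (Nat.lt_succ_of_lt (Nat.lt_succ_of_lt h1))
      · exact hloc _ (Nat.lt_succ_self _))
    refine ⟨p, C, fun a σ hσ => hp ⟨(a.1.1.1.1, a.1.2), ?_⟩ σ ⟨fun i hi' => ?_, hσ.2⟩⟩
    · have h2 := a.1.1.2
      have h3 := a.2
      dsimp only at h2 h3 ⊢
      omega
    · rcases Nat.lt_or_eq_of_le (Nat.lt_succ_iff.1 hi') with h | h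
      · have := hσ.1 i (Nat.lt_succ_of_lt (Nat.lt_succ_of_lt h))
        have e : loc' i = loc i := if_pos h
        change i < Γ.arity at h
        rw [e, this]
        simp [h, show i < Γ.arity + 1 by omega]
      · have := hσ.1 (Γ.arity + 1) (Nat.lt_succ_self _)
        change i = Γ.arity at h
        have e : loc' i = loc (Γ.arity + 1) := by simp [hloc', h]
        rw [e, this]
        simp [h]
  exact Comp.sum hb hbP (g := fun a i => ind (∀ j < i + 1, ¬P a j)) h1

theorem Comp.pow {x y : Γ.Idx → ℕ} (hx : Γ.Comp x) (hy : Γ.Comp y) (hyP : Γ.PolyB y)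
    (hB : Γ.ExpB fun a => x a ^ y a) : Γ.Comp fun a => x a ^ y a := by
  refine Comp.fold hy hyP (fun a i => x a ^ i) ((Comp.const 1).congr fun a => pow_zero _) ?_
  have hv : ((Γ.loop y).push fun p => x p.1.1 ^ p.1.2).Comp fun p => x p.1.1 ^ p.1.2 := by
    -- The added 1 is for base 0, where the intermediate value `0 ^ 0 = 1` may exceed the final one.
    refine Comp.push_var (((hB.add (ExpB.const 1)).lift y).le fun p => ?_)
    rcases Nat.eq_zero_or_pos (x p.1.1) with h | h
    · rw [h]
      have := Nat.pow_le_pow_left (show 0 ≤ 1 by omega) p.1.2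
      rw [one_pow] at this
      exact this.trans (Nat.le_add_left _ _)
    · exact (Nat.pow_le_pow_right h p.2.le).trans (by omega)
  exact (hv.mul ((hx.lift y).push _)).congr fun p => pow_succ _ _

theorem Comp.pow_const {x : Γ.Idx → ℕ} (hx : Γ.Comp x) (m : ℕ) : Γ.Comp fun a => x a ^ m := by
  induction m with
  | zero => exact (Comp.const 1).congr fun a => pow_zero _
  | succ m ih => exact (ih.mul hx).congr fun a => pow_succ _ _

/-! ### Functions that do not depend on the memory -/

/-- The situations of `Γ`, with additional data and another memory. -/
abbrev remem (Γ : Fam) {α : Type} (π : α → Γ.Idx) (m : α → ℕ → ℕ) : Fam :=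
  { Γ.pull π with mem := m }

/-- The function `f` is computable in polynomial time from the variables alone. -/
def VComp (Γ : Fam) (f : Γ.Idx → ℕ) : Prop :=
  ∀ (α : Type) (π : α → Γ.Idx) (m : α → ℕ → ℕ), (Γ.remem π m).Comp fun a => f (π a)

theorem VComp.comp {f : Γ.Idx → ℕ} (h : Γ.VComp f) : Γ.Comp f := h Γ.Idx id Γ.mem

theorem VComp.pull {f : Γ.Idx → ℕ} (h : Γ.VComp f) {α : Type} (π : α → Γ.Idx) :
    (Γ.pull π).VComp fun a => f (π a) := fun β ρ m => h β (fun b => π (ρ b)) m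

/-- The purpose of `VComp`: parameters and addresses remain computable after the memory has changed.
This does not follow from `Comp`, whose programs may read the old memory. -/
theorem VComp.withMem {f : Γ.Idx → ℕ} (h : Γ.VComp f) (Q : Γ.Idx → (ℕ → ℕ) → Prop) :
    (Γ.withMem Q).VComp fun p => f p.1.1 := fun β ρ m => h β (fun b => (ρ b).1.1) m

theorem VComp.push {f : Γ.Idx → ℕ} (h : Γ.VComp f) (v : Γ.Idx → ℕ) : (Γ.push v).VComp f :=
  fun β ρ m => (h β ρ m).push fun b => v (ρ b)

theorem VComp.push_var {v : Γ.Idx → ℕ} (hB : Γ.ExpB v) : (Γ.push v).VComp v :=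
  fun _ ρ m =>
    let ⟨C, hC⟩ := hB
    Comp.push_var (Γ := Γ.remem ρ m) (v := fun b => v (ρ b)) ⟨C, fun b => hC (ρ b)⟩

theorem VComp.loop_var {b : Γ.Idx → ℕ} (hb : Γ.ExpB b) : (Γ.loop b).VComp fun p => p.1.2 := by
  obtain ⟨C, hC⟩ := hb
  exact VComp.push_var ⟨C, fun p => (p.2.le).trans_lt (hC p.1.1)⟩

theorem VComp.lift {f : Γ.Idx → ℕ} (hf : Γ.VComp f) (b : Γ.Idx → ℕ) :
    (Γ.loop b).VComp fun p => f p.1.1 := (hf.pull _).push _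

theorem VComp.memLoop {f : Γ.Idx → ℕ} (hf : Γ.VComp f) (b : Γ.Idx → ℕ)
    (Inv : Γ.Idx → ℕ → (ℕ → ℕ) → Prop) :
    (Γ.memLoop b Inv).VComp fun p => f p.1.1.1.1 := (hf.lift b).withMem _

theorem VComp.memLoop_var {b : Γ.Idx → ℕ} (hb : Γ.ExpB b)
    (Inv : Γ.Idx → ℕ → (ℕ → ℕ) → Prop) :
    (Γ.memLoop b Inv).VComp fun p => p.1.1.1.2 := (VComp.loop_var hb).withMem _

end Fam
end WordRAM

/-! ### Relocation of programs and subroutine calls -/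

namespace WordRAM

/-- The program `p` with its memory moved to the addresses from `R[K]` on, and its registers to
the ones from `K + 2` on. -/
def Prog.reloc (K : ℕ) : Prog → Prog
  | .skip => .skip
  | .const r v => .const (K + 2 + r) v
  | .op o r s t => .op o (K + 2 + r) (K + 2 + s) (K + 2 + t)
  | .load r s => .seq (.op .add (K + 1) (K + 2 + s) K) (.load (K + 2 + r) (K + 1))
  | .store r s => .seq (.op .add (K + 1) (K + 2 + r) K) (.store (K + 1) (K + 2 + s))
  | .seq p q => .seq (p.reloc K) (q.reloc K)
  | .ite r p q => .ite (K + 2 + r) (p.reloc K) (q.reloc K)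
  | .loop r p => .loop (K + 2 + r) (p.reloc K)

/-- All registers that are mentioned in the program are smaller than this number. -/
def Prog.width : Prog → ℕ
  | .skip => 0
  | .const r _ => r + 1
  | .op _ r s t => r + s + t + 1
  | .load r s => r + s + 1
  | .store r s => r + s + 1
  | .seq p q => p.width + q.width
  | .ite r p q => r + 1 + p.width + q.width
  | .loop r p => r + 1 + p.width

/-- The configuration `τ` contains a relocated copy of the configuration `σ`. -/
structure Copy (w m K base : ℕ) (σ τ : State) : Prop where
  reg : ∀ r < m, τ.reg (K + 2 + r) = σ.reg r
  reg_base : τ.reg K = base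
  mem : ∀ x < 2 ^ w, τ.mem (base + x) = σ.mem x

/-- The configurations agree on what lies outside of a relocated copy. -/
structure SameOutside (w K base : ℕ) (σ τ : State) : Prop where
  reg : ∀ r < K, τ.reg r = σ.reg r
  mem : ∀ x, x < base ∨ base + 2 ^ w ≤ x → τ.mem x = σ.mem x

theorem SameOutside.refl (w K base : ℕ) (σ : State) : SameOutside w K base σ σ :=
  ⟨fun _ _ => rfl, fun _ _ => rfl⟩

theorem SameOutside.trans {w K base : ℕ} {σ τ υ : State} (h : SameOutside w K base σ τ)
    (h' : SameOutside w K base τ υ) : SameOutside w K base σ υ :=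
  ⟨fun r hr => (h'.reg r hr).trans (h.reg r hr), fun x hx => (h'.mem x hx).trans (h.mem x hx)⟩

theorem SameOutside.setReg {w K base : ℕ} (σ : State) {r : ℕ} (v : ℕ) (hr : K ≤ r) :
    SameOutside w K base σ (σ.setReg r v) :=
  ⟨fun s hs => State.setReg_reg_of_ne _ _ (by omega), fun _ _ => rfl⟩

theorem Copy.setReg {w m K base : ℕ} {σ τ : State} (h : Copy w m K base σ τ) (r v : ℕ) :
    Copy w m K base (σ.setReg r v) (τ.setReg (K + 2 + r) v) := by
  refine ⟨fun s hs => ?_, ?_, h.mem⟩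
  · by_cases e : s = r
    · subst e
      simp
    · rw [State.setReg_reg_of_ne _ _ (by omega), State.setReg_reg_of_ne _ _ e, h.reg s hs]
  · rw [State.setReg_reg_of_ne _ _ (by omega), h.reg_base]

theorem Copy.setTemp {w m K base : ℕ} {σ τ : State} (h : Copy w m K base σ τ) (v : ℕ) :
    Copy w m K base σ (τ.setReg (K + 1) v) :=
  ⟨fun s hs => by rw [State.setReg_reg_of_ne _ _ (by omega), h.reg s hs],
    by rw [State.setReg_reg_of_ne _ _ (by omega), h.reg_base], h.mem⟩

/-- Addresses come from registers, so a program on `w`-bit words that starts with small registers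
touches only the first `2 ^ w` cells. This confines a relocated copy to its region. -/
theorem Exec.reg_lt {w : ℕ} {p : Prog} {σ τ : State} {t : ℕ} (e : Exec w p σ t τ)
    (h : ∀ r, σ.reg r < 2 ^ w) : ∀ r, τ.reg r < 2 ^ w := by
  have key : ∀ (σ : State) (r v : ℕ), (∀ s, σ.reg s < 2 ^ w) → v < 2 ^ w →
      ∀ s, (σ.setReg r v).reg s < 2 ^ w := by
    intro σ r v hσ hv s
    by_cases e : s = r
    · subst e
      simpa
    · rw [State.setReg_reg_of_ne _ _ e]
      exact hσ s
  induction e with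
  | skip => exact h
  | const _ _ _ hv => exact key _ _ _ h hv
  | op _ _ _ _ _ hv => exact key _ _ _ h hv
  | load _ _ _ hv => exact key _ _ _ h hv
  | store => exact h
  | seq _ _ ih₁ ih₂ => exact ih₂ (ih₁ h)
  | ite_true _ _ ih => exact ih h
  | ite_false _ _ ih => exact ih h
  | loop_done => exact h
  | loop_step _ _ _ ih₁ ih₂ => exact ih₂ (ih₁ h)

/-- Step by step simulation; each memory access needs one more instruction for adding the base,
whence the factor 2. Only the registers below `m`, which include all that occur in the program, have
to agree. -/
theorem Exec.reloc {w w' m K base : ℕ} (hb : base + 2 ^ w ≤ 2 ^ w') {p : Prog} {σ τ : State}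
    {t : ℕ} (e : Exec w p σ t τ) (hm : p.width ≤ m) (hσ : ∀ r, σ.reg r < 2 ^ w) (σ' : State)
    (hc : Copy w m K base σ σ') :
    ∃ t' τ', Exec w' (p.reloc K) σ' t' τ' ∧ t' ≤ 2 * t ∧ Copy w m K base τ τ' ∧
      SameOutside w K base σ' τ' := by
  induction e generalizing σ' with
  | skip σ => exact ⟨1, σ', .skip _, by omega, hc, .refl ..⟩
  | const σ r v hv =>
    exact ⟨1, _, .const _ _ _ (by omega), by omega, hc.setReg r v, .setReg _ _ (by omega)⟩
  | op σ o r s t hv =>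
    simp only [Prog.width] at hm
    have h := Exec.op (w := w') σ' o (K + 2 + r) (K + 2 + s) (K + 2 + t)
      (by rw [hc.reg s (by omega), hc.reg t (by omega)]; omega)
    rw [hc.reg s (by omega), hc.reg t (by omega)] at h
    exact ⟨1, _, h, by omega, hc.setReg r _, .setReg _ _ (by omega)⟩
  | load σ r s hv =>
    simp only [Prog.width] at hm
    have hs := hσ s
    have h := Exec.op (w := w') σ' .add (K + 1) (K + 2 + s) K
      (by simp only [Op.eval]; rw [hc.reg s (by omega), hc.reg_base]; omega)
    simp only [Op.eval] at h
    rw [hc.reg s (by omega), hc.reg_base] at h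
    set σ₁ := σ'.setReg (K + 1) (σ.reg s + base) with hσ₁
    have hc₁ : Copy w m K base σ σ₁ := hc.setTemp _
    have hv₁ : σ₁.mem (σ₁.reg (K + 1)) = σ.mem (σ.reg s) := by
      rw [← hc₁.mem _ hs, hσ₁, State.setReg_reg_self, add_comm base]
    have h2 := Exec.load (w := w') σ₁ (K + 2 + r) (K + 1) (by rw [hv₁]; omega)
    rw [hv₁] at h2
    exact ⟨_, _, .seq h h2, by omega, hc₁.setReg r _,
      (SameOutside.setReg _ _ (by omega)).trans (.setReg _ _ (by omega))⟩
  | store σ r s =>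
    simp only [Prog.width] at hm
    have hr := hσ r
    have h := Exec.op (w := w') σ' .add (K + 1) (K + 2 + r) K
      (by simp only [Op.eval]; rw [hc.reg r (by omega), hc.reg_base]; omega)
    simp only [Op.eval] at h
    rw [hc.reg r (by omega), hc.reg_base] at h
    set σ₁ := σ'.setReg (K + 1) (σ.reg r + base) with hσ₁
    have hc₁ : Copy w m K base σ σ₁ := hc.setTemp _
    have h1 : σ₁.reg (K + 1) = σ.reg r + base := by rw [hσ₁, State.setReg_reg_self]
    have h2 := Exec.store (w := w') σ₁ (K + 1) (K + 2 + s)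
    rw [h1, hc₁.reg s (by omega)] at h2
    refine ⟨_, _, .seq h h2, by omega, ⟨hc₁.reg, hc₁.reg_base, fun x hx => ?_⟩,
      (SameOutside.setReg _ _ (by omega)).trans ⟨fun _ _ => rfl, fun x hx => ?_⟩⟩
    · rw [State.setMem_mem, State.setMem_mem]
      by_cases e : x = σ.reg r
      · subst e
        rw [add_comm]
        simp
      · rw [Function.update_of_ne (by omega), Function.update_of_ne e, hc₁.mem x hx]
    · rw [State.setMem_mem, Function.update_of_ne (by omega)]
  | seq hp hq ih₁ ih₂ =>
    simp only [Prog.width] at hm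
    obtain ⟨t₁, τ₁, e₁, ht₁, hc₁, hs₁⟩ := ih₁ (by omega) hσ σ' hc
    obtain ⟨t₂, τ₂, e₂, ht₂, hc₂, hs₂⟩ := ih₂ (by omega) (hp.reg_lt hσ) τ₁ hc₁
    exact ⟨_, _, .seq e₁ e₂, by omega, hc₂, hs₁.trans hs₂⟩
  | ite_true hr hp ih =>
    simp only [Prog.width] at hm
    obtain ⟨t₁, τ₁, e₁, ht₁, hc₁, hs₁⟩ := ih (by omega) hσ σ' hc
    exact ⟨_, _, .ite_true (by rwa [hc.reg _ (by omega)]) e₁, by omega, hc₁, hs₁⟩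
  | ite_false hr hp ih =>
    simp only [Prog.width] at hm
    obtain ⟨t₁, τ₁, e₁, ht₁, hc₁, hs₁⟩ := ih (by omega) hσ σ' hc
    exact ⟨_, _, .ite_false (by rwa [hc.reg _ (by omega)]) e₁, by omega, hc₁, hs₁⟩
  | loop_done hr =>
    simp only [Prog.width] at hm
    exact ⟨_, _, .loop_done (by rwa [hc.reg _ (by omega)]), by omega, hc, .refl ..⟩
  | loop_step hr hp hl ih₁ ih₂ =>
    have hm' := hm
    simp only [Prog.width] at hm
    obtain ⟨t₁, τ₁, e₁, ht₁, hc₁, hs₁⟩ := ih₁ (by omega) hσ σ' hc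
    obtain ⟨t₂, τ₂, e₂, ht₂, hc₂, hs₂⟩ := ih₂ hm' (hp.reg_lt hσ) τ₁ hc₁
    exact ⟨_, _, .loop_step (by rwa [hc.reg _ (by omega)]) e₁ e₂, by omega, hc₂, hs₁.trans hs₂⟩

/-- Set the registers from `K` to `K + m - 1` to zero. -/
def clearProg (K : ℕ) : ℕ → Prog
  | 0 => .skip
  | m + 1 => .seq (clearProg K m) (.const (K + m) 0)

theorem exec_clearProg (w K m : ℕ) (σ : State) :
    ∃ τ, Exec w (clearProg K m) σ (m + 1) τ ∧ (∀ r < m, τ.reg (K + r) = 0) ∧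
      (∀ r < K, τ.reg r = σ.reg r) ∧ τ.mem = σ.mem := by
  induction m with
  | zero => exact ⟨σ, .skip _, by simp, by simp, rfl⟩
  | succ m ih =>
    obtain ⟨τ, e, h1, h2, h3⟩ := ih
    refine ⟨τ.setReg (K + m) 0, .seq e (.const _ _ _ (by positivity)), fun r hr => ?_,
      fun r hr => ?_, h3⟩
    · by_cases e : r = m
      · subst e
        simp
      · rw [State.setReg_reg_of_ne _ _ (by omega), h1 r (by omega)]
    · rw [State.setReg_reg_of_ne _ _ (by omega), h2 r hr]

namespace Fam

variable {Γ : Fam}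

/-- A program can be called as a subroutine that works in a fresh part of the memory. -/
theorem Does.call (p : Prog) {base res tm wp : Γ.Idx → ℕ} {inp : Γ.Idx → List ℕ}
    {Good : Γ.Idx → ℕ → Prop} (hbase : Γ.Comp base) (hres : Γ.Comp res)
    (hE : Γ.ExpB fun a => base a + 2 ^ wp a)
    (hin : ∀ a, ∀ x < 2 ^ wp a, Γ.mem a (base a + x) = (inp a).getD x 0)
    (hp : ∀ a, ∃ t out, Computes (wp a) p (inp a) t out ∧ t ≤ tm a ∧ Good a out) :
    Γ.Does (fun a => tm a + 1) fun a μ => ∃ out, Good a out ∧ μ (res a) = out ∧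
      ∀ x, x ≠ res a → (x < base a ∨ base a + 2 ^ wp a ≤ x) → μ x = Γ.mem a x := by
  intro K loc hloc
  obtain ⟨E, hE⟩ := hE
  · obtain ⟨p₁, C₁, hp₁⟩ := hres.2 K loc hloc
    obtain ⟨p₂, C₂, hp₂⟩ := hbase.2 (K + 1) loc fun i hi => (hloc i hi).trans (by omega)
    -- The 1 makes sure that the output register `0` belongs to the copy, even if the program does
    -- not mention it.
    set m := p.width + 1 with hm
    refine ⟨.seq p₁ (.seq p₂ (.seq (clearProg (K + 3) m) (.seq (p.reloc (K + 1))
      (.store K (K + 3))))), C₁ + C₂ + E + m + 4, fun a σ hσ => ?_⟩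
    obtain ⟨t₁, σ₁, e₁, hr₁, hk₁, hm₁, ht₁⟩ := hp₁ a σ hσ
    obtain ⟨t₂, σ₂, e₂, hr₂, hk₂, hm₂, ht₂⟩ := hp₂ a σ₁ (hσ.congr hloc hk₁ hm₁)
    set w := (C₁ + C₂ + E + m + 4) * (Γ.size a + 1) with hw
    -- The registers may hold leftovers, for example of an earlier call, while the subroutine
    -- expects zeros.
    obtain ⟨σ₃, e₃, hz₃, hk₃, hm₃⟩ := exec_clearProg w (K + 3) m σ₂
    obtain ⟨t, out, ⟨τ, hτ, hout⟩, ht, hgood⟩ := hp a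
    obtain ⟨t₄, σ₄, e₄, ht₄, hc₄, hs₄⟩ := Exec.reloc (w' := w) (m := m) (K := K + 1)
      (base := base a) (by
        have h1 := hE a
        have h2 : 2 ^ (E * (Γ.size a + 1)) ≤ 2 ^ w :=
          Nat.pow_le_pow_right two_pos (word_mono (by omega) _)
        dsimp only at h1
        omega) hτ (by omega) (by simp [initState]) σ₃
      ⟨fun r hr => by
          rw [show K + 1 + 2 + r = K + 3 + r by ring, hz₃ r hr]
          rfl,
        by rw [hk₃ _ (by omega), hr₂],
        fun x hx => by
          rw [hm₃, hm₂, hm₁, hσ.2, hin a x hx]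
          rfl⟩
    have hK : σ₄.reg K = res a := by
      rw [hs₄.reg K (by omega), hk₃ _ (by omega), hk₂ _ (by omega), hr₁]
    have h0 : σ₄.reg (K + 3) = out := by
      rw [← hout, ← hc₄.reg 0 (by omega)]
    have hmem : ∀ x, x < base a ∨ base a + 2 ^ wp a ≤ x → σ₄.mem x = Γ.mem a x := by
      intro x hx
      rw [hs₄.mem x hx, hm₃, hm₂, hm₁, hσ.2]
    refine ⟨_, _, .seq (e₁.mono_word (word_mono (by omega) _))
      (.seq (e₂.mono_word (word_mono (by omega) _)) (.seq e₃ (.seq e₄ (.store _ _ _)))),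
      fun r hr => ?_, ⟨out, hgood, ?_, fun x hx hx' => ?_⟩, ?_⟩
    · rw [State.setMem_reg, hs₄.reg r (by omega), hk₃ r (by omega), hk₂ r (by omega), hk₁ r hr]
    · rw [State.setMem_mem, hK, h0, Function.update_self]
    · rw [State.setMem_mem, hK, Function.update_of_ne hx, hmem x hx']
    · set X := (Γ.size a + 2) ^ (C₁ + C₂ + E + m) with hX
      have i1 := ht₁.trans (time_mono (show C₁ ≤ C₁ + C₂ + E + m by omega) (Γ.size a))
      have i2 := ht₂.trans (time_mono (show C₂ ≤ C₁ + C₂ + E + m by omega) (Γ.size a))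
      have i3 : m + 1 ≤ X := by
        calc m + 1 ≤ 2 ^ m := Nat.lt_two_pow_self
          _ ≤ (Γ.size a + 2) ^ m := Nat.pow_le_pow_left (by omega) _
          _ ≤ X := time_mono (by omega) _
      have i4 := one_le_time (C₁ + C₂ + E + m) (Γ.size a)
      have i6 : (Γ.size a + 2) ^ (C₁ + C₂ + E + m + 4) = X * (Γ.size a + 2) ^ 4 := by
        rw [hX, ← pow_add]
      have i7 : 16 ≤ (Γ.size a + 2) ^ 4 := by
        calc 16 = 2 ^ 4 := by norm_num
          _ ≤ _ := Nat.pow_le_pow_left (by omega) _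
      have i9 : X * 16 * (tm a + 1) ≤ X * (Γ.size a + 2) ^ 4 * (tm a + 1) :=
        Nat.mul_le_mul_right _ (Nat.mul_le_mul_left _ i7)
      have i10 : tm a ≤ X * tm a := Nat.le_mul_of_pos_left _ i4
      rw [i6]
      nlinarith

/-- A memory changing program followed by a function evaluation yields a program with output. -/
theorem Does.computes {tm f : Γ.Idx → ℕ} {Q : Γ.Idx → (ℕ → ℕ) → Prop} (hΓ : Γ.arity = 0)
    {g : (Γ.withMem Q).Idx → ℕ} (h : Γ.Does tm Q) (hg : (Γ.withMem Q).Comp g)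
    (hf : ∀ p, g p = f p.1.1) :
    ∃ p C, ∀ a σ, σ.mem = Γ.mem a → ∃ t τ, Exec (C * (Γ.size a + 1)) p σ t τ ∧
      τ.reg 0 = f a ∧ t ≤ (Γ.size a + 2) ^ C * (tm a + 1) := by
  obtain ⟨p, C, hp⟩ := h 0 id (by simp [hΓ])
  obtain ⟨q, D, hq⟩ := hg.2 0 id (by intro i hi; exact absurd hi (by simp [hΓ]))
  refine ⟨.seq p q, C + D, fun a σ hσ => ?_⟩
  obtain ⟨t, τ, h1, h2, h3, h4⟩ := hp a σ ⟨by simp [hΓ], hσ⟩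
  obtain ⟨u, υ, k1, k2, k3, k4, k5⟩ := hq ⟨(a, τ.mem), h3⟩ τ
    ⟨by intro i hi; exact absurd hi (by simp [hΓ]), rfl⟩
  refine ⟨_, _, .seq (h1.mono_word (word_mono (by omega) _))
    (k1.mono_word (word_mono (by omega) _)), k2.trans (hf _), ?_⟩
  rw [mul_add, mul_one]
  exact Nat.add_le_add (h4.trans (Nat.mul_le_mul_right _ (time_mono (by omega) _)))
    (k5.trans (time_mono (by omega) _))

end Fam
end WordRAM

/-! ### Sparsification -/

namespace Sparsify

/-- The minimal members of a family of sets. -/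
def minF (F : Finset (Finset ℕ)) : Finset (Finset ℕ) :=
  F.filter fun e => ∀ e' ∈ F, e' ⊆ e → e' = e

/-- The minimal members of the family that arise from `H` by adding `c` elements. -/
def link (F : Finset (Finset ℕ)) (H : Finset ℕ) (c : ℕ) : Finset (Finset ℕ) :=
  (minF F).filter fun e => e.card = H.card + c ∧ H ⊆ e

/-- `H` is the heart of many minimal members, with petals of size `c`. -/
def Flower (θ : ℕ → ℕ) (F : Finset (Finset ℕ)) (H : Finset ℕ) (c : ℕ) : Prop :=
  H.Nonempty ∧ 1 ≤ c ∧ θ c ≤ (link F H c).card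

/-- A flower with the smallest members, and then with the smallest petals. -/
def LeastFlower (θ : ℕ → ℕ) (F : Finset (Finset ℕ)) (H : Finset ℕ) (c : ℕ) : Prop :=
  Flower θ F H c ∧ ∀ H' c', Flower θ F H' c' →
    H.card + c < H'.card + c' ∨ (H.card + c = H'.card + c' ∧ c ≤ c')

/-- Add the petals of a flower, or its heart. -/
def grow (F : Finset (Finset ℕ)) (H : Finset ℕ) (c : ℕ) (b : Bool) : Finset (Finset ℕ) :=
  F ∪ if b then (link F H c).image (· \ H) else {H}

/-- In each step the petals or the heart of a least flower are added, until there is no flower. -/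
def IsRun (θ : ℕ → ℕ) (F : ℕ → Finset (Finset ℕ)) (b : ℕ → Bool) : Prop :=
  ∀ s, (∃ H c, LeastFlower θ (F s) H c ∧ F (s + 1) = grow (F s) H c (b s)) ∨
    (F (s + 1) = F s ∧ ∀ H c, ¬Flower θ (F s) H c)

/-- The nonempty sets of at most `k` numbers below `V`. -/
def sets (V k : ℕ) : Finset (Finset ℕ) :=
  (Finset.range V).powerset.filter fun e => e.Nonempty ∧ e.card ≤ k

/-! ### Minimal members, flowers, and the members added in one step -/

variable {θ : ℕ → ℕ} {F : Finset (Finset ℕ)} {H : Finset ℕ} {c V k : ℕ}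

theorem mem_sets {e : Finset ℕ} :
    e ∈ sets V k ↔ e ⊆ Finset.range V ∧ e.Nonempty ∧ e.card ≤ k := by
  simp [sets]

theorem minF_subset (F : Finset (Finset ℕ)) : minF F ⊆ F := Finset.filter_subset _ _

theorem mem_minF {e : Finset ℕ} : e ∈ minF F ↔ e ∈ F ∧ ∀ e' ∈ F, e' ⊆ e → e' = e := by
  simp [minF]

theorem mem_link {e : Finset ℕ} :
    e ∈ link F H c ↔ e ∈ minF F ∧ e.card = H.card + c ∧ H ⊆ e := by
  simp [link]

theorem exists_minF_subset {e : Finset ℕ} (he : e ∈ F) : ∃ e' ∈ minF F, e' ⊆ e := by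
  induction h : e.card using Nat.strong_induction_on generalizing e with
  | _ n ih =>
    by_cases hm : e ∈ minF F
    · exact ⟨e, hm, le_rfl⟩
    · have : ∃ e' ∈ F, e' ⊆ e ∧ e' ≠ e := by
        by_contra! hcon
        exact hm (mem_minF.2 ⟨he, hcon⟩)
      obtain ⟨e', he', hs, hne⟩ := this
      have hlt : e'.card < n := h ▸ Finset.card_lt_card (hs.ssubset_of_ne hne)
      obtain ⟨e'', h1, h2⟩ := ih _ hlt he' rfl
      exact ⟨e'', h1, h2.trans hs⟩

/-- The members that are added. -/
theorem grow_sdiff_cases {b : Bool} {e : Finset ℕ} (he : e ∈ grow F H c b) (hF : e ∉ F) :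
    (b = true ∧ ∃ C ∈ link F H c, e = C \ H) ∨ (b = false ∧ e = H) := by
  unfold grow at he
  cases b <;> simp_all [eq_comm]

theorem Flower.link_nonempty (hθ : ∀ c, 1 ≤ θ c) (h : Flower θ F H c) : (link F H c).Nonempty :=
  Finset.card_pos.1 ((hθ c).trans h.2.2)

theorem ssubset_of_mem_link (hH : H.Nonempty) {C : Finset ℕ} (hC : C ∈ link F H c) :
    C \ H ⊂ C := by
  refine Finset.sdiff_subset.ssubset_of_ne fun h => ?_
  obtain ⟨v, hv⟩ := hH
  have := (mem_link.1 hC).2.2 hv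
  rw [← h] at this
  exact (Finset.mem_sdiff.1 this).2 hv

theorem card_petal {C : Finset ℕ} (hC : C ∈ link F H c) : (C \ H).card = c := by
  obtain ⟨_, h1, h2⟩ := mem_link.1 hC
  rw [Finset.card_sdiff_of_subset h2]
  omega

theorem heart_ssubset (hc : 1 ≤ c) {C : Finset ℕ} (hC : C ∈ link F H c) : H ⊂ C := by
  obtain ⟨_, h1, h2⟩ := mem_link.1 hC
  refine h2.ssubset_of_ne fun h => ?_
  rw [h] at h1
  omega

/-- An added member is strictly contained in a minimal member. -/
theorem exists_ssubset_of_new (hθ : ∀ c, 1 ≤ θ c) (h : Flower θ F H c) {b : Bool}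
    {e : Finset ℕ} (he : e ∈ grow F H c b) (hF : e ∉ F) : ∃ C ∈ minF F, e ⊂ C := by
  rcases grow_sdiff_cases he hF with ⟨_, C, hC, rfl⟩ | ⟨_, rfl⟩
  · exact ⟨C, (mem_link.1 hC).1, ssubset_of_mem_link h.1 hC⟩
  · obtain ⟨C, hC⟩ := h.link_nonempty hθ
    exact ⟨C, (mem_link.1 hC).1, heart_ssubset h.2.1 hC⟩

/-- An old member inside a new one would lie strictly inside a minimal member. -/
theorem not_subset_of_new (hθ : ∀ c, 1 ≤ θ c) (h : Flower θ F H c) {b : Bool}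
    {e : Finset ℕ} (he : e ∈ grow F H c b) (hF : e ∉ F) {e' : Finset ℕ} (he' : e' ∈ F) :
    ¬e' ⊆ e := by
  intro hs
  obtain ⟨C, hC, hlt⟩ := exists_ssubset_of_new hθ h he hF
  have := (mem_minF.1 hC).2 e' he' (hs.trans hlt.subset)
  subst this
  exact hlt.not_subset hs

/-- All members added in one step have the same size, so they do not contain each other, and old
ones are excluded by `not_subset_of_new`. -/
theorem new_mem_minF (hθ : ∀ c, 1 ≤ θ c) (h : Flower θ F H c) {b : Bool}
    {e : Finset ℕ} (he : e ∈ grow F H c b) (hF : e ∉ F) : e ∈ minF (grow F H c b) := by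
  refine mem_minF.2 ⟨he, fun e' he' hs => ?_⟩
  by_cases hF' : e' ∈ F
  · exact absurd hs (not_subset_of_new hθ h he hF hF')
  · refine Finset.eq_of_subset_of_card_le hs ?_
    rcases grow_sdiff_cases he hF with ⟨hb, C, hC, rfl⟩ | ⟨hb, rfl⟩ <;>
      rcases grow_sdiff_cases he' hF' with ⟨hb', C', hC', rfl⟩ | ⟨hb', rfl⟩ <;> simp_all
    rw [card_petal hC, card_petal hC']

theorem subset_grow (F : Finset (Finset ℕ)) (H : Finset ℕ) (c : ℕ) (b : Bool) :
    F ⊆ grow F H c b := Finset.subset_union_left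

theorem petal_new (h : Flower θ F H c) {C : Finset ℕ}
    (hC : C ∈ link F H c) : C \ H ∈ grow F H c true ∧ C \ H ∉ F := by
  refine ⟨Finset.mem_union_right _ (Finset.mem_image_of_mem _ hC), fun hF => ?_⟩
  have h1 := ssubset_of_mem_link h.1 hC
  exact h1.ne ((mem_minF.1 (mem_link.1 hC).1).2 _ hF h1.subset)

theorem heart_new (hθ : ∀ c, 1 ≤ θ c) (h : Flower θ F H c) :
    H ∈ grow F H c false ∧ H ∉ F := by
  refine ⟨by simp [grow], fun hF => ?_⟩
  obtain ⟨C, hC⟩ := h.link_nonempty hθ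
  have h1 := heart_ssubset h.2.1 hC
  exact h1.ne ((mem_minF.1 (mem_link.1 hC).1).2 _ hF h1.subset)

theorem exists_new (hθ : ∀ c, 1 ≤ θ c) (h : Flower θ F H c) (b : Bool) :
    ∃ e ∈ grow F H c b, e ∉ F := by
  cases b
  · exact ⟨H, heart_new hθ h⟩
  · obtain ⟨C, hC⟩ := h.link_nonempty hθ
    exact ⟨_, petal_new h hC⟩

theorem grow_subset_sets (hθ : ∀ c, 1 ≤ θ c) (h : Flower θ F H c) (hF : F ⊆ sets V k) (b : Bool) :
    grow F H c b ⊆ sets V k := by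
  intro e he
  by_cases heF : e ∈ F
  · exact hF heF
  · obtain ⟨C, hC, hlt⟩ := exists_ssubset_of_new hθ h he heF
    obtain ⟨h1, h2, h3⟩ := mem_sets.1 (hF (minF_subset F hC))
    refine mem_sets.2 ⟨hlt.subset.trans h1, ?_, (Finset.card_le_card hlt.subset).trans h3⟩
    rcases grow_sdiff_cases he heF with ⟨_, C', hC', rfl⟩ | ⟨_, rfl⟩
    · rw [← Finset.card_pos, card_petal hC']
      exact h.2.1
    · exact h.1

/-! ### Counting the added sets along a run -/

variable {Fs : ℕ → Finset (Finset ℕ)} {b : ℕ → Bool}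

theorem IsRun.subset_succ (h : IsRun θ Fs b) (s : ℕ) : Fs s ⊆ Fs (s + 1) := by
  rcases h s with ⟨H, c, _, h2⟩ | ⟨h1, _⟩
  · rw [h2]
    exact subset_grow _ _ _ _
  · rw [h1]

theorem IsRun.subset (h : IsRun θ Fs b) (s : ℕ) : Fs 0 ⊆ Fs s := by
  induction s with
  | zero => exact le_rfl
  | succ s ih => exact ih.trans (h.subset_succ s)

theorem IsRun.subset_sets (hθ : ∀ c, 1 ≤ θ c) (h : IsRun θ Fs b) (h0 : Fs 0 ⊆ sets V k) (s : ℕ) :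
    Fs s ⊆ sets V k := by
  induction s with
  | zero => exact h0
  | succ s ih =>
    rcases h s with ⟨H, c, h1, h2⟩ | ⟨h1, _⟩
    · rw [h2]
      exact grow_subset_sets hθ h1.1 ih _
    · rwa [h1]

/-- The added members, among the minimal ones, that arise from `S` by adding `c` elements. -/
def added (Fs : ℕ → Finset (Finset ℕ)) (s : ℕ) (S : Finset ℕ) (c : ℕ) : Finset (Finset ℕ) :=
  (link (Fs s) S c) \ Fs 0

theorem card_link_lt_of_card_lt (h : LeastFlower θ F H c) {S : Finset ℕ} (hS : S.Nonempty)
    {c' : ℕ} (hc' : 1 ≤ c') (hlt : S.card + c' < H.card + c) : (link F S c').card < θ c' := by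
  by_contra! hcon
  rcases h.2 S c' ⟨hS, hc', hcon⟩ with h1 | h1 <;> omega

/-- When such sets are newly added, the flower that is treated has larger members, so by leastness
fewer than `θ c` of them existed before. The step adds fewer than `θ c` petals above `S`, since
otherwise the heart could be enlarged by `S`, giving a flower with equally large members but smaller
petals; a heart is a single set. Steps that add none do not increase the number, because old members
can only lose minimality. -/
theorem IsRun.card_added_le (hθ : ∀ c, 1 ≤ θ c) (h : IsRun θ Fs b) (s : ℕ) {S : Finset ℕ}
    (hS : S.Nonempty) {c : ℕ} (hc : 1 ≤ c) : (added Fs s S c).card ≤ 2 * θ c := by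
  induction s with
  | zero =>
    have : added Fs 0 S c = ∅ := by
      refine Finset.sdiff_eq_empty_iff_subset.2 fun e he => ?_
      exact minF_subset _ (mem_link.1 he).1
    simp [this]
  | succ s ih =>
    rcases h s with ⟨H, c₀, hl, hg⟩ | ⟨h1, _⟩
    swap
    · unfold added at ih ⊢
      rwa [h1]
    set New := (link (Fs (s + 1)) S c).filter fun e => e ∉ Fs s with hNew
    have hsub : added Fs (s + 1) S c ⊆ added Fs s S c ∪ New := by
      intro e he
      obtain ⟨h1, h2⟩ := Finset.mem_sdiff.1 he
      by_cases heF : e ∈ Fs s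
      · refine Finset.mem_union_left _ (Finset.mem_sdiff.2 ⟨?_, h2⟩)
        obtain ⟨h3, h4⟩ := mem_link.1 h1
        refine mem_link.2 ⟨mem_minF.2 ⟨heF, fun e' he' => ?_⟩, h4⟩
        exact (mem_minF.1 h3).2 e' (h.subset_succ s he')
      · exact Finset.mem_union_right _ (Finset.mem_filter.2 ⟨h1, heF⟩)
    have hcard := (Finset.card_le_card hsub).trans (Finset.card_union_le _ _)
    rcases Finset.eq_empty_or_nonempty New with hN | ⟨e₀, he₀⟩
    · rw [hN, Finset.card_empty] at hcard
      omega
    have hnew : ∀ e ∈ New, e ∈ grow (Fs s) H c₀ (b s) ∧ e ∉ Fs s ∧ e.card = S.card + c ∧ S ⊆ e := by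
      intro e he
      obtain ⟨h1, h2⟩ := Finset.mem_filter.1 he
      obtain ⟨h3, h4⟩ := mem_link.1 h1
      exact ⟨hg ▸ minF_subset _ h3, h2, h4⟩
    obtain ⟨n1, n2, n3, n4⟩ := hnew e₀ he₀
    have hHc := Finset.card_pos.2 hl.1.1
    have hc₀ := hl.1.2.1
    have hold : ∀ hlt : S.card + c < H.card + c₀, (added Fs s S c).card < θ c := fun hlt =>
      (Finset.card_le_card Finset.sdiff_subset).trans_lt (card_link_lt_of_card_lt hl hS hc hlt)
    rcases grow_sdiff_cases n1 n2 with ⟨hb, C, hC, rfl⟩ | ⟨hb, rfl⟩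
    · have hcc := card_petal hC
      have h1 := hold (by omega)
      -- A petal that contains `S` comes from a member that contains `H ∪ S`.
      have h2 : New.card ≤ (link (Fs s) (H ∪ S) c).card := by
        refine (Finset.card_le_card (t := (link (Fs s) (H ∪ S) c).image (· \ H)) ?_).trans
          Finset.card_image_le
        intro e he
        obtain ⟨m1, m2, m3, m4⟩ := hnew e he
        rcases grow_sdiff_cases m1 m2 with ⟨_, C', hC', rfl⟩ | ⟨hb', _⟩
        · refine Finset.mem_image_of_mem _ (mem_link.2 ?_)
          obtain ⟨k1, k2, k3⟩ := mem_link.1 hC'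
          have hd : Disjoint H S :=
            (Finset.disjoint_of_subset_left m4 Finset.sdiff_disjoint).symm
          refine ⟨k1, ?_, Finset.union_subset k3 (m4.trans Finset.sdiff_subset)⟩
          rw [Finset.card_union_of_disjoint hd]
          omega
        · simp [hb] at hb'
      have hd : Disjoint H S :=
        (Finset.disjoint_of_subset_left n4 Finset.sdiff_disjoint).symm
      -- Here `c₀ = S.card + c`, so members over `H ∪ S` have the same size as those of the flower,
      -- but the petals are smaller.
      have h3 : (link (Fs s) (H ∪ S) c).card < θ c := by
        by_contra! hcon
        have hu := Finset.card_union_of_disjoint hd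
        rcases hl.2 (H ∪ S) c ⟨hl.1.1.mono Finset.subset_union_left, hc, hcon⟩ with h5 | h5
        · omega
        · have := Finset.card_pos.2 hS
          omega
      omega
    · have h1 := hold (by omega)
      have h2 : New.card ≤ 1 := by
        refine Finset.card_le_one.2 fun e he e' he' => ?_
        obtain ⟨m1, m2, -⟩ := hnew e he
        obtain ⟨m1', m2', -⟩ := hnew e' he'
        rcases grow_sdiff_cases m1 m2 with ⟨hb', _⟩ | ⟨_, rfl⟩
        · simp [hb] at hb'
        rcases grow_sdiff_cases m1' m2' with ⟨hb', _⟩ | ⟨_, rfl⟩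
        · simp [hb] at hb'
        rfl
      have := hθ c
      omega

/-- The number of added members of size `c`. -/
def numAdded (Fs : ℕ → Finset (Finset ℕ)) (s c : ℕ) : ℕ :=
  ((Fs s \ Fs 0).filter fun e => e.card = c).card

/-- The number of added members of size `c` that are minimal. -/
def numMin (Fs : ℕ → Finset (Finset ℕ)) (s c : ℕ) : ℕ :=
  ((minF (Fs s) \ Fs 0).filter fun e => e.card = c).card

theorem IsRun.numAdded_succ (h : IsRun θ Fs b) (s c : ℕ) : numAdded Fs (s + 1) c =
    numAdded Fs s c + ((Fs (s + 1) \ Fs s).filter fun e => e.card = c).card := by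
  unfold numAdded
  rw [← Finset.card_union_of_disjoint, ← Finset.filter_union]
  · congr 2
    ext e
    have h1 := @IsRun.subset_succ _ _ _ h s e
    have h2 := @IsRun.subset _ _ _ h s e
    simp only [Finset.mem_sdiff, Finset.mem_union]
    tauto
  · refine Finset.disjoint_left.2 fun e h1 h2 => ?_
    simp only [Finset.mem_filter, Finset.mem_sdiff] at h1 h2
    exact h2.1.2 h1.1.1

/-- Every added set is minimal at first. Once it is no longer minimal, this is charged to a smaller
set that was added inside it at that moment; a set of size `j` takes at most `2 * θ (c - j)` such
charges by `card_added_le`. -/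
theorem IsRun.numAdded_le (hθ : ∀ c, 1 ≤ θ c) (h : IsRun θ Fs b) (h0 : Fs 0 ⊆ sets V k)
    (s c : ℕ) : numAdded Fs s c ≤
      numMin Fs s c + ∑ j ∈ Finset.range c, numAdded Fs s j * (2 * θ (c - j)) := by
  induction s with
  | zero => simp [numAdded]
  | succ s ih =>
    set New : ℕ → Finset (Finset ℕ) := fun j => (Fs (s + 1) \ Fs s).filter fun e => e.card = j
      with hNew
    set Lost := ((minF (Fs s) \ Fs 0).filter fun e => e.card = c) \ minF (Fs (s + 1)) with hLost
    have hlost : Lost.card ≤ ∑ j ∈ Finset.range c, (New j).card * (2 * θ (c - j)) := by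
      have hsub : Lost ⊆ (Finset.range c).biUnion fun j =>
          (New j).biUnion fun e' => added Fs s e' (c - j) := by
        intro e he
        obtain ⟨h1, h2⟩ := Finset.mem_sdiff.1 he
        obtain ⟨h1, hc⟩ := Finset.mem_filter.1 h1
        obtain ⟨h1, h3⟩ := Finset.mem_sdiff.1 h1
        obtain ⟨e', he', hs⟩ := exists_minF_subset (h.subset_succ s (minF_subset _ h1))
        have hne : e' ≠ e := fun h => h2 (h ▸ he')
        have hlt := Finset.card_lt_card (hs.ssubset_of_ne hne)
        simp only [Finset.mem_biUnion, Finset.mem_range]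
        refine ⟨e'.card, by omega, e', ?_, ?_⟩
        · simp only [hNew, Finset.mem_filter, Finset.mem_sdiff, and_true]
          refine ⟨minF_subset _ he', fun hF => hne ((mem_minF.1 h1).2 e' hF hs)⟩
        · exact Finset.mem_sdiff.2 ⟨mem_link.2 ⟨h1, by omega, hs⟩, h3⟩
      refine (Finset.card_le_card hsub).trans (Finset.card_biUnion_le.trans ?_)
      refine Finset.sum_le_sum fun j hj => ?_
      refine Finset.card_biUnion_le_card_mul _ _ _ fun e' he' => ?_
      simp only [hNew, Finset.mem_filter, Finset.mem_sdiff] at he'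
      refine h.card_added_le hθ s ?_ (by have := Finset.mem_range.1 hj; omega)
      exact (mem_sets.1 (h.subset_sets hθ h0 (s + 1) he'.1.1)).2.1
    have hmin : numMin Fs s c + (New c).card ≤ numMin Fs (s + 1) c + Lost.card := by
      unfold numMin
      have hdis : Disjoint ((minF (Fs s) \ Fs 0).filter fun e => e.card = c) (New c) := by
        refine Finset.disjoint_left.2 fun e h1 h2 => ?_
        simp only [hNew, Finset.mem_filter, Finset.mem_sdiff] at h1 h2
        exact h2.1.2 (minF_subset _ h1.1.1)
      rw [← Finset.card_union_of_disjoint hdis]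
      refine (Finset.card_le_card ?_).trans (Finset.card_union_le _ _)
      intro e he
      rcases Finset.mem_union.1 he with he | he
      · by_cases hm : e ∈ minF (Fs (s + 1))
        · refine Finset.mem_union_left _ ?_
          simp only [Finset.mem_filter, Finset.mem_sdiff] at he ⊢
          exact ⟨⟨hm, he.1.2⟩, he.2⟩
        · exact Finset.mem_union_right _ (Finset.mem_sdiff.2 ⟨he, hm⟩)
      · refine Finset.mem_union_left _ ?_
        simp only [hNew, Finset.mem_filter, Finset.mem_sdiff] at he ⊢
        refine ⟨⟨?_, fun h' => he.1.2 (h.subset s h')⟩, he.2⟩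
        rcases h s with ⟨H, c₀, hl, hg⟩ | ⟨h1, _⟩
        · rw [hg] at he ⊢
          exact new_mem_minF hθ hl.1 he.1.1 he.1.2
        · rw [h1] at he
          exact absurd he.1.1 he.1.2
    have e1 : ∀ j, numAdded Fs (s + 1) j = numAdded Fs s j + (New j).card :=
      h.numAdded_succ s
    simp only [e1, add_mul, Finset.sum_add_distrib]
    omega

/-- Each set contains one of `V` elements, and `card_added_le` bounds the sets through a given
element. Singletons, which have no petal left, are counted directly. -/
theorem IsRun.numMin_le (hθ : ∀ c, 1 ≤ θ c) (h : IsRun θ Fs b) (h0 : Fs 0 ⊆ sets V k)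
    (s c : ℕ) : numMin Fs s (c + 1) ≤ V * (2 * θ c) := by
  have hsets : ∀ e ∈ minF (Fs s), e ⊆ Finset.range V ∧ e.Nonempty := fun e he =>
    ⟨(mem_sets.1 (h.subset_sets hθ h0 s (minF_subset _ he))).1,
      (mem_sets.1 (h.subset_sets hθ h0 s (minF_subset _ he))).2.1⟩
  rcases Nat.eq_zero_or_pos c with rfl | hc
  · have : numMin Fs s 1 ≤ V := by
      unfold numMin
      calc _ ≤ ((Finset.range V).image fun v => ({v} : Finset ℕ)).card := by
            refine Finset.card_le_card fun e he => ?_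
            simp only [Finset.mem_filter, Finset.mem_sdiff] at he
            obtain ⟨v, rfl⟩ := Finset.card_eq_one.1 he.2
            exact Finset.mem_image_of_mem _ ((hsets _ he.1.1).1 (Finset.mem_singleton_self v))
        _ ≤ _ := Finset.card_image_le.trans (by simp)
    exact this.trans (Nat.le_mul_of_pos_right _ (by have := hθ 0; omega))
  · unfold numMin
    have hsub : ((minF (Fs s) \ Fs 0).filter fun e => e.card = c + 1) ⊆
        (Finset.range V).biUnion fun v => added Fs s {v} c := by
      intro e he
      simp only [Finset.mem_filter, Finset.mem_sdiff] at he
      obtain ⟨h1, v, hv⟩ := hsets e he.1.1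
      refine Finset.mem_biUnion.2 ⟨v, h1 hv, Finset.mem_sdiff.2 ⟨mem_link.2 ⟨he.1.1, ?_, ?_⟩,
        he.1.2⟩⟩
      · rw [Finset.card_singleton, he.2, add_comm]
      · simpa using hv
    refine (Finset.card_le_card hsub).trans ?_
    refine (Finset.card_biUnion_le_card_mul _ _ _ fun v _ =>
      h.card_added_le hθ s (Finset.singleton_nonempty v) hc).trans (by simp)

theorem IsRun.numAdded_zero (hθ : ∀ c, 1 ≤ θ c) (h : IsRun θ Fs b) (h0 : Fs 0 ⊆ sets V k)
    (s : ℕ) : numAdded Fs s 0 = 0 := by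
  refine Finset.card_eq_zero.2 (Finset.filter_eq_empty_iff.2 fun e he h => ?_)
  have := (mem_sets.1 (IsRun.subset_sets hθ ‹_› h0 s (Finset.mem_sdiff.1 he).1)).2.1
  rw [Finset.card_eq_zero.1 h] at this
  simp at this

/-- The two preceding bounds say that size `c + 1` contributes at most `2 * θ c` times the left side
for `c`, which therefore grows by a factor of at most `1 + 2 * θ c ≤ 3 * θ c`. -/
theorem IsRun.sum_numAdded_le (hθ : ∀ c, 1 ≤ θ c) (hmono : Monotone θ) (h : IsRun θ Fs b)
    (h0 : Fs 0 ⊆ sets V k) (s c : ℕ) :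
    V + ∑ j ∈ Finset.range (c + 1), numAdded Fs s j ≤ V * ∏ i ∈ Finset.range c, (3 * θ i) := by
  induction c with
  | zero => simp [h.numAdded_zero hθ h0 s]
  | succ c ih =>
    have h1 := h.numAdded_le hθ h0 s (c + 1)
    have h2 := h.numMin_le hθ h0 s c
    have h3 : ∑ j ∈ Finset.range (c + 1), numAdded Fs s j * (2 * θ (c + 1 - j)) ≤
        (∑ j ∈ Finset.range (c + 1), numAdded Fs s j) * (2 * θ c) := by
      rw [Finset.sum_mul]
      refine Finset.sum_le_sum fun j _ => ?_
      rcases Nat.eq_zero_or_pos j with rfl | hj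
      · simp [h.numAdded_zero hθ h0 s]
      · exact Nat.mul_le_mul_left _ (Nat.mul_le_mul_left _ (hmono (by omega)))
    rw [Finset.sum_range_succ, Finset.prod_range_succ]
    set X := ∑ j ∈ Finset.range (c + 1), numAdded Fs s j
    set P := ∏ i ∈ Finset.range c, (3 * θ i)
    have h4 : (V + X) * (3 * θ c) ≤ V * P * (3 * θ c) := Nat.mul_le_mul_right _ ih
    have h5 : V + X ≤ (V + X) * θ c := Nat.le_mul_of_pos_right _ (hθ c)
    calc V + (X + numAdded Fs s (c + 1)) ≤ (V + X) * θ c + (V * (2 * θ c) + X * (2 * θ c)) := by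
          omega
      _ = (V + X) * (3 * θ c) := by ring
      _ ≤ V * P * (3 * θ c) := h4
      _ = V * (P * (3 * θ c)) := by ring

/-- The steps before `s` in which petals of size `c` are added. -/
def IsPetalStep (θ : ℕ → ℕ) (Fs : ℕ → Finset (Finset ℕ)) (c s : ℕ) : Prop :=
  ∃ H, Flower θ (Fs s) H c ∧ Fs (s + 1) = grow (Fs s) H c true

-- Removing the heart is injective on sets that contain it, so each petal step adds at least `θ c`
-- new sets of size `c`.
open Classical in
theorem IsRun.card_petalSteps_mul_le (h : IsRun θ Fs b) (s c : ℕ) :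
    ((Finset.range s).filter (IsPetalStep θ Fs c)).card * θ c ≤ numAdded Fs s c := by
  induction s with
  | zero => simp
  | succ s ih =>
    rw [h.numAdded_succ, Finset.range_add_one, Finset.filter_insert]
    split_ifs with hp
    · rw [Finset.card_insert_of_notMem (by simp), add_mul, one_mul]
      refine Nat.add_le_add ih ?_
      obtain ⟨H, hf, hg⟩ := hp
      refine hf.2.2.trans ?_
      refine Finset.card_le_card_of_injOn (· \ H) (fun C hC => ?_) fun C hC C' hC' heq => ?_
      · have := petal_new hf hC
        simp only [Finset.coe_filter, Set.mem_ofPred_eq, Finset.mem_sdiff, hg]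
        exact ⟨this, card_petal hC⟩
      · have h1 := (mem_link.1 hC).2.2
        have h2 := (mem_link.1 hC').2.2
        dsimp only at heq
        rw [← Finset.sdiff_union_of_subset h1, heq, Finset.sdiff_union_of_subset h2]
    · omega

-- For each petal size, the number of steps times `θ c` is at most `V` times the product in `hY`,
-- and `θ c` exceeds that product by a factor `Y`. Heart steps are not bounded here; they need not
-- be, since it suffices to record the positions of the petal steps.
open Classical in
theorem IsRun.card_petalSteps_le (hθ : ∀ c, 1 ≤ θ c) (hmono : Monotone θ) {Y : ℕ}
    (hY : ∀ c < k, 1 ≤ c → Y * ∏ i ∈ Finset.range c, (3 * θ i) ≤ θ c) (hY0 : 0 < Y)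
    (h : IsRun θ Fs b) (h0 : Fs 0 ⊆ sets V k) (s : ℕ) :
    ((Finset.range s).filter fun s => b s = true ∧ ∃ H c, Flower θ (Fs s) H c).card ≤
      k * (V / Y) := by
  have hsub : ((Finset.range s).filter fun s => b s = true ∧ ∃ H c, Flower θ (Fs s) H c) ⊆
      (Finset.Ico 1 k).biUnion fun c => (Finset.range s).filter (IsPetalStep θ Fs c) := by
    intro s' hs'
    simp only [Finset.mem_filter, Finset.mem_biUnion, Finset.mem_Ico] at hs' ⊢
    obtain ⟨h1, h2, H', c', h3⟩ := hs'
    rcases h s' with ⟨H, c, hl, hg⟩ | ⟨_, hno⟩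
    · refine ⟨c, ⟨hl.1.2.1, ?_⟩, h1, H, hl.1, by rw [hg, h2]⟩
      obtain ⟨C, hC⟩ := hl.1.link_nonempty hθ
      have := (mem_sets.1 (h.subset_sets hθ h0 s' (minF_subset _ (mem_link.1 hC).1))).2.2
      have h4 := (mem_link.1 hC).2.1
      have h5 := Finset.card_pos.2 hl.1.1
      omega
    · exact absurd h3 (hno _ _)
  refine (Finset.card_le_card hsub).trans ?_
  refine (Finset.card_biUnion_le_card_mul _ _ (V / Y) fun c hc => ?_).trans
    (Nat.mul_le_mul_right _ (by simp))
  obtain ⟨hc1, hc2⟩ := Finset.mem_Ico.1 hc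
  rw [Nat.le_div_iff_mul_le hY0]
  set n := ((Finset.range s).filter (IsPetalStep θ Fs c)).card
  set P := ∏ i ∈ Finset.range c, (3 * θ i) with hP
  have hPpos : 0 < P := Finset.prod_pos fun i _ => by have := hθ i; omega
  have i1 : n * θ c ≤ _ := h.card_petalSteps_mul_le s c
  have i2 : _ ≤ V * P := h.sum_numAdded_le hθ hmono h0 s c
  have i3 : numAdded Fs s c ≤ ∑ j ∈ Finset.range (c + 1), numAdded Fs s j :=
    Finset.single_le_sum (f := fun j => numAdded Fs s j) (fun _ _ => Nat.zero_le _) (by simp)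
  have i4 : n * (Y * P) ≤ n * θ c := Nat.mul_le_mul_left _ (hY c hc2 hc1)
  refine Nat.le_of_mul_le_mul_right (?_ : n * Y * P ≤ V * P) hPpos
  rw [mul_assoc]
  omega

/-- As long as there is a flower, each step adds a set that was not there, and there are only `(sets
V k).card` sets. -/
theorem IsRun.no_flower (hθ : ∀ c, 1 ≤ θ c) (h : IsRun θ Fs b) (h0 : Fs 0 ⊆ sets V k) {s : ℕ}
    (hs : (sets V k).card ≤ s) (H : Finset ℕ) (c : ℕ) : ¬Flower θ (Fs s) H c := by
  intro hf
  have key : ∀ s, (∃ H c, Flower θ (Fs s) H c) → s + 1 ≤ (Fs (s + 1)).card := by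
    intro s
    induction s with
    | zero =>
      rintro ⟨H, c, hf⟩
      rcases h 0 with ⟨H', c', hl, hg⟩ | ⟨_, h2⟩
      · obtain ⟨e, he, _⟩ := exists_new hθ hl.1 (b 0)
        rw [hg]
        exact Finset.card_pos.2 ⟨e, he⟩
      · exact absurd hf (h2 _ _)
    | succ s ih =>
      rintro ⟨H, c, hf⟩
      rcases h (s + 1) with ⟨H', c', hl, hg⟩ | ⟨_, h2⟩
      · have h1 : s + 1 ≤ (Fs (s + 1)).card := by
          apply ih
          rcases h s with ⟨H', c', hl, hg⟩ | ⟨h3, _⟩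
          · exact ⟨H', c', hl.1⟩
          · exact ⟨H, c, h3 ▸ hf⟩
        obtain ⟨e, he, he'⟩ := exists_new hθ hl.1 (b (s + 1))
        rw [← hg] at he
        have : Fs (s + 1) ⊂ Fs (s + 1 + 1) :=
          (h.subset_succ _).ssubset_of_ne fun h => he' (h ▸ he)
        have := Finset.card_lt_card this
        omega
      · exact absurd hf (h2 _ _)
  have h1 := key s ⟨H, c, hf⟩
  have h2 := Finset.card_le_card (h.subset_sets hθ h0 (s + 1))
  omega

/-- Each set contains some `v`, and no singleton `{v}` is the heart of a flower. -/
theorem card_minF_le (hθ : ∀ c, 1 ≤ θ c) (hmono : Monotone θ) (hF : F ⊆ sets V k)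
    (h : ∀ H c, ¬Flower θ F H c) : (minF F).card ≤ V * (k * θ k) := by
  have hsub : minF F ⊆ (Finset.range V).biUnion fun v =>
      (Finset.range k).biUnion fun c => link F {v} c := by
    intro e he
    obtain ⟨h1, ⟨v, hv⟩, h2⟩ := mem_sets.1 (hF (minF_subset _ he))
    have := Finset.card_pos.2 ⟨v, hv⟩
    simp only [Finset.mem_biUnion]
    refine ⟨v, h1 hv, e.card - 1, Finset.mem_range.2 (by omega), mem_link.2 ⟨he, ?_, by simpa⟩⟩
    rw [Finset.card_singleton]
    omega
  refine (Finset.card_le_card hsub).trans ?_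
  refine (Finset.card_biUnion_le_card_mul _ _ (k * θ k) fun v _ => ?_).trans (by simp)
  refine (Finset.card_biUnion_le_card_mul _ _ (θ k) fun c hc => ?_).trans (by simp)
  have hck := Finset.mem_range.1 hc
  -- Flowers have nonempty petals; for `c = 0` the only candidate is `{v}` itself.
  rcases Nat.eq_zero_or_pos c with rfl | hc0
  · refine (Finset.card_le_one.2 fun e he e' he' => ?_).trans (hθ k)
    have key : ∀ e ∈ link F {v} 0, e = {v} := fun e he =>
      (Finset.eq_of_subset_of_card_le (mem_link.1 he).2.2 (mem_link.1 he).2.1.le).symm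
    rw [key e he, key e' he']
  · have := h {v} c
    simp only [Flower, Finset.singleton_nonempty, true_and, not_and, not_le] at this
    exact (this hc0).le.trans (hmono hck.le)

/-- All members of the family meet `X`. -/
def Hits (X : Set ℕ) (F : Finset (Finset ℕ)) : Prop := ∀ e ∈ F, ∃ v ∈ e, v ∈ X

theorem Hits.of_minF {X : Set ℕ} (h : Hits X (minF F)) : Hits X F := fun e he => by
  obtain ⟨e', h1, h2⟩ := exists_minF_subset he
  obtain ⟨v, hv, hX⟩ := h e' h1
  exact ⟨v, h2 hv, hX⟩

theorem Hits.mono {X : Set ℕ} {F' : Finset (Finset ℕ)} (h : Hits X F') (hF : F ⊆ F') : Hits X F :=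
  fun e he => h e (hF he)

/-- One step, for a rule `sel` that selects flowers. -/
def next (sel : Finset (Finset ℕ) → Option (Finset ℕ × ℕ)) (F : Finset (Finset ℕ)) (b : Bool) :
    Finset (Finset ℕ) :=
  match sel F with
  | none => F
  | some (H, c) => grow F H c b

/-- The process that is governed by the rule `sel` and the bits `b`. -/
def run (sel : Finset (Finset ℕ) → Option (Finset ℕ × ℕ)) (F : Finset (Finset ℕ)) (b : ℕ → Bool) :
    ℕ → Finset (Finset ℕ)
  | 0 => F
  | s + 1 => next sel (run sel F b s) (b s)

/-- The rule `sel` selects least flowers. -/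
def Selects (θ : ℕ → ℕ) (V k : ℕ) (sel : Finset (Finset ℕ) → Option (Finset ℕ × ℕ)) : Prop :=
  ∀ F ⊆ sets V k, (∀ H c, sel F = some (H, c) → LeastFlower θ F H c) ∧
    (sel F = none → ∀ H c, ¬Flower θ F H c)

/-! ### Runs that are steered by a hitting set -/

variable {sel : Finset (Finset ℕ) → Option (Finset ℕ × ℕ)}

theorem run_subset_sets (hθ : ∀ c, 1 ≤ θ c) (hsel : Selects θ V k sel) (hF : F ⊆ sets V k)
    (b : ℕ → Bool) (s : ℕ) : run sel F b s ⊆ sets V k := by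
  induction s with
  | zero => exact hF
  | succ s ih =>
    rw [run, next]
    split
    · exact ih
    · rename_i H c h
      exact grow_subset_sets hθ ((hsel _ ih).1 _ _ h).1 ih _

theorem isRun_run (hθ : ∀ c, 1 ≤ θ c) (hsel : Selects θ V k sel) (hF : F ⊆ sets V k)
    (b : ℕ → Bool) : IsRun θ (run sel F b) b := by
  intro s
  have hs := run_subset_sets hθ hsel hF b s
  rw [run, next]
  split
  · rename_i h
    exact .inr ⟨rfl, (hsel _ hs).2 h⟩
  · rename_i H c h
    exact .inl ⟨H, c, (hsel _ hs).1 _ _ h, rfl⟩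

open Classical in
/-- The process in which each bit is chosen such that `X` still meets all members. -/
noncomputable def guided (sel : Finset (Finset ℕ) → Option (Finset ℕ × ℕ)) (X : Set ℕ)
    (F : Finset (Finset ℕ)) : ℕ → Finset (Finset ℕ)
  | 0 => F
  | s + 1 => next sel (guided sel X F s)
      (decide (∃ H c, sel (guided sel X F s) = some (H, c) ∧ ∀ v ∈ H, v ∉ X))

-- Let the bit ask for petals exactly if `X` misses the heart. Then `X` hits each petal, since it
-- hits the whole member; otherwise it hits the heart. So `X` stays a hitting set, and the true bits
-- only occur at petal steps, which are few.
open Classical in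
theorem exists_bits (hθ : ∀ c, 1 ≤ θ c) (hmono : Monotone θ) {Y : ℕ}
    (hY : ∀ c < k, 1 ≤ c → Y * ∏ i ∈ Finset.range c, (3 * θ i) ≤ θ c) (hY0 : 0 < Y)
    (hsel : Selects θ V k sel) (hF : F ⊆ sets V k) {X : Set ℕ} (hX : Hits X F) (S : ℕ) :
    ∃ b : ℕ → Bool, ((Finset.range S).filter fun s => b s = true).card ≤ k * (V / Y) ∧
      ∀ s, Hits X (run sel F b s) := by
  set b : ℕ → Bool := fun s =>
    decide (∃ H c, sel (guided sel X F s) = some (H, c) ∧ ∀ v ∈ H, v ∉ X) with hb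
  have hrun : ∀ s, run sel F b s = guided sel X F s := by
    intro s
    induction s with
    | zero => rfl
    | succ s ih => rw [run, guided, ih]
  have hr := isRun_run hθ hsel hF b
  refine ⟨b, ?_, fun s => ?_⟩
  · refine (Finset.card_le_card ?_).trans (hr.card_petalSteps_le hθ hmono hY hY0 hF S)
    intro s hs
    simp only [Finset.mem_filter] at hs ⊢
    refine ⟨hs.1, hs.2, ?_⟩
    obtain ⟨H, c, h1, _⟩ := of_decide_eq_true hs.2
    rw [← hrun] at h1
    exact ⟨H, c, ((hsel _ (run_subset_sets hθ hsel hF b s)).1 _ _ h1).1⟩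
  · induction s with
    | zero => exact hX
    | succ s ih =>
      rw [run, next]
      split
      · exact ih
      · rename_i H c h
        intro e he
        by_cases heF : e ∈ run sel F b s
        · exact ih e heF
        rcases grow_sdiff_cases he heF with ⟨hbs, C, hC, rfl⟩ | ⟨hbs, rfl⟩
        · obtain ⟨H', c', h1, h2⟩ := of_decide_eq_true hbs
          rw [← hrun, h] at h1
          obtain ⟨rfl, rfl⟩ : H = H' ∧ c = c' := by simpa using h1
          obtain ⟨v, hv, hvX⟩ := ih C (minF_subset _ (mem_link.1 hC).1)
          exact ⟨v, Finset.mem_sdiff.2 ⟨hv, fun hvH => h2 v hvH hvX⟩, hvX⟩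
        · have := of_decide_eq_false hbs
          rw [← hrun] at this
          push Not at this
          exact this e c h

/-- The thresholds. -/
def thr (W c : ℕ) : ℕ := W ^ 2 ^ c

theorem one_le_thr {W : ℕ} (hW : 1 ≤ W) (c : ℕ) : 1 ≤ thr W c := Nat.one_le_pow _ _ hW

theorem thr_mono {W : ℕ} (hW : 1 ≤ W) : Monotone (thr W) := fun _ _ h =>
  Nat.pow_le_pow_right hW (Nat.pow_le_pow_right two_pos h)

/-- Doubling exponents telescope: `W` times the product of the `W ^ 2 ^ i` for `i < c` is `W ^ 2 ^
c`. -/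
theorem mul_prod_thr_le {Y W : ℕ} (hW : 3 ^ k * Y ≤ W) (hY : 0 < Y) (c : ℕ) (hc : c < k) :
    Y * ∏ i ∈ Finset.range c, (3 * thr W i) ≤ thr W c := by
  have hW1 : 0 < W := lt_of_lt_of_le (by positivity) hW
  have key : ∀ c, W * ∏ i ∈ Finset.range c, (3 * thr W i) = 3 ^ c * thr W c := by
    intro c
    induction c with
    | zero => simp [thr]
    | succ c ih =>
      rw [Finset.prod_range_succ, ← mul_assoc, ih, thr, thr, pow_succ 2, pow_mul]
      ring
  refine Nat.le_of_mul_le_mul_right (?_ : _ * W ≤ _ * W) hW1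
  calc _ = Y * (W * ∏ i ∈ Finset.range c, (3 * thr W i)) := by ring
    _ = 3 ^ c * Y * thr W c := by rw [key]; ring
    _ ≤ W * thr W c := by
      refine Nat.mul_le_mul_right _ (le_trans ?_ hW)
      exact Nat.mul_le_mul_right _ (Nat.pow_le_pow_right (by omega) hc.le)
    _ = _ := mul_comm _ _

end Sparsify

/-! ### Digits -/

theorem div_pow_succ_mod (x b i : ℕ) : x / b ^ (i + 1) % b = x / b / b ^ i % b := by
  rw [pow_succ', Nat.div_div_eq_div_mul]

/-- Tuples are coded by numbers throughout: assignments, guesses, Merlin's polynomials, messages,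
sets and tensor indices. -/
theorem exists_digits (b n : ℕ) (f : ℕ → ℕ) (hf : ∀ i < n, f i < b) :
    ∃ x < b ^ n, ∀ i < n, x / b ^ i % b = f i := by
  induction n generalizing f with
  | zero => exact ⟨0, by simp, by simp⟩
  | succ n ih =>
    obtain ⟨x, hx, h⟩ := ih (fun i => f (i + 1)) fun i hi => hf _ (by omega)
    have h0 := hf 0 (by omega)
    refine ⟨f 0 + b * x, ?_, fun i hi => ?_⟩
    · rw [pow_succ']
      calc f 0 + b * x < b * (x + 1) := by rw [mul_add]; omega
        _ ≤ b * b ^ n := Nat.mul_le_mul_left _ hx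
    · rcases i with _ | i
      · simp [Nat.mod_eq_of_lt h0]
      · rw [div_pow_succ_mod, Nat.add_mul_div_left _ _ (by omega), Nat.div_eq_of_lt h0, zero_add]
        exact h i (by omega)

theorem digits_ext {b n x y : ℕ} (hx : x < b ^ n) (hy : y < b ^ n)
    (h : ∀ i < n, x / b ^ i % b = y / b ^ i % b) : x = y := by
  induction n generalizing x y with
  | zero => simp at hx hy; omega
  | succ n ih =>
    have h0 := h 0 (by omega)
    simp only [pow_zero, Nat.div_one] at h0
    have h1 : x / b = y / b := by
      refine ih (Nat.div_lt_of_lt_mul (by rwa [← pow_succ']))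
        (Nat.div_lt_of_lt_mul (by rwa [← pow_succ'])) fun i hi => ?_
      rw [← div_pow_succ_mod, ← div_pow_succ_mod]
      exact h (i + 1) (by omega)
    rw [← Nat.div_add_mod x b, ← Nat.div_add_mod y b, h0, h1]

theorem sum_range_mul_eq {M : Type*} [AddCommMonoid M] (m n : ℕ) (f : ℕ → M) :
    ∑ x ∈ Finset.range (m * n), f x =
      ∑ i ∈ Finset.range n, ∑ j ∈ Finset.range m, f (j + m * i) := by
  induction n with
  | zero => simp
  | succ n ih =>
    rw [mul_add, mul_one, Finset.sum_range_add, ih, Finset.sum_range_succ]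
    congr 1
    exact Finset.sum_congr rfl fun j _ => by rw [add_comm]

/-! ### The Merlin–Arthur protocol -/

namespace Protocol

open Polynomial

/-- The value at `x` of the `i`-th polynomial of the first player. -/
def msgA (I : Finset ℕ) (rk : ℕ → ℕ) (L : ℕ) (u : ℕ → ℕ) (x i : ℕ) : ℕ :=
  ∑ κ ∈ I with rk κ / L = i, u κ * x ^ (rk κ % L)

/-- The value at `x` of the `i`-th polynomial of the second player. -/
def msgB (I : Finset ℕ) (rk : ℕ → ℕ) (L : ℕ) (v : ℕ → ℕ) (x i : ℕ) : ℕ :=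
  ∑ κ ∈ I with rk κ / L = i, v κ * x ^ (L - rk κ % L)

/-- The value at `x` of the polynomial with code `s` that Merlin sends; its coefficient of degree
`L` is `0`. -/
def proofVal (L q s x : ℕ) : ℕ :=
  ∑ j ∈ Finset.range (2 * L + 1), (if j = L then 0 else s / q ^ j % q) * x ^ j

variable {I : Finset ℕ} {rk : ℕ → ℕ} {L T q : ℕ} {u v : ℕ → ℕ}

/-- The sum of the products of the polynomials of the players. -/
noncomputable def poly (q : ℕ) (I : Finset ℕ) (rk : ℕ → ℕ) (L T : ℕ) (u v : ℕ → ℕ) : (ZMod q)[X] :=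
  ∑ i ∈ Finset.range T, (∑ κ ∈ I with rk κ / L = i, C (u κ : ZMod q) * X ^ (rk κ % L)) *
    ∑ κ ∈ I with rk κ / L = i, C (v κ : ZMod q) * X ^ (L - rk κ % L)

theorem eval_poly (x : ℕ) : (poly q I rk L T u v).eval (x : ZMod q) =
    ((∑ i ∈ Finset.range T, msgA I rk L u x i * msgB I rk L v x i : ℕ) : ZMod q) := by
  simp [poly, msgA, msgB, eval_finsetSum]

theorem natDegree_poly_le (hL : 0 < L) : (poly q I rk L T u v).natDegree ≤ 2 * L := by
  refine natDegree_sum_le_of_forall_le _ _ fun i _ => ?_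
  refine natDegree_mul_le.trans ?_
  have h1 : (∑ κ ∈ I with rk κ / L = i, C (u κ : ZMod q) * X ^ (rk κ % L)).natDegree ≤ L :=
    natDegree_sum_le_of_forall_le _ _ fun κ _ =>
      (natDegree_C_mul_X_pow_le _ _).trans (Nat.mod_lt _ hL).le
  have h2 : (∑ κ ∈ I with rk κ / L = i, C (v κ : ZMod q) * X ^ (L - rk κ % L)).natDegree ≤ L :=
    natDegree_sum_le_of_forall_le _ _ fun κ _ =>
      (natDegree_C_mul_X_pow_le _ _).trans (Nat.sub_le _ _)
  omega

/-- A product of terms has the exponent `r + (L - r')` with positions `r, r' < L` in one block. This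
is `L` only if `r = r'`, so only the diagonal terms contribute. -/
theorem coeff_poly (hL : 0 < L) (hinj : Set.InjOn rk I) (hrk : ∀ κ ∈ I, rk κ < T * L) :
    (poly q I rk L T u v).coeff L = ((∑ κ ∈ I, u κ * v κ : ℕ) : ZMod q) := by
  have hprod : ∀ i, ((∑ κ ∈ I with rk κ / L = i, C (u κ : ZMod q) * X ^ (rk κ % L)) *
      ∑ κ ∈ I with rk κ / L = i, C (v κ : ZMod q) * X ^ (L - rk κ % L)).coeff L =
      ∑ κ ∈ I with rk κ / L = i, (u κ : ZMod q) * v κ := by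
    intro i
    rw [Finset.sum_mul_sum, finsetSum_coeff]
    refine Finset.sum_congr rfl fun κ hκ => ?_
    rw [finsetSum_coeff, Finset.sum_eq_single κ]
    · have := Nat.mod_lt (rk κ) hL
      rw [show C (u κ : ZMod q) * X ^ (rk κ % L) * (C (v κ : ZMod q) * X ^ (L - rk κ % L)) =
        C ((u κ : ZMod q) * v κ) * X ^ (rk κ % L + (L - rk κ % L)) by
          rw [C_mul, pow_add]; ring, coeff_C_mul_X_pow, if_pos (by omega)]
    · intro κ' hκ' hne
      have h1 := Nat.mod_lt (rk κ) hL
      have h2 := Nat.mod_lt (rk κ') hL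
      rw [show C (u κ : ZMod q) * X ^ (rk κ % L) * (C (v κ' : ZMod q) * X ^ (L - rk κ' % L)) =
        C ((u κ : ZMod q) * v κ') * X ^ (rk κ % L + (L - rk κ' % L)) by
          rw [C_mul, pow_add]; ring, coeff_C_mul_X_pow, if_neg]
      intro h
      obtain ⟨m1, m2⟩ := Finset.mem_filter.1 hκ
      obtain ⟨m3, m4⟩ := Finset.mem_filter.1 hκ'
      refine hne (hinj m3 m1 ?_)
      rw [← Nat.div_add_mod (rk κ) L, ← Nat.div_add_mod (rk κ') L, m2, m4]
      omega
    · exact fun h => absurd hκ h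
  rw [poly, finsetSum_coeff]
  simp only [hprod]
  push_cast
  exact Finset.sum_fiberwise_of_maps_to (g := fun κ => rk κ / L) (t := Finset.range T)
    (fun κ hκ => Finset.mem_range.2 (Nat.div_lt_of_lt_mul (by rw [mul_comm]; exact hrk κ hκ)))
    (fun κ => (u κ : ZMod q) * v κ)

/-- Merlin's polynomial. -/
noncomputable def proofPoly (L q s : ℕ) : (ZMod q)[X] :=
  ∑ j ∈ Finset.range (2 * L + 1), C ((if j = L then 0 else s / q ^ j % q : ℕ) : ZMod q) * X ^ j

theorem eval_proofPoly (s x : ℕ) :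
    (proofPoly L q s).eval (x : ZMod q) = ((proofVal L q s x : ℕ) : ZMod q) := by
  simp [proofPoly, proofVal, eval_finsetSum]

theorem coeff_proofPoly (s j : ℕ) (hj : j < 2 * L + 1) :
    (proofPoly L q s).coeff j = ((if j = L then 0 else s / q ^ j % q : ℕ) : ZMod q) := by
  rw [proofPoly, finsetSum_coeff]
  simp only [coeff_C_mul_X_pow]
  rw [Finset.sum_ite_eq, if_pos (Finset.mem_range.2 hj)]

theorem natDegree_proofPoly_le (s : ℕ) : (proofPoly L q s).natDegree ≤ 2 * L :=
  natDegree_sum_le_of_forall_le _ _ fun j hj =>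
    (natDegree_C_mul_X_pow_le _ _).trans (by have := Finset.mem_range.1 hj; omega)

/-- Merlin sends the true polynomial, which he is able to do because its coefficient of degree `L`
vanishes. -/
theorem complete [Fact q.Prime] (hL : 0 < L) (hinj : Set.InjOn rk I)
    (hrk : ∀ κ ∈ I, rk κ < T * L) (h0 : ∑ κ ∈ I, u κ * v κ = 0) :
    ∃ s < q ^ (2 * L + 1), ∀ x, (∑ i ∈ Finset.range T, msgA I rk L u x i * msgB I rk L v x i) % q =
      proofVal L q s x % q := by
  have : NeZero q := ⟨(Fact.out : q.Prime).ne_zero⟩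
  set P := poly q I rk L T u v with hP
  obtain ⟨s, hs, hd⟩ := exists_digits q (2 * L + 1) (fun j => (P.coeff j).val)
    fun j _ => ZMod.val_lt _
  refine ⟨s, hs, fun x => ?_⟩
  have hS : proofPoly L q s = P := by
    ext j
    by_cases hj : j < 2 * L + 1
    · rw [coeff_proofPoly _ _ hj]
      split_ifs with hjL
      · rw [hjL, hP, coeff_poly hL hinj hrk, h0]
      · rw [hd j hj]
        simp
    · rw [coeff_eq_zero_of_natDegree_lt ((natDegree_proofPoly_le s).trans_lt (by omega)),
        coeff_eq_zero_of_natDegree_lt ((natDegree_poly_le hL).trans_lt (by omega))]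
  have := (eval_poly (q := q) (I := I) (rk := rk) (L := L) (T := T) (u := u) (v := v) x).symm
  rw [← hP, ← hS, eval_proofPoly] at this
  exact (ZMod.natCast_eq_natCast_iff' _ _ _).1 this

/-- The difference of the true polynomial and Merlin's has a nonzero coefficient of degree `L`, as
the inner product is smaller than `q`; so it has at most `2 * L` roots. -/
theorem sound [Fact q.Prime] (hL : 0 < L) (hinj : Set.InjOn rk I)
    (hrk : ∀ κ ∈ I, rk κ < T * L) (h0 : ∑ κ ∈ I, u κ * v κ ≠ 0)
    (hlt : ∑ κ ∈ I, u κ * v κ < q) (s : ℕ) :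
    ((Finset.range q).filter fun x =>
      (∑ i ∈ Finset.range T, msgA I rk L u x i * msgB I rk L v x i) % q =
        proofVal L q s x % q).card ≤ 2 * L := by
  set P := poly q I rk L T u v - proofPoly L q s with hP
  have hne : P ≠ 0 := by
    intro h
    have := congrArg (fun p => coeff p L) h
    simp only [hP, coeff_sub, coeff_zero, coeff_poly hL hinj hrk,
      coeff_proofPoly (L := L) (q := q) s L (by omega), if_true, Nat.cast_zero, sub_zero] at this
    rw [ZMod.natCast_eq_zero_iff] at this
    exact h0 (Nat.eq_zero_of_dvd_of_lt this hlt)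
  have hdeg : P.natDegree ≤ 2 * L :=
    (natDegree_sub_le _ _).trans (max_le (natDegree_poly_le hL) (natDegree_proofPoly_le s))
  classical
  refine le_trans ?_ ((Multiset.toFinset_card_le _).trans ((card_roots' P).trans hdeg))
  refine Finset.card_le_card_of_injOn (fun x : ℕ => (x : ZMod q)) (fun x hx => ?_) ?_
  · simp only [Finset.coe_filter, Finset.mem_range, Set.mem_ofPred_eq] at hx
    simp only [Finset.mem_coe, Multiset.mem_toFinset]
    rw [mem_roots hne, IsRoot, hP, eval_sub, eval_poly, eval_proofPoly, sub_eq_zero]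
    exact (ZMod.natCast_eq_natCast_iff' _ _ _).2 hx.2
  · intro x hx y hy hxy
    simp only [Finset.coe_filter, Finset.mem_range, Set.mem_ofPred_eq] at hx hy
    have := (ZMod.natCast_eq_natCast_iff' _ _ _).1 hxy
    rwa [Nat.mod_eq_of_lt hx.1, Nat.mod_eq_of_lt hy.1] at this

end Protocol

/-! ### Sign vectors -/

namespace SignVec

variable {q T R : ℕ}

/-- The message of the first player that is coded by the cell `I`, for the coordinate `I % q`, is
the right one. -/
def CellA (q T : ℕ) (A : ℕ → ℕ → ℕ) (I : ℕ) : Prop :=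
  ∀ i < T, I / q / q ^ i % q = A (I % q) i % q

/-- The second player accepts the message that is coded by the cell `I`. -/
def CellB (q T : ℕ) (B : ℕ → ℕ → ℕ) (S : ℕ → ℕ) (I : ℕ) : Prop :=
  (∑ i ∈ Finset.range T, I / q / q ^ i % q * B (I % q) i) % q = S (I % q) % q

open Classical in
/-- Four signs for each cell of the first player (`0` for the sign `1`, and `1` for `-1`). -/
noncomputable def negA (q T : ℕ) (A : ℕ → ℕ → ℕ) (I : ℕ) : ℕ :=
  if CellA q T A (I / 4) ∨ I % 4 < 2 then 0 else 1

open Classical in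
/-- Four signs for each cell of the second player. -/
noncomputable def negB (q T : ℕ) (B : ℕ → ℕ → ℕ) (S : ℕ → ℕ) (I : ℕ) : ℕ :=
  if CellB q T B S (I / 4) ∨ I % 4 % 2 = 0 then 0 else 1

/-- The number of coordinates for which the second player accepts. -/
def numAcc (q T : ℕ) (A B : ℕ → ℕ → ℕ) (S : ℕ → ℕ) : ℕ :=
  ((Finset.range q).filter fun x =>
    (∑ i ∈ Finset.range T, A x i * B x i) % q = S x % q).card

theorem sum_four (f : ℕ → ℤ) (n : ℕ) : ∑ x ∈ Finset.range (4 * n), f x =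
    ∑ i ∈ Finset.range n, (f (4 * i) + f (4 * i + 1) + f (4 * i + 2) + f (4 * i + 3)) := by
  rw [sum_range_mul_eq]
  refine Finset.sum_congr rfl fun i _ => ?_
  simp [Finset.sum_range_succ, add_comm]

theorem cellB_iff {A B : ℕ → ℕ → ℕ} {S : ℕ → ℕ} {I : ℕ} (hA : CellA q T A I) :
    CellB q T B S I ↔ (∑ i ∈ Finset.range T, A (I % q) i * B (I % q) i) % q = S (I % q) % q := by
  unfold CellB
  rw [Finset.sum_nat_mod, Finset.sum_congr rfl (g := fun i => A (I % q) i * B (I % q) i % q),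
    ← Finset.sum_nat_mod]
  intro i hi
  rw [hA i (Finset.mem_range.1 hi), Nat.mod_mul_mod]

/-- In a cell the first player plays `++++` or `++--`, the second one `++++` or `+-+-`. These
patterns are orthogonal unless both are constant, so a cell contributes 4 if the message is right
and accepted, and 0 otherwise. For each point there is exactly one right message. -/
theorem sum_neg (hq : 0 < q) (A B : ℕ → ℕ → ℕ) (S : ℕ → ℕ) :
    ∑ I ∈ Finset.range (4 * q ^ (T + 1)), (-1 : ℤ) ^ negA q T A I * (-1) ^ negB q T B S I =
      4 * numAcc q T A B S := by
  classical
  have h1 : ∀ I, (-1 : ℤ) ^ negA q T A (4 * I) * (-1) ^ negB q T B S (4 * I) +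
      (-1 : ℤ) ^ negA q T A (4 * I + 1) * (-1) ^ negB q T B S (4 * I + 1) +
      (-1 : ℤ) ^ negA q T A (4 * I + 2) * (-1) ^ negB q T B S (4 * I + 2) +
      (-1 : ℤ) ^ negA q T A (4 * I + 3) * (-1) ^ negB q T B S (4 * I + 3) =
      if CellA q T A I ∧ CellB q T B S I then 4 else 0 := by
    intro I
    have e0 : (4 * I) / 4 = I := by omega
    have e1 : (4 * I + 1) / 4 = I := by omega
    have e2 : (4 * I + 2) / 4 = I := by omega
    have e3 : (4 * I + 3) / 4 = I := by omega
    have f0 : (4 * I) % 4 = 0 := by omega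
    have f1 : (4 * I + 1) % 4 = 1 := by omega
    have f2 : (4 * I + 2) % 4 = 2 := by omega
    have f3 : (4 * I + 3) % 4 = 3 := by omega
    simp only [negA, negB, e0, e1, e2, e3, f0, f1, f2, f3]
    by_cases ha : CellA q T A I <;> by_cases hb : CellB q T B S I <;> simp [ha, hb]
  rw [sum_four]
  simp only [h1]
  rw [pow_succ', sum_range_mul_eq, Finset.sum_comm]
  have h2 : ∀ x ∈ Finset.range q, ∑ z ∈ Finset.range (q ^ T),
      (if CellA q T A (x + q * z) ∧ CellB q T B S (x + q * z) then (4 : ℤ) else 0) =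
      if (∑ i ∈ Finset.range T, A x i * B x i) % q = S x % q then 4 else 0 := by
    intro x hx
    have hx := Finset.mem_range.1 hx
    have e1 : ∀ z, (x + q * z) / q = z := fun z => by
      rw [Nat.add_mul_div_left _ _ hq, Nat.div_eq_of_lt hx, zero_add]
    have e2 : ∀ z, (x + q * z) % q = x := fun z => by
      rw [Nat.add_mul_mod_self_left, Nat.mod_eq_of_lt hx]
    -- The right message for the point `x`; only its cell survives in the sum.
    obtain ⟨z₀, hz₀, hd⟩ := exists_digits q T (fun i => A x i % q) fun i _ => Nat.mod_lt _ hq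
    have hc : CellA q T A (x + q * z₀) := by
      intro i hi
      rw [e1, e2, hd i hi]
    rw [Finset.sum_eq_single z₀]
    · simp only [hc, true_and, cellB_iff hc, e2]
    · intro z hz hne
      refine if_neg fun h => hne ?_
      refine digits_ext (Finset.mem_range.1 hz) hz₀ fun i hi => ?_
      have := h.1 i hi
      rw [e1, e2] at this
      rw [this, hd i hi]
    · exact fun h => absurd (Finset.mem_range.2 hz₀) h
  rw [Finset.sum_congr rfl h2, numAcc, Finset.card_filter]
  push_cast
  rw [Finset.mul_sum]
  refine Finset.sum_congr rfl fun x _ => ?_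
  split_ifs <;> simp

/-- The inner product of tensor powers is the power of the inner product; tensor coordinates are the
`R`-digit numbers in base `M`. -/
theorem sum_tensor (M R : ℕ) (a b : ℕ → ℕ) :
    ∑ J ∈ Finset.range (M ^ R), (-1 : ℤ) ^ (∑ r ∈ Finset.range R, a (J / M ^ r % M)) *
      (-1) ^ (∑ r ∈ Finset.range R, b (J / M ^ r % M)) =
    (∑ I ∈ Finset.range M, (-1 : ℤ) ^ a I * (-1) ^ b I) ^ R := by
  induction R with
  | zero => simp
  | succ R ih =>
    rcases Nat.eq_zero_or_pos M with rfl | hM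
    · simp
    rw [pow_succ', sum_range_mul_eq, pow_succ, ← ih, Finset.sum_mul]
    refine Finset.sum_congr rfl fun i _ => ?_
    rw [Finset.mul_sum]
    refine Finset.sum_congr rfl fun j hj => ?_
    have hj := Finset.mem_range.1 hj
    have h1 : ∀ f : ℕ → ℕ, ∑ r ∈ Finset.range (R + 1), f ((j + M * i) / M ^ r % M) =
        (∑ r ∈ Finset.range R, f (i / M ^ r % M)) + f j := by
      intro f
      rw [Finset.sum_range_succ']
      simp only [div_pow_succ_mod, Nat.add_mul_div_left _ _ hM, Nat.div_eq_of_lt hj, zero_add,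
        pow_zero, Nat.div_one, Nat.add_mul_mod_self_left, Nat.mod_eq_of_lt hj]
    rw [h1, h1, pow_add, pow_add]
    ring

/-- The exponent of the `J`-th sign of a vector of the first family; the last signs tell the
vectors apart. -/
noncomputable def expA (q T R : ℕ) (A : ℕ → ℕ → ℕ) (α J : ℕ) : ℕ :=
  if J < (4 * q ^ (T + 1)) ^ R then
    ∑ r ∈ Finset.range R, negA q T A (J / (4 * q ^ (T + 1)) ^ r % (4 * q ^ (T + 1)))
  else if (J - (4 * q ^ (T + 1)) ^ R) % 4 < 2 then
    α / 2 ^ ((J - (4 * q ^ (T + 1)) ^ R) / 4) % 2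
  else (J - (4 * q ^ (T + 1)) ^ R) % 4 - 2

/-- The exponent of the `J`-th sign of a vector of the second family. -/
noncomputable def expB (q T R : ℕ) (B : ℕ → ℕ → ℕ) (S : ℕ → ℕ) (β J : ℕ) : ℕ :=
  if J < (4 * q ^ (T + 1)) ^ R then
    ∑ r ∈ Finset.range R, negB q T B S (J / (4 * q ^ (T + 1)) ^ r % (4 * q ^ (T + 1)))
  else if (J - (4 * q ^ (T + 1)) ^ R) % 4 < 2 then (J - (4 * q ^ (T + 1)) ^ R) % 4
  else β / 2 ^ ((J - (4 * q ^ (T + 1)) ^ R) / 4) % 2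

/-- The padding contributes nothing: in each group of four, a repeated bit of one player is always
paired with the signs `+-` of the other. -/
theorem sum_exp (hq : 0 < q) (A B : ℕ → ℕ → ℕ) (S : ℕ → ℕ) (α β m : ℕ) :
    ∑ J ∈ Finset.range ((4 * q ^ (T + 1)) ^ R + 4 * m),
      (-1 : ℤ) ^ expA q T R A α J * (-1) ^ expB q T R B S β J =
    ((4 * numAcc q T A B S) ^ R : ℕ) := by
  rw [Finset.sum_range_add]
  have h1 : ∑ J ∈ Finset.range ((4 * q ^ (T + 1)) ^ R),
      (-1 : ℤ) ^ expA q T R A α J * (-1) ^ expB q T R B S β J =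
      ((4 * numAcc q T A B S) ^ R : ℕ) := by
    push_cast
    rw [← sum_neg hq, ← sum_tensor]
    refine Finset.sum_congr rfl fun J hJ => ?_
    have hJ := Finset.mem_range.1 hJ
    rw [expA, expB, if_pos hJ, if_pos hJ]
  rw [h1, add_eq_left, sum_four]
  refine Finset.sum_eq_zero fun i _ => ?_
  have e : ∀ r, (4 * q ^ (T + 1)) ^ R + r - (4 * q ^ (T + 1)) ^ R = r := fun r => by omega
  have e0 : (4 * i) / 4 = i := by omega
  have e1 : (4 * i + 1) / 4 = i := by omega
  have e2 : (4 * i + 2) / 4 = i := by omega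
  have e3 : (4 * i + 3) / 4 = i := by omega
  have f0 : (4 * i) % 4 = 0 := by omega
  have f1 : (4 * i + 1) % 4 = 1 := by omega
  have f2 : (4 * i + 2) % 4 = 2 := by omega
  have f3 : (4 * i + 3) % 4 = 3 := by omega
  simp [expA, expB, e, e0, e1, e2, e3, f0, f1, f2, f3]

/-- The sign vector with the given exponents. -/
def vec (d : ℕ) (e : ℕ → ℕ) : Fin d → ℤˣ := fun J => (-1) ^ e J

theorem signedIP_vec (d : ℕ) (a b : ℕ → ℕ) :
    signedIP (vec d a) (vec d b) = ∑ J ∈ Finset.range d, (-1 : ℤ) ^ a J * (-1) ^ b J := by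
  rw [signedIP, Finset.sum_range]
  exact Finset.sum_congr rfl fun J _ => by simp [vec]

theorem vec_eq_one_iff {d : ℕ} {e : ℕ → ℕ} {J : Fin d} : vec d e J = 1 ↔ e J % 2 = 0 := by
  unfold vec
  rw [← Nat.even_iff]
  rcases Nat.even_or_odd (e J) with h | h
  · simp [h]
  · rw [h.neg_one_pow]
    simp only [Nat.not_even_iff_odd.2 h, iff_false]
    decide

/-- Instances are sets without repetitions, but the tensor part may coincide for different
assignments. The padding displays the bits of the index, one per group of four, and thus separates
the vectors. -/
theorem vec_injective {h m : ℕ} (E : ℕ → ℕ → ℕ) (D : ℕ) (c : ℕ) (hc : c < 4)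
    (hE : ∀ α, ∀ i < m, E α (D + (4 * i + c)) = α / 2 ^ i % 2) (hm : h ≤ m) :
    Function.Injective fun α : Fin (2 ^ h) => vec (D + 4 * m) (E α) := by
  intro α β hαβ
  refine Fin.ext (digits_ext (b := 2) (n := h) α.2 β.2 fun i hi => ?_)
  have h1 := congrFun hαβ ⟨D + (4 * i + c), by omega⟩
  have h2 : vec (D + 4 * m) (E α) ⟨D + (4 * i + c), by omega⟩ = 1 ↔
    vec (D + 4 * m) (E β) ⟨D + (4 * i + c), by omega⟩ = 1 := by
    dsimp only at h1
    rw [h1]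
  rw [vec_eq_one_iff, vec_eq_one_iff] at h2
  dsimp only at h2
  rw [hE _ i (by omega), hE _ i (by omega)] at h2
  omega

theorem expA_pad (A : ℕ → ℕ → ℕ) (α i : ℕ) :
    expA q T R A α ((4 * q ^ (T + 1)) ^ R + (4 * i + 0)) = α / 2 ^ i % 2 := by
  have e0 : (4 * i) / 4 = i := by omega
  have f0 : (4 * i) % 4 = 0 := by omega
  simp [expA, e0, f0]

theorem expB_pad (B : ℕ → ℕ → ℕ) (S : ℕ → ℕ) (β i : ℕ) :
    expB q T R B S β ((4 * q ^ (T + 1)) ^ R + (4 * i + 2)) = β / 2 ^ i % 2 := by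
  have e0 : (4 * i + 2) / 4 = i := by omega
  have f0 : (4 * i + 2) % 4 = 2 := by omega
  have e : (4 * q ^ (T + 1)) ^ R + (4 * i + 2) - (4 * q ^ (T + 1)) ^ R = 4 * i + 2 := by omega
  simp [expB, e0, f0, e]

end SignVec

/-! ### The reduction -/

namespace Red

open Sparsify WordRAM

/-- The `j`-th digit of the code of a set. -/
def digit (V κ j : ℕ) : ℕ := κ / V ^ j % V

/-- The set with code `κ`. -/
def codeSet (V k κ : ℕ) : Finset ℕ := (Finset.range k).image (digit V κ)

/-- The least code of a set. -/
def Canon (V k κ : ℕ) : Prop := ∀ κ' < κ, codeSet V k κ' ≠ codeSet V k κ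

variable {V k h : ℕ}

theorem mem_codeSet {κ v : ℕ} : v ∈ codeSet V k κ ↔ ∃ j < k, digit V κ j = v := by
  simp [codeSet]

theorem codeSet_mem_sets (hV : 0 < V) (hk : 0 < k) (κ : ℕ) : codeSet V k κ ∈ sets V k := by
  refine mem_sets.2 ⟨fun v hv => ?_, ⟨digit V κ 0, mem_codeSet.2 ⟨0, hk, rfl⟩⟩,
    Finset.card_image_le.trans (by simp)⟩
  obtain ⟨j, _, rfl⟩ := mem_codeSet.1 hv
  exact Finset.mem_range.2 (Nat.mod_lt _ hV)

theorem exists_codeSet {e : Finset ℕ} (he : e ∈ sets V k) : ∃ κ < V ^ k, codeSet V k κ = e := by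
  obtain ⟨h1, ⟨v₀, hv₀⟩, h3⟩ := mem_sets.1 he
  have hlen : e.toList.length = e.card := e.length_toList
  obtain ⟨κ, hκ, hd⟩ := exists_digits V k (fun j => e.toList.getD j v₀) (by
    intro j _
    have : e.toList.getD j v₀ ∈ e := by
      by_cases hj : j < e.toList.length
      · rw [List.getD_eq_getElem _ _ hj]
        exact Finset.mem_toList.1 (List.getElem_mem hj)
      · rw [List.getD_eq_default _ _ (by omega)]
        exact hv₀
    exact Finset.mem_range.1 (h1 this))
  refine ⟨κ, hκ, ?_⟩
  ext v
  rw [mem_codeSet]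
  constructor
  · rintro ⟨j, hj, rfl⟩
    rw [digit, hd j hj]
    by_cases hj : j < e.toList.length
    · rw [List.getD_eq_getElem _ _ hj]
      exact Finset.mem_toList.1 (List.getElem_mem hj)
    · rw [List.getD_eq_default _ _ (by omega)]
      exact hv₀
  · intro hv
    obtain ⟨j, hj, hjv⟩ := List.getElem_of_mem (Finset.mem_toList.2 hv)
    refine ⟨j, by omega, ?_⟩
    rw [digit, hd j (by omega), List.getD_eq_getElem _ _ hj, hjv]

theorem exists_canon {e : Finset ℕ} (he : e ∈ sets V k) :
    ∃ κ < V ^ k, Canon V k κ ∧ codeSet V k κ = e := by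
  classical
  obtain ⟨κ, hκ, hc⟩ := exists_codeSet he
  have hex : ∃ κ, codeSet V k κ = e := ⟨κ, hc⟩
  refine ⟨Nat.find hex, (Nat.find_min' hex hc).trans_lt hκ, fun κ' hκ' h' => ?_, Nat.find_spec hex⟩
  exact Nat.find_min hex hκ' (h'.trans (Nat.find_spec hex))

theorem Canon.eq {κ κ' : ℕ} (h : Canon V k κ) (h' : Canon V k κ')
    (he : codeSet V k κ = codeSet V k κ') : κ = κ' := by
  rcases lt_trichotomy κ κ' with hlt | heq | hlt
  · exact absurd he (h' _ hlt)
  · exact heq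
  · exact absurd he.symm (h _ hlt)

open Classical in
/-- The number of sets with a property can be counted through their codes. -/
theorem card_filter_canon (V k : ℕ) (F : Finset (Finset ℕ)) (hF : F ⊆ sets V k) :
    ((Finset.range (V ^ k)).filter fun κ => Canon V k κ ∧ codeSet V k κ ∈ F).card = F.card := by
  refine Finset.card_bij (fun κ _ => codeSet V k κ) (fun κ hκ => (Finset.mem_filter.1 hκ).2.2)
    (fun κ hκ κ' hκ' he => (Finset.mem_filter.1 hκ).2.1.eq (Finset.mem_filter.1 hκ').2.1 he)
    fun e he => ?_
  obtain ⟨κ, h1, h2, h3⟩ := exists_canon (hF he)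
  exact ⟨κ, by simp [h1, h2, h3, he], h3⟩

theorem card_sets_le (V k : ℕ) : (sets V k).card ≤ V ^ k := by
  classical
  rw [← card_filter_canon V k _ le_rfl]
  exact (Finset.card_filter_le _ _).trans (by simp)

/-! #### Selection of flowers -/

/-- The index `f` codes the flower with the heart `f % U`, the size `f / U % (k + 1)` of petals and
the size `f / U / (k + 1)` of members, where `U = V ^ k`. -/
def IsFlowerIdx (θ : ℕ → ℕ) (V k : ℕ) (F : Finset (Finset ℕ)) (f : ℕ) : Prop :=
  Flower θ F (codeSet V k (f % V ^ k)) (f / V ^ k % (k + 1)) ∧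
    (codeSet V k (f % V ^ k)).card + f / V ^ k % (k + 1) = f / V ^ k / (k + 1)

/-- The least index of a flower. -/
noncomputable def selIdx (θ : ℕ → ℕ) (V k : ℕ) (F : Finset (Finset ℕ)) : ℕ :=
  firstIdx (IsFlowerIdx θ V k F) ((k + 1) * (k + 1) * V ^ k)

/-- The flower with the least index. -/
noncomputable def sel (θ : ℕ → ℕ) (V k : ℕ) (F : Finset (Finset ℕ)) : Option (Finset ℕ × ℕ) :=
  if selIdx θ V k F < (k + 1) * (k + 1) * V ^ k then
    some (codeSet V k (selIdx θ V k F % V ^ k), selIdx θ V k F / V ^ k % (k + 1))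
  else none

theorem exists_flowerIdx {θ : ℕ → ℕ} (hθ : ∀ c, 1 ≤ θ c) {F : Finset (Finset ℕ)}
    (hF : F ⊆ sets V k) {H : Finset ℕ} {c : ℕ} (hf : Flower θ F H c) :
    ∃ f < (k + 1) * (k + 1) * V ^ k, IsFlowerIdx θ V k F f ∧
      f / V ^ k % (k + 1) = c ∧ f / V ^ k / (k + 1) = H.card + c := by
  obtain ⟨C, hC⟩ := hf.link_nonempty hθ
  obtain ⟨h1, h2, h3⟩ := mem_link.1 hC
  obtain ⟨h4, h5, h6⟩ := mem_sets.1 (hF (minF_subset _ h1))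
  have hH : H ∈ sets V k := mem_sets.2 ⟨h3.trans h4, hf.1, by omega⟩
  obtain ⟨κ, hκ, rfl⟩ := exists_codeSet hH
  set w := (codeSet V k κ).card + c with hw
  have hck : c < k + 1 := by omega
  have hU : 0 < V ^ k := by omega
  have e1 : (κ + V ^ k * (c + (k + 1) * w)) % V ^ k = κ := by
    rw [Nat.add_mul_mod_self_left, Nat.mod_eq_of_lt hκ]
  have e2 : (κ + V ^ k * (c + (k + 1) * w)) / V ^ k = c + (k + 1) * w := by
    rw [Nat.add_mul_div_left _ _ hU, Nat.div_eq_of_lt hκ, zero_add]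
  have e3 : (c + (k + 1) * w) % (k + 1) = c := by
    rw [Nat.add_mul_mod_self_left, Nat.mod_eq_of_lt hck]
  have e4 : (c + (k + 1) * w) / (k + 1) = w := by
    rw [Nat.add_mul_div_left _ _ (by omega), Nat.div_eq_of_lt hck, zero_add]
  refine ⟨κ + V ^ k * (c + (k + 1) * w), ?_, ?_, ?_, ?_⟩
  · have i1 : c + (k + 1) * w + 1 ≤ (k + 1) * (k + 1) := by
      have : (k + 1) * w ≤ (k + 1) * k := Nat.mul_le_mul_left _ (by omega)
      nlinarith
    calc κ + V ^ k * (c + (k + 1) * w) < V ^ k * (c + (k + 1) * w + 1) := by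
          rw [mul_add _ (c + (k + 1) * w) 1, mul_one]; omega
      _ ≤ V ^ k * ((k + 1) * (k + 1)) := Nat.mul_le_mul_left _ i1
      _ = _ := mul_comm _ _
  · unfold IsFlowerIdx
    rw [e1, e2, e3, e4]
    exact ⟨hf, rfl⟩
  · rw [e2, e3]
  · rw [e2, e4]

/-- The size of the members is the most significant part of the index, followed by the size of the
petals, so the order of the indices refines the one in `LeastFlower`. -/
theorem selects_sel {θ : ℕ → ℕ} (hθ : ∀ c, 1 ≤ θ c) (V k : ℕ) : Selects θ V k (sel θ V k) := by
  intro F hF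
  constructor
  · intro H c hs
    unfold sel at hs
    split_ifs at hs with hlt
    obtain ⟨rfl, rfl⟩ : codeSet V k (selIdx θ V k F % V ^ k) = H ∧
        selIdx θ V k F / V ^ k % (k + 1) = c := by simpa using hs
    have hex : ∃ f < (k + 1) * (k + 1) * V ^ k, IsFlowerIdx θ V k F f := by
      by_contra! hcon
      exact hlt.ne (firstIdx_eq_of_forall hcon)
    obtain ⟨f, hf, hF'⟩ := hex
    obtain ⟨_, h2, h3⟩ := firstIdx_spec hf hF'
    refine ⟨h2.1, fun H' c' hfl => ?_⟩
    obtain ⟨f', hf', hi, hc', hw'⟩ := exists_flowerIdx hθ hF hfl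
    have hle : selIdx θ V k F ≤ f' := by
      by_contra! hcon
      exact h3 f' hcon hi
    have h4 : _ = selIdx θ V k F / V ^ k / (k + 1) := h2.2
    change (codeSet V k (selIdx θ V k F % V ^ k)).card + selIdx θ V k F / V ^ k % (k + 1) = _ at h4
    rw [h4, ← hw', ← hc']
    have hle' : selIdx θ V k F / V ^ k ≤ f' / V ^ k := Nat.div_le_div_right hle
    generalize selIdx θ V k F / V ^ k = a at hle' ⊢
    generalize f' / V ^ k = b at hle' ⊢
    rcases Nat.lt_or_eq_of_le (Nat.div_le_div_right (c := k + 1) hle') with h5 | h5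
    · exact .inl h5
    · refine .inr ⟨h5, ?_⟩
      have h6 := Nat.div_add_mod a (k + 1)
      have h7 := Nat.div_add_mod b (k + 1)
      rw [h5] at h6
      omega
  · intro hs H c hfl
    unfold sel at hs
    split_ifs at hs with hlt
    obtain ⟨f', hf', hi, _⟩ := exists_flowerIdx hθ hF hfl
    exact hlt (firstIdx_spec hf' hi).1

/-! #### Parameters -/

/-- The logarithm of the logarithm of the number of vectors. -/
def len (h : ℕ) : ℕ := Nat.log 2 h

/-- The logarithm of the dimension. -/
def dimExp (h : ℕ) : ℕ := 2 ^ (len h - (len h).sqrt)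

/-- The dimension, for `2 ^ h` vectors. -/
def dim (h : ℕ) : ℕ := 2 ^ dimExp h

/-- The number of repetitions, which is the logarithm of the gap. -/
def reps (h : ℕ) : ℕ := 2 ^ (len h - 2 * (len h).sqrt)

/-- The maximal number of steps in which petals are added. -/
def maxPetal (k h : ℕ) : ℕ := k * (4 * h / len h ^ 2)

/-- The base of the thresholds. -/
def base (k h : ℕ) : ℕ := 3 ^ k * len h ^ 2

/-- The number of polynomials of a player. -/
def blocks (k h : ℕ) : ℕ := len h ^ (2 ^ (k + 1) + 3)

/-- The number of clauses for one polynomial. -/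
def deg (h : ℕ) : ℕ := h / len h ^ 2

/-- The prime number. -/
noncomputable def prm (h : ℕ) : ℕ := firstIdx (fun i => h ^ 2 < i ∧ Nat.Prime i) (2 * h ^ 2 + 1)

/-- The number of codes of sets, and of steps. -/
def numCodes (k h : ℕ) : ℕ := (4 * h) ^ k

/-- The number of ways to choose the steps in which petals are added. -/
def numGuess (k h : ℕ) : ℕ := (numCodes k h + 1) ^ maxPetal k h

/-- The number of Merlin's polynomials. -/
noncomputable def numProof (h : ℕ) : ℕ := prm h ^ (2 * deg h + 1)

/-- The number `h` is large enough. -/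
structure Good (k h : ℕ) : Prop where
  len_pos : 0 < len h
  deg_pos : 0 < deg h
  clauses_le : 4 * h * (k * thr (base k h) k) ≤ blocks k h * deg h
  clauses_le_sq : 4 * h * (k * thr (base k h) k) ≤ h ^ 2
  deg_le : 4 * deg h ≤ h ^ 2
  dim_le : (4 * prm h ^ (blocks k h + 1)) ^ reps h + 4 * h ≤ dim h
  numProof_le : numProof h ≤ 2 ^ h
  numGuess_le : numGuess k h ≤ 2 ^ h
  dimExp_le : dimExp h ≤ h
  two_le_dimExp : 2 ≤ dimExp h

/-- Bertrand's postulate. The lower bound puts the prime above the number of clauses and above `4 *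
deg h`; the upper bound allows for trial division. -/
theorem prm_spec (hh : 0 < h) : h ^ 2 < prm h ∧ (prm h).Prime ∧ prm h ≤ 2 * h ^ 2 := by
  obtain ⟨p, hp, h1, h2⟩ := Nat.exists_prime_lt_and_le_two_mul (h ^ 2) (by positivity)
  obtain ⟨h3, h4, _⟩ := firstIdx_spec (P := fun i => h ^ 2 < i ∧ Nat.Prime i)
    (X := 2 * h ^ 2 + 1) (i := p) (by omega) ⟨h1, hp⟩
  exact ⟨h4.1, h4.2, Nat.lt_succ_iff.1 h3⟩

open Classical in
/-- The bits that are coded by `g`. -/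
noncomputable def bits (k h g s : ℕ) : Bool :=
  decide (∃ i < maxPetal k h, g / (numCodes k h + 1) ^ i % (numCodes k h + 1) = s)

/-- The sets of literals after `s` steps. -/
noncomputable def fam (k h : ℕ) (F₀ : Finset (Finset ℕ)) (g s : ℕ) : Finset (Finset ℕ) :=
  run (sel (thr (base k h)) (4 * h) k) F₀ (bits k h g) s

/-- The sparse formula. -/
noncomputable def final (k h : ℕ) (F₀ : Finset (Finset ℕ)) (g : ℕ) : Finset (Finset ℕ) :=
  fam k h F₀ g (numCodes k h)

open Classical in
/-- The codes of the clauses of a sparse formula. -/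
noncomputable def clauseCodes (k h : ℕ) (F : Finset (Finset ℕ)) : Finset ℕ :=
  (Finset.range (numCodes k h)).filter fun κ => Canon (4 * h) k κ ∧ codeSet (4 * h) k κ ∈ minF F

open Classical in
/-- The position of a clause. -/
noncomputable def rank (k h : ℕ) (F : Finset (Finset ℕ)) (κ : ℕ) : ℕ :=
  ((Finset.range κ).filter fun κ' => Canon (4 * h) k κ' ∧ codeSet (4 * h) k κ' ∈ minF F).card

/-- The assignment `α` of the first half of the variables does not satisfy the clause. -/
noncomputable def missA (k h α κ : ℕ) : ℕ :=
  ind (∀ j < k, digit (4 * h) κ j / 2 < h →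
    α / 2 ^ (digit (4 * h) κ j / 2) % 2 ≠ digit (4 * h) κ j % 2)

/-- The assignment `β` of the second half of the variables does not satisfy the clause. -/
noncomputable def missB (k h β κ : ℕ) : ℕ :=
  ind (∀ j < k, h ≤ digit (4 * h) κ j / 2 →
    β / 2 ^ (digit (4 * h) κ j / 2 - h) % 2 ≠ digit (4 * h) κ j % 2)

/-- The literals that are satisfied. -/
def trueLits (h α β : ℕ) : Set ℕ :=
  {v | (v / 2 < h ∧ α / 2 ^ (v / 2) % 2 = v % 2) ∨ (h ≤ v / 2 ∧ β / 2 ^ (v / 2 - h) % 2 = v % 2)}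

theorem miss_mul_eq_zero {α β κ : ℕ} : missA k h α κ * missB k h β κ = 0 ↔
    ∃ v ∈ codeSet (4 * h) k κ, v ∈ trueLits h α β := by
  rw [mul_eq_zero, missA, missB, ind_eq_zero, ind_eq_zero]
  push Not
  simp only [mem_codeSet, trueLits, Set.mem_ofPred_eq]
  constructor
  · rintro (⟨j, hj, h1, h2⟩ | ⟨j, hj, h1, h2⟩)
    · exact ⟨_, ⟨j, hj, rfl⟩, .inl ⟨h1, h2⟩⟩
    · exact ⟨_, ⟨j, hj, rfl⟩, .inr ⟨h1, h2⟩⟩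
  · rintro ⟨_, ⟨j, hj, rfl⟩, ⟨h1, h2⟩ | ⟨h1, h2⟩⟩
    · exact .inl ⟨j, hj, h1, h2⟩
    · exact .inr ⟨j, hj, h1, h2⟩

theorem sum_miss_eq_zero {F : Finset (Finset ℕ)} (hF : F ⊆ sets (4 * h) k) {α β : ℕ} :
    ∑ κ ∈ clauseCodes k h F, missA k h α κ * missB k h β κ = 0 ↔
      Hits (trueLits h α β) (minF F) := by
  rw [Finset.sum_eq_zero_iff]
  simp only [miss_mul_eq_zero]
  constructor
  · intro H e he
    obtain ⟨κ, h1, h2, rfl⟩ := exists_canon (hF (minF_subset _ he))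
    exact H κ (by simpa [clauseCodes, numCodes, h1, h2] using he)
  · intro H κ hκ
    simp only [clauseCodes, Finset.mem_filter] at hκ
    exact H _ hκ.2.2

theorem sum_miss_le {F : Finset (Finset ℕ)} (hF : F ⊆ sets (4 * h) k) {α β : ℕ} :
    ∑ κ ∈ clauseCodes k h F, missA k h α κ * missB k h β κ ≤ (minF F).card := by
  rw [← card_filter_canon (4 * h) k _ ((minF_subset F).trans hF)]
  refine (Finset.sum_le_card_nsmul _ _ 1 fun κ _ => ?_).trans (by simp [clauseCodes, numCodes])
  exact Nat.mul_le_mul (ind_le_one _) (ind_le_one _)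

theorem rank_injOn (F : Finset (Finset ℕ)) : Set.InjOn (rank k h F) (clauseCodes k h F) := by
  classical
  have key : ∀ κ ∈ clauseCodes k h F, ∀ κ', κ < κ' → rank k h F κ < rank k h F κ' := by
    intro κ hκ κ' hlt
    refine Finset.card_lt_card ⟨Finset.filter_subset_filter _ (Finset.range_mono hlt.le), ?_⟩
    intro hcon
    have h1 : κ ∈ (Finset.range κ').filter fun κ' =>
        Canon (4 * h) k κ' ∧ codeSet (4 * h) k κ' ∈ minF F :=
      Finset.mem_filter.2 ⟨Finset.mem_range.2 hlt, (Finset.mem_filter.1 hκ).2⟩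
    have := (Finset.mem_filter.1 (hcon h1)).1
    simp at this
  intro κ hκ κ' hκ' he
  rcases lt_trichotomy κ κ' with hlt | heq | hlt
  · exact absurd he (key κ hκ κ' hlt).ne
  · exact heq
  · exact absurd he (key κ' hκ' κ hlt).ne'

theorem rank_lt {F : Finset (Finset ℕ)} (hF : F ⊆ sets (4 * h) k) {κ : ℕ}
    (hκ : κ ∈ clauseCodes k h F) : rank k h F κ < (minF F).card := by
  classical
  rw [← card_filter_canon (4 * h) k _ ((minF_subset F).trans hF)]
  obtain ⟨h1, h2⟩ := Finset.mem_filter.1 hκ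
  have h1 := Finset.mem_range.1 h1
  refine Finset.card_lt_card ⟨Finset.filter_subset_filter _ (Finset.range_mono h1.le), ?_⟩
  intro hcon
  have h3 := hcon (Finset.mem_filter.2 ⟨Finset.mem_range.2 h1, h2⟩)
  simp at h3

/-- The exponents of the signs of the vectors of the first family. -/
noncomputable def entA (k h : ℕ) (F : Finset (Finset ℕ)) (α J : ℕ) : ℕ :=
  SignVec.expA (prm h) (blocks k h) (reps h)
    (Protocol.msgA (clauseCodes k h F) (rank k h F) (deg h) (missA k h α)) α J

/-- The exponents of the signs of the vectors of the second family. -/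
noncomputable def entB (k h : ℕ) (F : Finset (Finset ℕ)) (s β J : ℕ) : ℕ :=
  SignVec.expB (prm h) (blocks k h) (reps h)
    (Protocol.msgB (clauseCodes k h F) (rank k h F) (deg h) (missB k h β))
    (Protocol.proofVal (deg h) (prm h) s) β J

/-- The first family of vectors. -/
noncomputable def vecA (k h : ℕ) (F : Finset (Finset ℕ)) (α : Fin (2 ^ h)) : Fin (dim h) → ℤˣ :=
  SignVec.vec (dim h) (entA k h F α)

/-- The second family of vectors. -/
noncomputable def vecB (k h : ℕ) (F : Finset (Finset ℕ)) (s : ℕ) (β : Fin (2 ^ h)) :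
    Fin (dim h) → ℤˣ :=
  SignVec.vec (dim h) (entB k h F s β)

theorem Good.pos (hg : Good k h) : 0 < h := by
  have := hg.deg_pos
  rcases Nat.eq_zero_or_pos h with rfl | hh
  · simp [deg] at this
  · exact hh

theorem Good.base_pos (hg : Good k h) : 1 ≤ base k h := by
  have := hg.len_pos
  unfold base
  exact Nat.one_le_iff_ne_zero.2 (by positivity)

/-- Both the dimension and the size of the tensor part are divisible by 4, so what is left splits
into groups of four, at least one for each bit of an index. -/
theorem Good.dim_eq (hg : Good k h) : ∃ m, h ≤ m ∧
    dim h = (4 * prm h ^ (blocks k h + 1)) ^ reps h + 4 * m := by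
  have h1 := hg.dim_le
  have h2 : 4 ∣ dim h := by
    unfold dim
    exact pow_dvd_pow 2 hg.two_le_dimExp
  have h3 : 4 ∣ (4 * prm h ^ (blocks k h + 1)) ^ reps h :=
    dvd_pow (Dvd.intro _ rfl) (by unfold reps; positivity)
  obtain ⟨a, ha⟩ := h2
  obtain ⟨b, hb⟩ := h3
  exact ⟨a - b, by omega, by omega⟩

theorem Good.vecA_injective (hg : Good k h) (F : Finset (Finset ℕ)) :
    Function.Injective (vecA k h F) := by
  obtain ⟨m, hm, hd⟩ := hg.dim_eq
  have := SignVec.vec_injective (h := h) (m := m) (entA k h F) _ 0 (by omega)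
    (fun α i _ => SignVec.expA_pad _ α i) hm
  unfold vecA
  rw [hd]
  exact this

theorem Good.vecB_injective (hg : Good k h) (F : Finset (Finset ℕ)) (s : ℕ) :
    Function.Injective (vecB k h F s) := by
  obtain ⟨m, hm, hd⟩ := hg.dim_eq
  have := SignVec.vec_injective (h := h) (m := m) (entB k h F s) _ 2 (by omega)
    (fun α i _ => SignVec.expB_pad _ _ α i) hm
  unfold vecB
  rw [hd]
  exact this

/-- The number of coordinates of the protocol for which the assignments are accepted. -/
noncomputable def acc (k h : ℕ) (F : Finset (Finset ℕ)) (s α β : ℕ) : ℕ :=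
  SignVec.numAcc (prm h) (blocks k h)
    (Protocol.msgA (clauseCodes k h F) (rank k h F) (deg h) (missA k h α))
    (Protocol.msgB (clauseCodes k h F) (rank k h F) (deg h) (missB k h β))
    (Protocol.proofVal (deg h) (prm h) s)

theorem Good.signedIP_eq (hg : Good k h) (F : Finset (Finset ℕ)) (s : ℕ) (α β : Fin (2 ^ h)) :
    signedIP (vecA k h F α) (vecB k h F s β) = ((4 * acc k h F s α β) ^ reps h : ℕ) := by
  obtain ⟨m, hm, hd⟩ := hg.dim_eq
  rw [vecA, vecB, SignVec.signedIP_vec, hd]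
  exact SignVec.sum_exp (prm_spec hg.pos).2.1.pos _ _ _ _ _ _

theorem fam_subset (hg : Good k h) {F₀ : Finset (Finset ℕ)} (h0 : F₀ ⊆ sets (4 * h) k)
    (g s : ℕ) : fam k h F₀ g s ⊆ sets (4 * h) k :=
  run_subset_sets (one_le_thr hg.base_pos) (selects_sel (one_le_thr hg.base_pos) _ _) h0 _ _

/-- There are as many steps as codes, hence at least as many as sets, so no flower is left at the
end. -/
theorem card_minF_final_le (hg : Good k h) {F₀ : Finset (Finset ℕ)} (h0 : F₀ ⊆ sets (4 * h) k)
    (g : ℕ) : (minF (final k h F₀ g)).card ≤ 4 * h * (k * thr (base k h) k) := by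
  have hθ := one_le_thr hg.base_pos
  refine card_minF_le hθ (thr_mono hg.base_pos) (fam_subset hg h0 _ _) ?_
  have hr := isRun_run hθ (selects_sel hθ (4 * h) k) h0 (bits k h g)
  exact fun H c => hr.no_flower hθ h0 (card_sets_le _ _) H c

/-- If the formula is unsatisfiable, then all inner products are small. -/
theorem acc_le (hg : Good k h) {F₀ : Finset (Finset ℕ)} (h0 : F₀ ⊆ sets (4 * h) k)
    {α β : ℕ} (hX : ¬Hits (trueLits h α β) F₀) (g s : ℕ) :
    acc k h (final k h F₀ g) s α β ≤ 2 * deg h := by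
  have hF : final k h F₀ g ⊆ _ := fam_subset hg h0 g (numCodes k h)
  have hθ := one_le_thr hg.base_pos
  obtain ⟨hq1, hq2, _⟩ := prm_spec hg.pos
  have : Fact (prm h).Prime := ⟨hq2⟩
  have hcard := card_minF_final_le hg h0 g
  refine Protocol.sound hg.deg_pos (rank_injOn _) (fun κ hκ => ?_) ?_ ?_ s
  · exact (rank_lt hF hκ).trans_le (hcard.trans hg.clauses_le)
  · rw [Ne, sum_miss_eq_zero hF]
    intro hh
    exact hX (hh.of_minF.mono
      ((isRun_run hθ (selects_sel hθ (4 * h) k) h0 (bits k h g)).subset _))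
  · exact ((sum_miss_le hF).trans (hcard.trans hg.clauses_le_sq)).trans_lt hq1

theorem run_congr (selr : Finset (Finset ℕ) → Option (Finset ℕ × ℕ)) (F₀ : Finset (Finset ℕ))
    {b b' : ℕ → Bool} {S : ℕ} (hb : ∀ s < S, b s = b' s) : run selr F₀ b S = run selr F₀ b' S := by
  induction S with
  | zero => rfl
  | succ S ih =>
    rw [run, run, ih fun s hs => hb s (by omega), hb S (by omega)]

/-- If the formula is satisfiable, then there is a large inner product. -/
theorem exists_acc_eq (hg : Good k h) {F₀ : Finset (Finset ℕ)} (h0 : F₀ ⊆ sets (4 * h) k)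
    {α β : ℕ} (hX : Hits (trueLits h α β) F₀) :
    ∃ g < numGuess k h, ∃ s < numProof h, acc k h (final k h F₀ g) s α β = prm h := by
  classical
  have hθ := one_le_thr hg.base_pos
  obtain ⟨hq1, hq2, _⟩ := prm_spec hg.pos
  have : Fact (prm h).Prime := ⟨hq2⟩
  have hlen := hg.len_pos
  -- This `Y` turns the bound for the petal steps into `maxPetal k h`, and `base k h` is the least
  -- base that `mul_prod_thr_le` admits for it.
  obtain ⟨b, hb, hrun⟩ := exists_bits (Y := len h ^ 2) hθ (thr_mono hg.base_pos)
    (fun c hc _ => mul_prod_thr_le le_rfl (by positivity) c hc) (by positivity)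
    (selects_sel hθ (4 * h) k) h0 hX (numCodes k h)
  set P := (Finset.range (numCodes k h)).filter fun s => b s = true with hP
  -- The digits of the guess list the petal steps. Superfluous digits are `numCodes k h`, which is
  -- not the number of a step.
  obtain ⟨g, hg', hd⟩ := exists_digits (numCodes k h + 1) (maxPetal k h)
    (fun i => P.toList.getD i (numCodes k h)) (by
      intro i _
      by_cases hi : i < P.toList.length
      · rw [List.getD_eq_getElem _ _ hi]
        have := Finset.mem_toList.1 (List.getElem_mem hi)
        have := Finset.mem_range.1 (Finset.mem_filter.1 this).1
        omega
      · rw [List.getD_eq_default _ _ (by omega)]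
        omega)
  have hbits : ∀ s < numCodes k h, bits k h g s = b s := by
    intro s hs
    rw [Bool.eq_iff_iff, bits, decide_eq_true_iff]
    constructor
    · rintro ⟨i, hi, rfl⟩
      rw [hd i hi] at hs ⊢
      by_cases hi' : i < P.toList.length
      · rw [List.getD_eq_getElem _ _ hi']
        exact (Finset.mem_filter.1 (Finset.mem_toList.1 (List.getElem_mem hi'))).2
      · rw [List.getD_eq_default _ _ (by omega)] at hs
        omega
    · intro hbs
      have hsP : s ∈ P.toList := Finset.mem_toList.2
        (Finset.mem_filter.2 ⟨Finset.mem_range.2 hs, hbs⟩)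
      obtain ⟨i, hi, his⟩ := List.getElem_of_mem hsP
      rw [Finset.length_toList] at hi
      refine ⟨i, lt_of_lt_of_le hi hb, ?_⟩
      rw [hd i (lt_of_lt_of_le hi hb), List.getD_eq_getElem _ _ (by simpa using hi), his]
  have hfin : final k h F₀ g = run (sel (thr (base k h)) (4 * h) k) F₀ b (numCodes k h) :=
    run_congr _ _ hbits
  have hF : final k h F₀ g ⊆ _ := fam_subset hg h0 g (numCodes k h)
  have hcard := card_minF_final_le hg h0 g
  have hh : Hits (trueLits h α β) (minF (final k h F₀ g)) := by
    rw [hfin]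
    exact (hrun _).mono (minF_subset _)
  obtain ⟨s, hs, heq⟩ := Protocol.complete (q := prm h) (T := blocks k h) hg.deg_pos
    (rank_injOn (final k h F₀ g))
    (fun κ hκ => (rank_lt hF hκ).trans_le (hcard.trans hg.clauses_le))
    ((sum_miss_eq_zero (α := α) (β := β) hF).2 hh)
  refine ⟨g, hg', s, hs, ?_⟩
  rw [acc, SignVec.numAcc, Finset.filter_true_of_mem fun x _ => heq x, Finset.card_range]

/-! #### Formulas -/

/-- The literals of a clause. -/
def clauseLits {k n : ℕ} (C : KClause k n) : Finset ℕ :=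
  Finset.univ.image fun j => 2 * ((C j).1 : ℕ) + (C j).2.toNat

/-- The clauses of a formula. -/
def formulaSets {k n : ℕ} (φ : KCNF k n) : Finset (Finset ℕ) :=
  (φ.clauses.map clauseLits).toFinset

theorem formulaSets_subset {n : ℕ} (hk : 0 < k) (hn : n ≤ 2 * h) (φ : KCNF k n) :
    formulaSets φ ⊆ sets (4 * h) k := by
  intro e he
  simp only [formulaSets, List.mem_toFinset, List.mem_map] at he
  obtain ⟨C, _, rfl⟩ := he
  refine mem_sets.2 ⟨fun v hv => ?_, ?_, ?_⟩
  · simp only [clauseLits, Finset.mem_image, Finset.mem_univ, true_and] at hv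
    obtain ⟨j, rfl⟩ := hv
    have h1 := (C j).1.2
    have h2 := (C j).2.toNat_lt
    rw [Finset.mem_range]
    omega
  · exact ⟨_, Finset.mem_image_of_mem _ (Finset.mem_univ (⟨0, hk⟩ : Fin k))⟩
  · exact Finset.card_image_le.trans (by simp)

theorem hits_formulaSets {n : ℕ} (φ : KCNF k n) (X : Set ℕ) : Hits X (formulaSets φ) ↔
    ∀ C ∈ φ.clauses, ∃ j : Fin k, 2 * ((C j).1 : ℕ) + (C j).2.toNat ∈ X := by
  simp [Hits, formulaSets, clauseLits]

theorem satisfiable_iff {n : ℕ} (hn : n ≤ 2 * h) (φ : KCNF k n) : φ.Satisfiable ↔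
    ∃ α < 2 ^ h, ∃ β < 2 ^ h, Hits (trueLits h α β) (formulaSets φ) := by
  have e1 : ∀ (x : ℕ) (b : Bool), (2 * x + b.toNat) / 2 = x := fun x b => by
    have := b.toNat_lt
    omega
  have e2 : ∀ (x : ℕ) (b : Bool), (2 * x + b.toNat) % 2 = b.toNat := fun x b => by
    have := b.toNat_lt
    omega
  simp only [hits_formulaSets, trueLits, Set.mem_ofPred_eq, e1, e2]
  constructor
  · rintro ⟨x, hx⟩
    obtain ⟨α, hα, hdα⟩ := exists_digits 2 h
      (fun i => if hi : i < n then (x ⟨i, hi⟩).toNat else 0) fun i _ => by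
        split_ifs
        · exact Bool.toNat_lt _
        · omega
    obtain ⟨β, hβ, hdβ⟩ := exists_digits 2 h
      (fun i => if hi : i + h < n then (x ⟨i + h, hi⟩).toNat else 0) fun i _ => by
        split_ifs
        · exact Bool.toNat_lt _
        · omega
    refine ⟨α, hα, β, hβ, fun C hC => ?_⟩
    obtain ⟨j, hj⟩ := hx C hC
    refine ⟨j, ?_⟩
    have hn' := (C j).1.2
    by_cases hlt : ((C j).1 : ℕ) < h
    · left
      refine ⟨hlt, ?_⟩
      rw [hdα _ hlt, dif_pos hn', ← hj]
    · right
      refine ⟨by omega, ?_⟩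
      rw [hdβ _ (by omega), dif_pos (by omega), ← hj]
      congr 2
      ext
      simp only
      omega
  · rintro ⟨α, _, β, _, H⟩
    refine ⟨fun i => if (i : ℕ) < h then decide (α / 2 ^ (i : ℕ) % 2 = 1)
      else decide (β / 2 ^ ((i : ℕ) - h) % 2 = 1), fun C hC => ?_⟩
    obtain ⟨j, hj⟩ := H C hC
    refine ⟨j, ?_⟩
    rcases hj with ⟨h1, h2⟩ | ⟨h1, h2⟩
    · beta_reduce
      rw [if_pos h1, h2]
      cases (C j).2 <;> rfl
    · beta_reduce
      rw [if_neg (by omega), h2]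
      cases (C j).2 <;> rfl

theorem le_maxAbsIP {N d : ℕ} (A B : Fin N → Fin d → ℤˣ) (i j : Fin N) :
    (signedIP (A i) (B j)).natAbs ≤ maxAbsIP A B :=
  Finset.le_sup (f := fun p : Fin N × Fin N => (signedIP (A p.1) (B p.2)).natAbs)
    (Finset.mem_univ (i, j))

theorem exists_le_maxAbsIP {n : ℕ} (hg : Good k h) (hk : 0 < k) (hn : n ≤ 2 * h) {φ : KCNF k n}
    (hφ : φ.Satisfiable) : ∃ g < numGuess k h, ∃ s < numProof h, (4 * prm h) ^ reps h ≤
      maxAbsIP (vecA k h (final k h (formulaSets φ) g))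
        (vecB k h (final k h (formulaSets φ) g) s) := by
  obtain ⟨α, hα, β, hβ, hX⟩ := (satisfiable_iff hn φ).1 hφ
  obtain ⟨g, hg', s, hs, heq⟩ := exists_acc_eq hg (formulaSets_subset hk hn φ) hX
  refine ⟨g, hg', s, hs, ?_⟩
  refine le_trans (le_of_eq ?_) (le_maxAbsIP _ _ ⟨α, hα⟩ ⟨β, hβ⟩)
  rw [hg.signedIP_eq, Int.natAbs_natCast, heq]

/-- At most `2 * deg h` points are accepted for each pair, and each counts 4 times. This holds for
every guess and every polynomial of Merlin. -/
theorem maxAbsIP_le {n : ℕ} (hg : Good k h) (hk : 0 < k) (hn : n ≤ 2 * h) {φ : KCNF k n}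
    (hφ : ¬φ.Satisfiable) (g s : ℕ) :
    maxAbsIP (vecA k h (final k h (formulaSets φ) g))
      (vecB k h (final k h (formulaSets φ) g) s) ≤ (8 * deg h) ^ reps h := by
  refine Finset.sup_le fun p _ => ?_
  rw [hg.signedIP_eq, Int.natAbs_natCast]
  refine Nat.pow_le_pow_left ?_ _
  have := acc_le hg (formulaSets_subset hk hn φ) (α := p.1) (β := p.2)
    (fun hX => hφ ((satisfiable_iff hn φ).2 ⟨_, p.1.2, _, p.2.2, hX⟩)) g s
  omega

end Red

/-! ### Asymptotics of the parameters -/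

namespace Red

theorem tendsto_len : Tendsto len atTop atTop :=
  tendsto_atTop_atTop.2 fun b => ⟨2 ^ b, fun a ha => Nat.le_log_of_pow_le (by norm_num) ha⟩

theorem tendsto_sqrt_len : Tendsto (fun h => (len h).sqrt) atTop atTop :=
  (tendsto_atTop_atTop.2 fun b => ⟨b * b, fun _ ha => Nat.le_sqrt.2 ha⟩).comp tendsto_len

theorem eventually_pow_le_two_pow (A : ℕ) : ∀ᶠ r : ℕ in atTop, r ^ A ≤ 2 ^ r := by
  have h := tendsto_pow_const_div_const_pow_of_one_lt A (r := (2 : ℝ)) (by norm_num)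
  filter_upwards [h.eventually_le_const (u := 1) (by norm_num)] with r hr
  rw [div_le_one (by positivity)] at hr
  exact_mod_cast hr

theorem two_pow_len_le {h : ℕ} (hh : h ≠ 0) : 2 ^ len h ≤ h := Nat.pow_log_le_self 2 hh

theorem lt_two_pow_len (h : ℕ) : h < 2 ^ (len h + 1) := Nat.lt_pow_succ_log_self (by norm_num) h

theorem prm_le {h : ℕ} (hh : 0 < h) : prm h ≤ 2 ^ (2 * len h + 3) := by
  have h1 := lt_two_pow_len h
  calc prm h ≤ 2 * h ^ 2 := (prm_spec hh).2.2
    _ ≤ 2 * (2 ^ (len h + 1)) ^ 2 := by gcongr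
    _ = _ := by ring

/-- Holding for every `M`, this says `numProof h = 2 ^ o(h)`: there are `O(h / len h ^ 2)`
coefficients with `O(len h)` bits each. -/
theorem numProof_pow_le (M : ℕ) : ∀ᶠ h in atTop, numProof h ^ M ≤ 2 ^ h := by
  filter_upwards [eventually_gt_atTop 0, tendsto_len.eventually_ge_atTop (15 * M),
    tendsto_len.eventually_ge_atTop 1, tendsto_len.eventually (eventually_pow_le_two_pow 2)]
    with h h0 h1 h2 h3
  have hl := h3.trans (two_pow_len_le h0.ne')
  have hd : 0 < deg h := Nat.div_pos hl (by positivity)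
  have hd2 : deg h * len h ^ 2 ≤ h := Nat.div_mul_le_self _ _
  have e1 : (2 * len h + 3) * (2 * deg h + 1) * M ≤ h := by
    calc (2 * len h + 3) * (2 * deg h + 1) * M ≤ (5 * len h) * (3 * deg h) * M := by
          gcongr <;> omega
      _ = deg h * (15 * M * len h) := by ring
      _ ≤ deg h * (len h * len h) := by gcongr
      _ ≤ h := by rwa [← sq]
  calc numProof h ^ M = prm h ^ ((2 * deg h + 1) * M) := by rw [numProof, pow_mul]
    _ ≤ (2 ^ (2 * len h + 3)) ^ ((2 * deg h + 1) * M) := Nat.pow_le_pow_left (prm_le h0) _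
    _ = 2 ^ ((2 * len h + 3) * (2 * deg h + 1) * M) := by rw [← pow_mul, mul_assoc]
    _ ≤ _ := Nat.pow_le_pow_right (by norm_num) e1

/-- A guess consists of `O(h / len h ^ 2)` step numbers, each with `O(len h)` bits. -/
theorem numGuess_pow_le (k M : ℕ) : ∀ᶠ h in atTop, numGuess k h ^ M ≤ 2 ^ h := by
  filter_upwards [tendsto_len.eventually_ge_atTop (20 * M * (k + 1) * k),
    tendsto_len.eventually_ge_atTop 1] with h h1 h2
  have hd2 : 4 * h / len h ^ 2 * len h ^ 2 ≤ 4 * h := Nat.div_mul_le_self _ _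
  have hc : numCodes k h + 1 ≤ 2 ^ ((len h + 3) * k + 1) := by
    have h3 := lt_two_pow_len h
    calc numCodes k h + 1 ≤ (2 ^ (len h + 3)) ^ k + (2 ^ (len h + 3)) ^ k := by
          refine Nat.add_le_add (Nat.pow_le_pow_left ?_ _) (Nat.one_le_pow _ _ (by positivity))
          have : 2 ^ (len h + 3) = 4 * 2 ^ (len h + 1) := by ring
          omega
      _ = _ := by rw [← pow_mul]; ring
  have e1 : ((len h + 3) * k + 1) * (maxPetal k h * M) ≤ h := by
    have : 4 * (((len h + 3) * k + 1) * (maxPetal k h * M)) ≤ 4 * h := by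
      calc 4 * (((len h + 3) * k + 1) * (maxPetal k h * M)) ≤
            4 * (5 * (k + 1) * len h * (maxPetal k h * M)) := by
            gcongr
            nlinarith
        _ = 4 * h / len h ^ 2 * (20 * M * (k + 1) * k * len h) := by unfold maxPetal; ring
        _ ≤ 4 * h / len h ^ 2 * (len h * len h) := by gcongr
        _ ≤ _ := by rwa [← sq]
    omega
  calc numGuess k h ^ M = (numCodes k h + 1) ^ (maxPetal k h * M) := by rw [numGuess, pow_mul]
    _ ≤ (2 ^ ((len h + 3) * k + 1)) ^ (maxPetal k h * M) := Nat.pow_le_pow_left hc _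
    _ = 2 ^ (((len h + 3) * k + 1) * (maxPetal k h * M)) := by rw [← pow_mul]
    _ ≤ _ := Nat.pow_le_pow_right (by norm_num) e1

theorem dimExp_mul_le (M : ℕ) : ∀ᶠ h in atTop, dimExp h * M ≤ h := by
  filter_upwards [eventually_gt_atTop 0, tendsto_sqrt_len.eventually_ge_atTop M] with h h0 h1
  calc dimExp h * M ≤ 2 ^ (len h - (len h).sqrt) * 2 ^ (len h).sqrt := by
        refine Nat.mul_le_mul le_rfl (h1.trans Nat.lt_two_pow_self.le)
    _ = 2 ^ len h := by rw [← pow_add, Nat.sub_add_cancel (Nat.sqrt_le_self _)]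
    _ ≤ h := two_pow_len_le h0.ne'

theorem dim_pow_le (M : ℕ) : ∀ᶠ h in atTop, dim h ^ M ≤ 2 ^ h := by
  filter_upwards [dimExp_mul_le M] with h hh
  rw [dim, ← pow_mul]
  exact Nat.pow_le_pow_right (by norm_num) hh

theorem two_mul_sqrt_le {l : ℕ} (hl : 4 ≤ l) : 2 * l.sqrt ≤ l := by
  have h1 : 2 ≤ l.sqrt := Nat.le_sqrt.2 (by omega)
  have h2 := Nat.sqrt_le l
  nlinarith

/-- A polynomial in `len h` against `2 ^ √(len h)`. This makes room for the logarithm of the number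
of coordinates before the tensor power. -/
theorem eventually_le_two_pow_sqrt (A : ℕ) :
    ∀ᶠ h in atTop, (2 * len h + 3) * (len h ^ A + 1) + 3 ≤ 2 ^ (len h).sqrt := by
  filter_upwards [tendsto_sqrt_len.eventually (eventually_pow_le_two_pow (4 * (A + 2))),
    tendsto_sqrt_len.eventually_ge_atTop 4, tendsto_len.eventually_ge_atTop 13] with h h1 h2 h3
  set l := len h
  have e2 : l ≤ l.sqrt ^ 4 := by
    have := Nat.lt_succ_sqrt l
    have h4 : l.sqrt + 1 ≤ l.sqrt ^ 2 := by nlinarith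
    have h5 : (l.sqrt + 1) * (l.sqrt + 1) ≤ l.sqrt ^ 2 * l.sqrt ^ 2 := Nat.mul_le_mul h4 h4
    have h6 : l.sqrt ^ 4 = l.sqrt ^ 2 * l.sqrt ^ 2 := by ring
    rw [Nat.succ_eq_add_one] at this
    omega
  have hp : 1 ≤ l ^ A := Nat.one_le_pow _ _ (by omega)
  calc (2 * l + 3) * (l ^ A + 1) + 3 ≤ (3 * l) * (2 * l ^ A) + 3 * (l * l ^ A) := by
        have : (2 * l + 3) * (l ^ A + 1) ≤ (3 * l) * (2 * l ^ A) :=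
          Nat.mul_le_mul (by omega) (by omega)
        have : 1 * 1 ≤ l * l ^ A := Nat.mul_le_mul (by omega) hp
        omega
    _ = 9 * (l * l ^ A) := by ring
    _ ≤ l * (l * l ^ A) := by gcongr; omega
    _ = l ^ (A + 2) := by ring
    _ ≤ (l.sqrt ^ 4) ^ (A + 2) := Nat.pow_le_pow_left e2 _
    _ = l.sqrt ^ (4 * (A + 2)) := by rw [← pow_mul]
    _ ≤ _ := h1

theorem eventually_good (k : ℕ) : ∀ᶠ h in atTop, Good k h := by
  filter_upwards [eventually_ge_atTop 4, numProof_pow_le 1, numGuess_pow_le k 1, dimExp_mul_le 1,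
    tendsto_len.eventually_ge_atTop 4, tendsto_len.eventually (eventually_pow_le_two_pow 2),
    tendsto_len.eventually_ge_atTop (8 * (k * 3 ^ (k * 2 ^ k))),
    tendsto_len.eventually (eventually_pow_le_two_pow (2 ^ (k + 1) + 1)),
    eventually_le_two_pow_sqrt (2 ^ (k + 1) + 3)]
    with h h4 hp hg hd hl hl2 hlk hlp hs
  have hlh := two_pow_len_le (h := h) (by omega)
  have hdeg : 0 < deg h := Nat.div_pos (hl2.trans hlh) (by positivity)
  have hthr : Sparsify.thr (base k h) k = 3 ^ (k * 2 ^ k) * len h ^ (2 ^ (k + 1)) := by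
    unfold Sparsify.thr base
    rw [mul_pow, ← pow_mul, ← pow_mul, pow_succ 2 k, mul_comm 2]
  have hdh : h ≤ 2 * (deg h * len h ^ 2) := by
    have h1 := Nat.lt_div_mul_add (a := h) (b := len h ^ 2) (by positivity)
    have h2 : 1 * len h ^ 2 ≤ deg h * len h ^ 2 := Nat.mul_le_mul hdeg le_rfl
    unfold deg at *
    omega
  have hr := two_mul_sqrt_le hl
  have hr2 : 2 ≤ (len h).sqrt := Nat.le_sqrt.2 (by omega)
  refine ⟨by omega, hdeg, ?_, ?_, ?_, ?_, by simpa using hp, by simpa using hg, by simpa using hd,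
    ?_⟩
  · rw [hthr]
    calc 4 * h * (k * (3 ^ (k * 2 ^ k) * len h ^ (2 ^ (k + 1)))) ≤
        4 * (2 * (deg h * len h ^ 2)) * (k * (3 ^ (k * 2 ^ k) * len h ^ (2 ^ (k + 1)))) := by
          gcongr
      _ = 8 * (k * 3 ^ (k * 2 ^ k)) * (deg h * len h ^ 2 * len h ^ (2 ^ (k + 1))) := by ring
      _ ≤ len h * (deg h * len h ^ 2 * len h ^ (2 ^ (k + 1))) := by gcongr
      _ = _ := by unfold blocks; ring
  · rw [hthr]
    calc 4 * h * (k * (3 ^ (k * 2 ^ k) * len h ^ (2 ^ (k + 1)))) =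
        h * (4 * (k * 3 ^ (k * 2 ^ k)) * len h ^ (2 ^ (k + 1))) := by ring
      _ ≤ h * (len h * len h ^ (2 ^ (k + 1))) := by gcongr; omega
      _ = h * len h ^ (2 ^ (k + 1) + 1) := by ring
      _ ≤ h * h := by gcongr; exact hlp.trans hlh
      _ = _ := by ring
  · have : deg h ≤ h := Nat.div_le_self _ _
    nlinarith
  -- The 1 subtracted in the exponent becomes `reps h` after the tensor power. So the tensor part
  -- takes at most half of the dimension, and the padding fits into the other half.
  · have e1 : 4 * prm h ^ (blocks k h + 1) ≤ 2 ^ (2 ^ (len h).sqrt - 1) := by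
      calc 4 * prm h ^ (blocks k h + 1) ≤ 2 ^ 2 * (2 ^ (2 * len h + 3)) ^ (blocks k h + 1) := by
            gcongr
            · norm_num
            · exact prm_le (by omega)
        _ = 2 ^ (2 + (2 * len h + 3) * (blocks k h + 1)) := by rw [← pow_mul, ← pow_add]
        _ ≤ _ := Nat.pow_le_pow_right (by norm_num) (by unfold blocks; omega)
    have e2 : 2 ^ (len h).sqrt * reps h = dimExp h := by
      rw [reps, dimExp, ← pow_add]
      congr 1
      omega
    have hrep : 1 ≤ reps h := Nat.one_le_two_pow
    have e3 : (4 * prm h ^ (blocks k h + 1)) ^ reps h ≤ 2 ^ (dimExp h - 1) := by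
      refine (Nat.pow_le_pow_left e1 _).trans ?_
      rw [← pow_mul, ← e2, Nat.sub_mul]
      exact Nat.pow_le_pow_right (by norm_num) (by omega)
    have e4 : 2 ^ (len h).sqrt ≤ dimExp h := Nat.pow_le_pow_right (by norm_num) (by omega)
    have e5 : len h + 4 ≤ 2 ^ (len h).sqrt := by
      refine le_trans ?_ hs
      have : (2 * len h + 3) * 1 ≤ (2 * len h + 3) * (len h ^ (2 ^ (k + 1) + 3) + 1) :=
        Nat.mul_le_mul le_rfl (by omega)
      omega
    have e6 : 4 * h ≤ 2 ^ (dimExp h - 1) := by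
      have h7 := lt_two_pow_len h
      calc 4 * h ≤ 2 ^ 2 * 2 ^ (len h + 1) := by omega
        _ = 2 ^ (2 + (len h + 1)) := by rw [← pow_add]
        _ ≤ _ := Nat.pow_le_pow_right (by norm_num) (by omega)
    have e7 : dim h = 2 ^ (dimExp h - 1) + 2 ^ (dimExp h - 1) := by
      rw [dim, ← two_mul, ← pow_succ']
      congr 1
      omega
    omega
  · exact (pow_one 2).symm.trans_le (Nat.pow_le_pow_right (by norm_num) (by omega))

/-- The exponent of the dimension. -/
noncomputable def dimRate (N : ℕ) : ℝ := Real.logb N (dim (Nat.log 2 N))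

/-- The defect in the exponent of the logarithm of the gap. -/
noncomputable def gapRate (N : ℕ) : ℝ :=
  1 - Real.logb (Nat.log 2 N : ℕ) (reps (Nat.log 2 N))

theorem tendsto_log_two : Tendsto (Nat.log 2) atTop atTop := tendsto_len

theorem rpow_dimRate {N : ℕ} (hN : 2 ≤ N) : (dim (Nat.log 2 N) : ℝ) = (N : ℝ) ^ dimRate N := by
  rw [dimRate, Real.rpow_logb]
  · positivity
  · have : (2 : ℝ) ≤ N := by exact_mod_cast hN
    linarith
  · unfold dim; positivity

theorem tendsto_of_forall_mul_le {u : ℕ → ℝ} (h0 : ∀ᶠ N in atTop, 0 ≤ u N)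
    (h : ∀ M : ℕ, ∀ᶠ N in atTop, u N * M ≤ 1) : Tendsto u atTop (𝓝 0) := by
  rw [tendsto_order]
  refine ⟨fun a ha => ?_, fun a ha => ?_⟩
  · filter_upwards [h0] with N hN using ha.trans_le hN
  · obtain ⟨M, hM⟩ := exists_nat_gt (1 / a)
    filter_upwards [h M] with N hN
    rw [div_lt_iff₀ ha] at hM
    have hM0 : (0 : ℝ) < M := by
      rcases Nat.eq_zero_or_pos M with rfl | hM'
      · simp at hM
        linarith
      · exact_mod_cast hM'
    by_contra! hcon
    nlinarith

theorem tendsto_dimRate : Tendsto dimRate atTop (𝓝 0) := by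
  refine tendsto_of_forall_mul_le ?_ fun M => ?_
  · filter_upwards [eventually_ge_atTop 2] with N hN
    refine Real.logb_nonneg (by exact_mod_cast hN) ?_
    exact_mod_cast Nat.one_le_two_pow
  · filter_upwards [eventually_ge_atTop 2, tendsto_log_two.eventually (dimExp_mul_le M)]
      with N hN hM
    have hN' : (1 : ℝ) < N := by exact_mod_cast hN
    rw [dimRate, mul_comm, ← Real.logb_pow, Real.logb_le_iff_le_rpow hN' (by unfold dim; positivity),
      Real.rpow_one]
    norm_cast
    calc dim (Nat.log 2 N) ^ M ≤ 2 ^ Nat.log 2 N := by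
          rw [dim, ← pow_mul]
          exact Nat.pow_le_pow_right (by norm_num) hM
      _ ≤ N := Nat.pow_log_le_self 2 (by omega)

/-- Since `h` is at most `reps h * 2 ^ (2 * √(len h) + 1)` and the second factor is `h ^ o(1)`, the
logarithm of `reps h` to base `h` tends to 1. -/
theorem tendsto_gapRate : Tendsto gapRate atTop (𝓝 0) := by
  refine Tendsto.comp (g := fun h : ℕ => 1 - Real.logb h (reps h)) ?_ tendsto_log_two
  refine tendsto_of_forall_mul_le ?_ fun M => ?_
  · filter_upwards [eventually_ge_atTop 2] with h hh
    have h1 : (1 : ℝ) < h := by exact_mod_cast hh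
    rw [sub_nonneg, Real.logb_le_iff_le_rpow h1 (by unfold reps; positivity), Real.rpow_one]
    have : reps h ≤ h := (Nat.pow_le_pow_right (by norm_num) (Nat.sub_le _ _)).trans
      (two_pow_len_le (by omega))
    exact_mod_cast this
  · filter_upwards [eventually_ge_atTop 2, tendsto_len.eventually_ge_atTop 4,
      tendsto_sqrt_len.eventually_ge_atTop (3 * M)] with h hh hl hM
    have h1 : (1 : ℝ) < h := by exact_mod_cast hh
    have h0 : (0 : ℝ) < h := by linarith
    have hr := two_mul_sqrt_le hl
    have hr2 : 2 ≤ (len h).sqrt := Nat.le_sqrt.2 (by omega)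
    have key : h ^ M ≤ reps h ^ M * h := by
      have h2 := lt_two_pow_len h
      calc h ^ M ≤ (2 ^ (len h + 1)) ^ M := Nat.pow_le_pow_left h2.le _
        _ = (2 ^ (len h - 2 * (len h).sqrt)) ^ M * 2 ^ ((2 * (len h).sqrt + 1) * M) := by
          rw [← pow_mul, ← pow_mul, ← pow_add, ← add_mul]
          congr 2
          omega
        _ ≤ reps h ^ M * 2 ^ len h := by
          refine Nat.mul_le_mul le_rfl (Nat.pow_le_pow_right (by norm_num) ?_)
          calc (2 * (len h).sqrt + 1) * M ≤ 3 * (len h).sqrt * M := by gcongr; omega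
            _ = (len h).sqrt * (3 * M) := by ring
            _ ≤ (len h).sqrt * (len h).sqrt := by gcongr
            _ ≤ _ := Nat.sqrt_le _
        _ ≤ _ := Nat.mul_le_mul le_rfl (two_pow_len_le (by omega))
    have hrep : (0 : ℝ) < reps h := by unfold reps; positivity
    have : (M : ℝ) ≤ M * Real.logb h (reps h) + 1 := by
      have h3 : (h : ℝ) ^ M ≤ (reps h : ℝ) ^ M * h := by exact_mod_cast key
      have h4 := Real.logb_le_logb_of_le h1 (by positivity) h3
      rw [Real.logb_mul (by positivity) h0.ne', Real.logb_pow, Real.logb_pow,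
        Real.logb_self_eq_one h1] at h4
      linarith
    linarith

/-- The gap, if the number of vectors is a power of `2`. -/
theorem rpow_gapRate {h : ℕ} (hh : 2 ≤ h) :
    (2 : ℝ) ^ (Real.logb 2 ((2 ^ h : ℕ) : ℝ) ^ (1 - gapRate (2 ^ h))) = 2 ^ reps h := by
  have h1 : (2 : ℝ) ≤ h := by exact_mod_cast hh
  rw [gapRate, Nat.log_pow (by norm_num), sub_sub_cancel, Nat.cast_pow, Real.logb_pow, Nat.cast_two,
    Real.logb_self_eq_one (by norm_num), mul_one, Real.rpow_logb (by linarith) (by linarith),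
    Real.rpow_natCast]
  unfold reps; positivity

end Red

/-! ### Computation of the parameters -/

namespace Red

open WordRAM WordRAM.Fam

theorem firstIdx_eq {P : ℕ → Prop} {X i : ℕ} (hi : i < X) (hP : P i) (h : ∀ j < i, ¬P j) :
    firstIdx P X = i := by
  obtain ⟨_, h2, h3⟩ := firstIdx_spec hi hP
  rcases lt_trichotomy (firstIdx P X) i with h4 | h4 | h4
  · exact absurd h2 (h _ h4)
  · exact h4
  · exact absurd hP (h3 _ h4)

/-- As a bounded search, the logarithm falls under `Comp.firstIdx`; the square root is treated in
the same way. -/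
theorem len_eq_firstIdx (h : ℕ) : len h = firstIdx (fun i => h < 2 ^ (i + 1)) (h + 1) := by
  refine (firstIdx_eq (P := fun i => h < 2 ^ (i + 1)) ?_ (lt_two_pow_len h) fun j hj => ?_).symm
  · exact (Nat.log_le_self 2 h).trans_lt (Nat.lt_succ_self h)
  · rw [not_lt]
    rcases Nat.eq_zero_or_pos h with rfl | hh
    · simp [len] at hj
    · exact (Nat.pow_le_pow_right (by norm_num) hj).trans (two_pow_len_le hh.ne')

theorem sqrt_eq_firstIdx (l : ℕ) :
    l.sqrt = firstIdx (fun i => l < (i + 1) * (i + 1)) (l + 1) := by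
  refine (firstIdx_eq (Nat.lt_succ_of_le (Nat.sqrt_le_self l)) (Nat.lt_succ_sqrt l)
    fun j hj => ?_).symm
  rw [not_lt]
  exact (Nat.mul_le_mul hj hj).trans (Nat.sqrt_le l)

/-- Situations with a large number `h` that is given. -/
structure Par (Γ : Fam) (k : ℕ) (h : Γ.Idx → ℕ) : Prop where
  pos : 0 < k
  comp : Γ.Comp h
  le : ∀ a, h a ≤ Γ.size a + 1
  good : ∀ a, Good k (h a)

theorem Good.pow_le_dim {k h : ℕ} (hg : Good k h) :
    (4 * prm h ^ (blocks k h + 1)) ^ reps h ≤ dim h :=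
  (Nat.le_add_right _ _).trans hg.dim_le

theorem Good.prm_pos {k h : ℕ} (hg : Good k h) : 0 < prm h := (prm_spec hg.pos).2.1.pos

theorem Good.four_deg_le {k h : ℕ} (hg : Good k h) : 4 * deg h ≤ prm h :=
  hg.deg_le.trans (prm_spec hg.pos).1.le

theorem Good.prm_pow_le_dim {k h : ℕ} (hg : Good k h) : prm h ^ (blocks k h + 1) ≤ dim h := by
  refine le_trans ?_ hg.pow_le_dim
  calc prm h ^ (blocks k h + 1) ≤ 4 * prm h ^ (blocks k h + 1) := by omega
    _ ≤ _ := Nat.le_self_pow (by unfold reps; positivity) _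

theorem Good.dim_le_two_pow {k h : ℕ} (hg : Good k h) : dim h ≤ 2 ^ h :=
  Nat.pow_le_pow_right (by norm_num) hg.dimExp_le

theorem Good.gap_le {k h : ℕ} (hg : Good k h) : (8 * deg h) ^ reps h ≤ 2 ^ h := by
  refine le_trans ?_ (hg.pow_le_dim.trans hg.dim_le_two_pow)
  refine Nat.pow_le_pow_left ?_ _
  have h1 := hg.four_deg_le
  have h2 : prm h ≤ prm h ^ (blocks k h + 1) := Nat.le_self_pow (by omega) _
  omega

variable {Γ : Fam} {k : ℕ} {h : Γ.Idx → ℕ}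

theorem Par.lift (E : Par Γ k h) (b : Γ.Idx → ℕ) : Par (Γ.loop b) k fun p => h p.1.1 :=
  ⟨E.pos, E.comp.lift b, fun p => E.le p.1.1, fun p => E.good p.1.1⟩

namespace Par

theorem poly (E : Par Γ k h) : Γ.PolyB h := (PolyB.size.add (PolyB.const 1)).le E.le

theorem expB_two_pow (E : Par Γ k h) : Γ.ExpB fun a => 2 ^ h a :=
  ExpB.two_pow (C := 1) fun a => (E.le a).trans (by omega)

theorem expB (E : Par Γ k h) {f : Γ.Idx → ℕ} (hf : ∀ a, f a ≤ 2 ^ h a) : Γ.ExpB f :=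
  E.expB_two_pow.le hf

theorem comp_two_pow (E : Par Γ k h) : Γ.Comp fun a => 2 ^ h a :=
  Comp.pow (Comp.const 2) E.comp E.poly E.expB_two_pow

theorem len_le (h : ℕ) : len h ≤ h := Nat.log_le_self 2 h

theorem comp_len (E : Par Γ k h) : Γ.Comp fun a => len (h a) := by
  simp only [len_eq_firstIdx]
  refine Comp.firstIdx (E.comp.add (Comp.const 1)) (E.poly.add (PolyB.const 1)) ?_
  have hv : (Γ.loop fun a => h a + 1).Comp fun p => p.1.2 :=
    Comp.loop_var (E.comp.add (Comp.const 1)).expB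
  have E' := E.lift fun a => h a + 1
  refine CompP.lt E'.comp (Comp.pow (Comp.const 2) (hv.add (Comp.const 1)) ?_ ?_)
  · exact ((E'.poly.add (PolyB.const 2))).le fun p => by have := p.2; dsimp only at *; omega
  · exact ExpB.two_pow (C := 2) fun p => by
      have := p.2
      have := E.le p.1.1
      dsimp only at *
      omega

theorem poly_len (E : Par Γ k h) : Γ.PolyB fun a => len (h a) := E.poly.le fun _ => len_le _

theorem comp_sqrt (E : Par Γ k h) : Γ.Comp fun a => (len (h a)).sqrt := by
  simp only [sqrt_eq_firstIdx]
  have hb := E.comp_len.add (Comp.const 1)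
  refine Comp.firstIdx hb (E.poly_len.add (PolyB.const 1)) ?_
  have hv := (Comp.loop_var hb.expB).add (Comp.const 1)
  exact CompP.lt (E.lift _).comp_len (hv.mul hv)

theorem two_pow_le (E : Par Γ k h) {f : Γ.Idx → ℕ} (hf : ∀ a, f a ≤ len (h a)) (a : Γ.Idx) :
    2 ^ f a ≤ h a :=
  (Nat.pow_le_pow_right (by norm_num) (hf a)).trans (two_pow_len_le (E.good a).pos.ne')

theorem comp_two_pow_of_le (E : Par Γ k h) {f : Γ.Idx → ℕ} (hc : Γ.Comp f)
    (hf : ∀ a, f a ≤ len (h a)) : Γ.Comp fun a => 2 ^ f a :=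
  Comp.pow (Comp.const 2) hc (E.poly_len.le hf) (E.poly.le (E.two_pow_le hf)).expB

theorem comp_dimExp (E : Par Γ k h) : Γ.Comp fun a => dimExp (h a) :=
  E.comp_two_pow_of_le (E.comp_len.sub E.comp_sqrt) fun _ => Nat.sub_le _ _

theorem comp_dim (E : Par Γ k h) : Γ.Comp fun a => dim (h a) :=
  Comp.pow (Comp.const 2) E.comp_dimExp (E.poly.le fun a => (E.good a).dimExp_le)
    (E.expB fun a => (E.good a).dim_le_two_pow)

theorem comp_reps (E : Par Γ k h) : Γ.Comp fun a => reps (h a) :=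
  E.comp_two_pow_of_le (E.comp_len.sub ((Comp.const 2).mul E.comp_sqrt)) fun _ => Nat.sub_le _ _

theorem poly_reps (E : Par Γ k h) : Γ.PolyB fun a => reps (h a) :=
  E.poly.le (E.two_pow_le fun _ => Nat.sub_le _ _)

theorem comp_numCodes (E : Par Γ k h) : Γ.Comp fun a => numCodes k (h a) :=
  ((Comp.const 4).mul E.comp).pow_const k

theorem poly_numCodes (E : Par Γ k h) : Γ.PolyB fun a => numCodes k (h a) :=
  ((PolyB.const 4).mul E.poly).pow k

theorem comp_deg (E : Par Γ k h) : Γ.Comp fun a => deg (h a) :=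
  E.comp.div (E.comp_len.pow_const 2)

theorem poly_deg (E : Par Γ k h) : Γ.PolyB fun a => deg (h a) :=
  E.poly.le fun _ => Nat.div_le_self _ _

theorem comp_maxPetal (E : Par Γ k h) : Γ.Comp fun a => maxPetal k (h a) :=
  (Comp.const k).mul (((Comp.const 4).mul E.comp).div (E.comp_len.pow_const 2))

theorem poly_maxPetal (E : Par Γ k h) : Γ.PolyB fun a => maxPetal k (h a) :=
  ((PolyB.const k).mul ((PolyB.const 4).mul E.poly)).le fun _ =>
    Nat.mul_le_mul_left _ (Nat.div_le_self _ _)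

theorem comp_base (E : Par Γ k h) : Γ.Comp fun a => base k (h a) :=
  (Comp.const _).mul (E.comp_len.pow_const 2)

theorem poly_base (E : Par Γ k h) : Γ.PolyB fun a => base k (h a) :=
  (PolyB.const _).mul (E.poly_len.pow 2)

theorem comp_blocks (E : Par Γ k h) : Γ.Comp fun a => blocks k (h a) := E.comp_len.pow_const _

theorem poly_blocks (E : Par Γ k h) : Γ.PolyB fun a => blocks k (h a) := E.poly_len.pow _

theorem comp_thr (E : Par Γ k h) {c : Γ.Idx → ℕ} (hc : Γ.Comp c) (hck : ∀ a, c a ≤ k) :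
    Γ.Comp fun a => Sparsify.thr (base k (h a)) (c a) := by
  have h2 : ∀ a, 2 ^ c a ≤ 2 ^ k := fun a => Nat.pow_le_pow_right (by norm_num) (hck a)
  refine Comp.pow E.comp_base (Comp.pow (Comp.const 2) hc ((PolyB.const k).le hck)
    ((ExpB.const (2 ^ k)).le h2)) ((PolyB.const (2 ^ k)).le h2)
    ((E.poly_base.pow (2 ^ k)).expB.le fun a => ?_)
  exact Nat.pow_le_pow_right (E.good a).base_pos (h2 a)

/-- Trial division, which is fast enough as the number itself is polynomially bounded. -/
theorem compP_prime {f : Γ.Idx → ℕ} (hf : Γ.Comp f) (hfP : Γ.PolyB f) :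
    Γ.CompP fun a => (f a).Prime := by
  have hv := Comp.loop_var (Γ := Γ) hf.expB
  refine (CompP.and (CompP.le (Comp.const 2) hf) (CompP.ball hf hfP
    (P := fun a m => 2 ≤ m → ¬f a % m = 0) ((CompP.le (Comp.const 2) hv).imp
    (CompP.eq ((hf.lift f).mod hv) (Comp.const 0)).not))).congr fun a => ?_
  rw [Nat.prime_def_lt']
  simp only [Nat.dvd_iff_mod_eq_zero]
  exact and_congr_right fun _ => forall_congr' fun m => ⟨fun H h1 h2 => H h2 h1,
    fun H h1 h2 => H h2 h1⟩

theorem comp_prm (E : Par Γ k h) : Γ.Comp fun a => prm (h a) := by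
  have hb : Γ.Comp fun a => 2 * h a ^ 2 + 1 :=
    ((Comp.const 2).mul (E.comp.pow_const 2)).add (Comp.const 1)
  have hP : Γ.PolyB fun a => 2 * h a ^ 2 + 1 :=
    ((PolyB.const 2).mul (E.poly.pow 2)).add (PolyB.const 1)
  have hv := Comp.loop_var hb.expB
  exact Comp.firstIdx hb hP (CompP.and (CompP.lt ((E.comp.pow_const 2).lift _) hv)
    (compP_prime hv ((hP.lift _).le fun p => p.2.le)))

theorem comp_numGuess (E : Par Γ k h) : Γ.Comp fun a => numGuess k (h a) :=
  Comp.pow (E.comp_numCodes.add (Comp.const 1)) E.comp_maxPetal E.poly_maxPetal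
    (E.expB fun a => (E.good a).numGuess_le)

theorem comp_numProof (E : Par Γ k h) : Γ.Comp fun a => numProof (h a) :=
  Comp.pow E.comp_prm (((Comp.const 2).mul E.comp_deg).add (Comp.const 1))
    (((PolyB.const 2).mul E.poly_deg).add (PolyB.const 1))
    (E.expB fun a => (E.good a).numProof_le)

theorem comp_gap (E : Par Γ k h) : Γ.Comp fun a => (8 * deg (h a)) ^ reps (h a) :=
  Comp.pow ((Comp.const 8).mul E.comp_deg) E.comp_reps E.poly_reps
    (E.expB fun a => (E.good a).gap_le)

/-- These powers fit into words because they are bounded by the dimension, which is at most `2 ^ h`.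
-/
theorem comp_prm_pow (E : Par Γ k h) {f : Γ.Idx → ℕ} (hf : Γ.Comp f)
    (hfb : ∀ a, f a ≤ blocks k (h a) + 1) : Γ.Comp fun a => prm (h a) ^ f a :=
  Comp.pow E.comp_prm hf ((E.poly_blocks.add (PolyB.const 1)).le hfb) (E.expB fun a =>
    (Nat.pow_le_pow_right (E.good a).prm_pos (hfb a)).trans
      ((E.good a).prm_pow_le_dim.trans (E.good a).dim_le_two_pow))

theorem comp_coords (E : Par Γ k h) : Γ.Comp fun a => 4 * prm (h a) ^ (blocks k (h a) + 1) :=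
  (Comp.const 4).mul (E.comp_prm_pow (E.comp_blocks.add (Comp.const 1)) fun _ => le_rfl)

theorem comp_coords_pow (E : Par Γ k h) {f : Γ.Idx → ℕ} (hf : Γ.Comp f)
    (hfb : ∀ a, f a ≤ reps (h a)) :
    Γ.Comp fun a => (4 * prm (h a) ^ (blocks k (h a) + 1)) ^ f a :=
  Comp.pow E.comp_coords hf (E.poly_reps.le hfb) (E.expB fun a => by
    refine (Nat.pow_le_pow_right ?_ (hfb a)).trans
      ((E.good a).pow_le_dim.trans (E.good a).dim_le_two_pow)
    have := Nat.pow_pos (n := blocks k (h a) + 1) (E.good a).prm_pos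
    omega)

/-! #### Codes of sets -/

variable {κ η v : Γ.Idx → ℕ}

theorem comp_digit (E : Par Γ k h) (hκ : Γ.Comp κ) {j : Γ.Idx → ℕ} (hj : Γ.Comp j)
    (hjk : ∀ a, j a < k) : Γ.Comp fun a => digit (4 * h a) (κ a) (j a) :=
  (hκ.div (Comp.pow ((Comp.const 4).mul E.comp) hj ((PolyB.const k).le fun a => (hjk a).le)
    (E.poly_numCodes.expB.le fun a => Nat.pow_le_pow_right (by have := (E.good a).pos; omega)
      (hjk a).le))).mod ((Comp.const 4).mul E.comp)

theorem comp_loop_digit (E : Par Γ k h) (hκ : Γ.Comp κ) :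
    (Γ.loop fun _ => k).Comp fun p => digit (4 * h p.1.1) (κ p.1.1) p.1.2 :=
  (E.lift _).comp_digit (hκ.lift _) (Comp.loop_var (ExpB.const k)) fun p => p.2

theorem compP_mem (E : Par Γ k h) (hκ : Γ.Comp κ) (hv : Γ.Comp v) :
    Γ.CompP fun a => v a ∈ codeSet (4 * h a) k (κ a) := by
  simp only [mem_codeSet]
  exact CompP.bex (Comp.const k) (PolyB.const k) (CompP.eq (E.comp_loop_digit hκ) (hv.lift _))

theorem subset_iff {V k κ η : ℕ} : codeSet V k κ ⊆ codeSet V k η ↔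
    ∀ j < k, digit V κ j ∈ codeSet V k η := by
  refine ⟨fun H j hj => H (mem_codeSet.2 ⟨j, hj, rfl⟩), fun H v hv => ?_⟩
  obtain ⟨j, hj, rfl⟩ := mem_codeSet.1 hv
  exact H j hj

theorem compP_subset (E : Par Γ k h) (hκ : Γ.Comp κ) (hη : Γ.Comp η) :
    Γ.CompP fun a => codeSet (4 * h a) k (κ a) ⊆ codeSet (4 * h a) k (η a) := by
  simp only [subset_iff]
  exact CompP.ball (Comp.const k) (PolyB.const k)
    ((E.lift _).compP_mem (hη.lift _) (E.comp_loop_digit hκ))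

theorem compP_codeSet_eq (E : Par Γ k h) (hκ : Γ.Comp κ) (hη : Γ.Comp η) :
    Γ.CompP fun a => codeSet (4 * h a) k (κ a) = codeSet (4 * h a) k (η a) :=
  ((E.compP_subset hκ hη).and (E.compP_subset hη hκ)).congr fun _ => subset_antisymm_iff

theorem compP_canon (E : Par Γ k h) (hκ : Γ.Comp κ) (hb : ∀ a, κ a < numCodes k (h a)) :
    Γ.CompP fun a => Canon (4 * h a) k (κ a) :=
  CompP.ball hκ (E.poly_numCodes.le fun a => (hb a).le)
    ((E.lift _).compP_codeSet_eq (Comp.loop_var hκ.expB) (hκ.lift _)).not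

/-- Digits may repeat, so only first occurrences are counted. -/
theorem card_codeSet (V k κ : ℕ) : (codeSet V k κ).card =
    ∑ j ∈ Finset.range k, ind (∀ i < j, ¬digit V κ i = digit V κ j) := by
  classical
  have : ∑ j ∈ Finset.range k, ind (∀ i < j, ¬digit V κ i = digit V κ j) =
      ((Finset.range k).filter fun j => ∀ i < j, ¬digit V κ i = digit V κ j).card := by
    rw [Finset.card_filter]
    exact Finset.sum_congr rfl fun j _ => ind_eq_ite
  rw [this]
  symm
  refine Finset.card_bij (fun j _ => digit V κ j) (fun j hj => ?_) (fun i hi j hj he => ?_)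
    fun v hv => ?_
  · exact mem_codeSet.2 ⟨j, Finset.mem_range.1 (Finset.mem_filter.1 hj).1, rfl⟩
  · rcases lt_trichotomy i j with hij | hij | hij
    · exact absurd he ((Finset.mem_filter.1 hj).2 i hij)
    · exact hij
    · exact absurd he.symm ((Finset.mem_filter.1 hi).2 j hij)
  · have hex : ∃ j, j < k ∧ digit V κ j = v := mem_codeSet.1 hv
    refine ⟨Nat.find hex, ?_, (Nat.find_spec hex).2⟩
    rw [Finset.mem_filter, Finset.mem_range]
    refine ⟨(Nat.find_spec hex).1, fun i hi he => Nat.find_min hex hi ⟨?_, ?_⟩⟩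
    · exact hi.trans (Nat.find_spec hex).1
    · rw [he, (Nat.find_spec hex).2]

theorem comp_card (E : Par Γ k h) (hκ : Γ.Comp κ) :
    Γ.Comp fun a => (codeSet (4 * h a) k (κ a)).card := by
  simp only [card_codeSet]
  have hj := Comp.loop_var (Γ := Γ) (ExpB.const k)
  have E' := E.lift fun _ => k
  refine Comp.sum (Comp.const k) (PolyB.const k) (CompP.ball hj
    ((PolyB.const k).le fun p => p.2.le) (CompP.not (CompP.eq ?_ ((E.comp_loop_digit hκ).lift _))))
  exact (E'.lift _).comp_digit ((hκ.lift _).lift _) (Comp.loop_var hj.expB)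
    fun p => p.2.trans p.1.1.2

end Par
end Red

/-! ### Computation of the vectors -/

namespace Red

open Sparsify WordRAM WordRAM.Fam

/-- Situations in which the memory, from the address `x` on, holds a table of the codes of the
members of `F`. -/
structure Table (Γ : Fam) (k : ℕ) (h x : Γ.Idx → ℕ) (F : Γ.Idx → Finset (Finset ℕ)) : Prop
    extends Par Γ k h where
  comp_pos : Γ.Comp x
  subset : ∀ a, F a ⊆ sets (4 * h a) k
  mem : ∀ a, ∀ κ < numCodes k (h a), Γ.mem a (x a + κ) = ind (codeSet (4 * h a) k κ ∈ F a)

variable {Γ : Fam} {k : ℕ} {h x : Γ.Idx → ℕ} {F : Γ.Idx → Finset (Finset ℕ)}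
  {κ η c : Γ.Idx → ℕ}

namespace Table

theorem lift (E : Table Γ k h x F) (b : Γ.Idx → ℕ) :
    Table (Γ.loop b) k (fun p => h p.1.1) (fun p => x p.1.1) fun p => F p.1.1 :=
  { E.toPar.lift b with
    comp_pos := E.comp_pos.lift b
    subset := fun p => E.subset p.1.1
    mem := fun p => E.mem p.1.1 }

theorem comp_code (E : Table Γ k h x F) : (Γ.loop fun a => numCodes k (h a)).Comp fun p => p.1.2 :=
  Comp.loop_var E.comp_numCodes.expB

theorem compP_member (E : Table Γ k h x F) (hκ : Γ.Comp κ) (hb : ∀ a, κ a < numCodes k (h a)) :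
    Γ.CompP fun a => codeSet (4 * h a) k (κ a) ∈ F a := by
  refine (Comp.load (E.comp_pos.add hκ) ?_).congr fun a => (E.mem a _ (hb a)).symm
  exact (ExpB.const 1).le fun a => by rw [E.mem a _ (hb a)]; exact ind_le_one _

theorem forall_mem_iff {V : ℕ} {F : Finset (Finset ℕ)}
    (hF : F ⊆ sets V k) {P : Finset ℕ → Prop} :
    (∀ e ∈ F, P e) ↔ ∀ κ < V ^ k, codeSet V k κ ∈ F → P (codeSet V k κ) := by
  refine ⟨fun H κ _ hκ => H _ hκ, fun H e he => ?_⟩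
  obtain ⟨κ, hκ, rfl⟩ := exists_codeSet (hF he)
  exact H κ hκ he

theorem compP_minF (E : Table Γ k h x F) (hκ : Γ.Comp κ) (hb : ∀ a, κ a < numCodes k (h a)) :
    Γ.CompP fun a => codeSet (4 * h a) k (κ a) ∈ minF (F a) := by
  have hv := E.comp_code
  have E' := E.lift fun a => numCodes k (h a)
  refine ((E.compP_member hκ hb).and (CompP.ball E.comp_numCodes E.poly_numCodes
    (P := fun a κ' => codeSet (4 * h a) k κ' ∈ F a →
      (codeSet (4 * h a) k κ' ⊆ codeSet (4 * h a) k (κ a) →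
        codeSet (4 * h a) k κ' = codeSet (4 * h a) k (κ a)))
    ((E'.compP_member hv fun p => p.2).imp ((E'.compP_subset hv (hκ.lift _)).imp
      (E'.compP_codeSet_eq hv (hκ.lift _)))))).congr fun a => ?_
  rw [mem_minF]
  refine and_congr_right fun _ => ?_
  exact forall_mem_iff (E.subset a)

theorem compP_clause (E : Table Γ k h x F) (hκ : Γ.Comp κ) (hb : ∀ a, κ a < numCodes k (h a)) :
    Γ.CompP fun a => κ a ∈ clauseCodes k (h a) (F a) :=
  ((E.compP_canon hκ hb).and (E.compP_minF hκ hb)).congr fun a => by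
    simp [clauseCodes, hb a]

theorem compP_link (E : Table Γ k h x F) (hκ : Γ.Comp κ) (hb : ∀ a, κ a < numCodes k (h a))
    (hη : Γ.Comp η) (hc : Γ.Comp c) : Γ.CompP fun a =>
      codeSet (4 * h a) k (κ a) ∈ link (F a) (codeSet (4 * h a) k (η a)) (c a) :=
  ((E.compP_minF hκ hb).and ((CompP.eq (E.comp_card hκ) ((E.comp_card hη).add hc)).and
    (E.compP_subset hη hκ))).congr fun _ => mem_link

theorem comp_card_link (E : Table Γ k h x F) (hη : Γ.Comp η) (hc : Γ.Comp c) :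
    Γ.Comp fun a => (link (F a) (codeSet (4 * h a) k (η a)) (c a)).card := by
  classical
  have hv := E.comp_code
  have E' := E.lift fun a => numCodes k (h a)
  refine (Comp.count E.comp_numCodes E.poly_numCodes
    (P := fun a κ => Canon (4 * h a) k κ ∧
      codeSet (4 * h a) k κ ∈ link (F a) (codeSet (4 * h a) k (η a)) (c a))
    ((E'.compP_canon hv fun p => p.2).and
      (E'.compP_link hv (fun p => p.2) (hη.lift _) (hc.lift _)))).congr fun a => ?_
  have hsub : link (F a) (codeSet (4 * h a) k (η a)) (c a) ⊆ sets (4 * h a) k :=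
    ((Finset.filter_subset _ _).trans (minF_subset _)).trans (E.subset a)
  rw [← card_filter_canon (4 * h a) k _ hsub, numCodes]

theorem compP_flower (E : Table Γ k h x F) (hη : Γ.Comp η) (hc : Γ.Comp c) (hck : ∀ a, c a ≤ k) :
    Γ.CompP fun a =>
      Flower (thr (base k (h a))) (F a) (codeSet (4 * h a) k (η a)) (c a) :=
  ((CompP.le (Comp.const 1) hc).and (CompP.le (E.comp_thr hc hck) (E.comp_card_link hη hc))).congr
    fun a => by
      have h1 : (codeSet (4 * h a) k (η a)).Nonempty :=
        (mem_sets.1 (codeSet_mem_sets (by have := (E.good a).pos; omega) E.pos _)).2.1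
      simp [Flower, h1]

theorem comp_selIdx (E : Table Γ k h x F) :
    Γ.Comp fun a => selIdx (thr (base k (h a))) (4 * h a) k (F a) := by
  have hb : Γ.Comp fun a => (k + 1) * (k + 1) * (4 * h a) ^ k :=
    (Comp.const _).mul E.comp_numCodes
  have hv := Comp.loop_var hb.expB
  have E' := E.lift fun a => (k + 1) * (k + 1) * (4 * h a) ^ k
  have hm := hv.mod E'.comp_numCodes
  have hd := hv.div E'.comp_numCodes
  have hc := hd.mod (Comp.const (k + 1))
  exact Comp.firstIdx hb ((PolyB.const _).mul E.poly_numCodes) (CompP.and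
    (E'.compP_flower hm hc fun p => Nat.lt_succ_iff.1 (Nat.mod_lt _ (Nat.succ_pos k)))
    (CompP.eq ((E'.comp_card hm).add hc) (hd.div (Comp.const (k + 1)))))

/-- One step of the process in terms of codes and bounded quantifiers only, the form in which it can
be computed from a table. -/
theorem mem_next_sel {θ : ℕ → ℕ} {V k : ℕ} {F : Finset (Finset ℕ)}
    (hF : F ⊆ sets V k) (b : Bool) (e : Finset ℕ) :
    e ∈ next (sel θ V k) F b ↔ e ∈ F ∨ (selIdx θ V k F < (k + 1) * (k + 1) * V ^ k ∧
      ((b = true ∧ ∃ κ < V ^ k, codeSet V k κ ∈ link F (codeSet V k (selIdx θ V k F % V ^ k))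
          (selIdx θ V k F / V ^ k % (k + 1)) ∧
        codeSet V k κ \ codeSet V k (selIdx θ V k F % V ^ k) = e) ∨
      (b = false ∧ codeSet V k (selIdx θ V k F % V ^ k) = e))) := by
  have key : ∀ H c, (∃ C ∈ link F H c, C \ H = e) ↔
      ∃ κ < V ^ k, codeSet V k κ ∈ link F H c ∧ codeSet V k κ \ H = e := by
    intro H c
    constructor
    · rintro ⟨C, hC, he⟩
      obtain ⟨κ, hκ, rfl⟩ := exists_codeSet (hF (minF_subset _ (mem_link.1 hC).1))
      exact ⟨κ, hκ, hC, he⟩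
    · rintro ⟨κ, _, hC, he⟩
      exact ⟨_, hC, he⟩
  unfold next sel
  split_ifs with hlt
  · rw [← key]
    cases b
    · simp [grow, hlt, or_comm, eq_comm]
    · simp [grow, hlt]
  · simp [hlt]

theorem compP_sdiff_eq (E : Par Γ k h) {ρ : Γ.Idx → ℕ} (hκ : Γ.Comp κ) (hη : Γ.Comp η)
    (hρ : Γ.Comp ρ) : Γ.CompP fun a =>
      codeSet (4 * h a) k (κ a) \ codeSet (4 * h a) k (η a) = codeSet (4 * h a) k (ρ a) := by
  have hb : Γ.Comp fun a => 4 * h a := (Comp.const 4).mul E.comp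
  have hv := Comp.loop_var hb.expB
  have E' := E.lift fun a => 4 * h a
  refine (CompP.ball hb ((PolyB.const 4).mul E.poly)
    (P := fun a v => (v ∈ codeSet (4 * h a) k (κ a) ∧ ¬v ∈ codeSet (4 * h a) k (η a)) ↔
      v ∈ codeSet (4 * h a) k (ρ a))
    (((E'.compP_mem (hκ.lift _) hv).and (E'.compP_mem (hη.lift _) hv).not).iff
      (E'.compP_mem (hρ.lift _) hv))).congr fun a => ?_
  have hs : ∀ κ v, v ∈ codeSet (4 * h a) k κ → v < 4 * h a := fun κ v hv' =>
    Finset.mem_range.1 ((mem_sets.1 (codeSet_mem_sets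
      (by have := (E.good a).pos; omega) E.pos κ)).1 hv')
  simp only [Finset.ext_iff, Finset.mem_sdiff]
  refine ⟨fun H v _ => H v, fun H v => ⟨fun hv' => (H v (hs _ _ hv'.1)).1 hv',
    fun hv' => (H v (hs _ _ hv')).2 hv'⟩⟩

theorem compP_bits (E : Par Γ k h) {g s : Γ.Idx → ℕ} (hg : Γ.Comp g) (hs : Γ.Comp s) :
    Γ.CompP fun a => bits k (h a) (g a) (s a) = true := by
  have hm := E.comp_maxPetal
  have hv := Comp.loop_var hm.expB
  have E' := E.lift fun a => maxPetal k (h a)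
  have hU := E'.comp_numCodes.add (Comp.const 1)
  refine (CompP.bex hm E.poly_maxPetal (P := fun a i =>
    g a / (numCodes k (h a) + 1) ^ i % (numCodes k (h a) + 1) = s a)
    (CompP.eq (((hg.lift _).div (Comp.pow hU hv ((E.poly_maxPetal.lift _).le fun p => p.2.le)
      ?_)).mod hU) (hs.lift _))).congr fun a => by simp [bits]
  -- The powers needed for reading digits are at most the number of guesses, so they fit into words.
  exact (E.comp_numGuess.expB.lift _).le fun p => Nat.pow_le_pow_right (Nat.succ_pos _) p.2.le

theorem compP_next (E : Table Γ k h x F) {g s : Γ.Idx → ℕ} (hg : Γ.Comp g) (hs : Γ.Comp s)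
    (hκ : Γ.Comp κ) (hb : ∀ a, κ a < numCodes k (h a)) :
    Γ.CompP fun a => codeSet (4 * h a) k (κ a) ∈
      next (sel (thr (base k (h a))) (4 * h a) k) (F a) (bits k (h a) (g a) (s a)) := by
  have hU := E.comp_numCodes
  have hsel := E.comp_selIdx
  have hη := hsel.mod hU
  have hc := (hsel.div hU).mod (Comp.const (k + 1))
  have hv := E.comp_code
  have E' := E.lift fun a => numCodes k (h a)
  have hbit := compP_bits E.toPar hg hs
  refine ((E.compP_member hκ hb).or ((CompP.lt hsel ((Comp.const ((k + 1) * (k + 1))).mul hU)).and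
    ((hbit.and (CompP.bex hU E.poly_numCodes (P := fun a κ' => codeSet (4 * h a) k κ' ∈
      link (F a) (codeSet (4 * h a) k (selIdx (thr (base k (h a))) (4 * h a) k (F a) %
        numCodes k (h a)))
        (selIdx (thr (base k (h a))) (4 * h a) k (F a) / numCodes k (h a) % (k + 1)) ∧
      codeSet (4 * h a) k κ' \ codeSet (4 * h a) k (selIdx (thr (base k (h a))) (4 * h a) k (F a) %
        numCodes k (h a)) = codeSet (4 * h a) k (κ a)) ((E'.compP_link hv (fun p => p.2)
          (hη.lift _) (hc.lift _)).and
        (compP_sdiff_eq E'.toPar hv (hη.lift _) (hκ.lift _))))).or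
      (hbit.not.and (E.compP_codeSet_eq hη hκ))))).congr fun a => ?_
  rw [mem_next_sel (E.subset a), Bool.not_eq_true]
  rfl

theorem comp_rank (E : Table Γ k h x F) (hκ : Γ.Comp κ) (hb : ∀ a, κ a < numCodes k (h a)) :
    Γ.Comp fun a => rank k (h a) (F a) (κ a) := by
  classical
  have hv := Comp.loop_var hκ.expB
  have E' := E.lift κ
  have hb' : ∀ p : (Γ.loop κ).Idx, p.1.2 < numCodes k (h p.1.1) := fun p => p.2.trans (hb p.1.1)
  exact Comp.count hκ (E.poly_numCodes.le fun a => (hb a).le)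
    (P := fun a κ' => Canon (4 * h a) k κ' ∧ codeSet (4 * h a) k κ' ∈ minF (F a))
    ((E'.compP_canon hv hb').and (E'.compP_minF hv hb'))

theorem compP_literal (E : Par Γ k h) {α v : Γ.Idx → ℕ} {m : Γ.Idx → ℕ} (hα : Γ.Comp α)
    (hv : Γ.Comp v) (hm : Γ.Comp m) (hmh : ∀ a, m a < 2 * h a) :
    Γ.CompP fun a => α a / 2 ^ m a % 2 ≠ v a % 2 :=
  (CompP.eq ((hα.div (Comp.pow (Comp.const 2) hm (((PolyB.const 2).mul E.poly).le fun a =>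
    (hmh a).le) (ExpB.two_pow (C := 2) fun a => by
      have := hmh a
      have := E.le a
      omega))).mod (Comp.const 2)) (hv.mod (Comp.const 2))).not

theorem digit_lt (E : Par Γ k h) (κ j : ℕ) (a : Γ.Idx) : digit (4 * h a) κ j / 2 < 2 * h a := by
  have h1 := (E.good a).pos
  have h2 : digit (4 * h a) κ j < 4 * h a := Nat.mod_lt _ (by omega)
  omega

theorem comp_missA (E : Par Γ k h) {α : Γ.Idx → ℕ} (hα : Γ.Comp α) (hκ : Γ.Comp κ) :
    Γ.Comp fun a => missA k (h a) (α a) (κ a) := by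
  have E' := E.lift fun _ => k
  have hd := E.comp_loop_digit hκ
  exact CompP.ball (Comp.const k) (PolyB.const k) ((CompP.lt (hd.div (Comp.const 2)) E'.comp).imp
    (compP_literal E' (hα.lift _) hd (hd.div (Comp.const 2)) fun p => digit_lt E _ _ p.1.1))

theorem comp_missB (E : Par Γ k h) {β : Γ.Idx → ℕ} (hβ : Γ.Comp β) (hκ : Γ.Comp κ) :
    Γ.Comp fun a => missB k (h a) (β a) (κ a) := by
  have E' := E.lift fun _ => k
  have hd := E.comp_loop_digit hκ
  exact CompP.ball (Comp.const k) (PolyB.const k) ((CompP.le E'.comp (hd.div (Comp.const 2))).imp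
    (compP_literal E' (hβ.lift _) hd ((hd.div (Comp.const 2)).sub E'.comp) fun p =>
      (Nat.sub_le _ _).trans_lt (digit_lt E _ _ p.1.1)))

/-! #### Messages -/

theorem prm_pow_le {k h m : ℕ} (hg : Good k h) (hm : m ≤ 2 * deg h) : prm h ^ m ≤ 2 ^ h :=
  (Nat.pow_le_pow_right hg.prm_pos (by omega)).trans hg.numProof_le

theorem comp_pow_deg (E : Par Γ k h) {y m : Γ.Idx → ℕ} (hy : Γ.Comp y) (hyq : ∀ a, y a ≤ prm (h a))
    (hm : Γ.Comp m) (hmd : ∀ a, m a ≤ 2 * deg (h a)) : Γ.Comp fun a => y a ^ m a :=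
  Comp.pow hy hm (((PolyB.const 2).mul E.poly_deg).le hmd) (E.expB fun a =>
    (Nat.pow_le_pow_left (hyq a) _).trans (prm_pow_le (E.good a) (hmd a)))

/-- The sum over the clauses of a block becomes a sum over all codes, weighted by an indicator.
Covers the messages of both players. -/
theorem comp_message (E : Table Γ k h x F) {u : Γ.Idx → ℕ → ℕ} {e : Γ.Idx → ℕ → ℕ} {y i : Γ.Idx → ℕ}
    (hu : (Γ.loop fun a => numCodes k (h a)).Comp fun p => u p.1.1 p.1.2)
    (he : (Γ.loop fun a => numCodes k (h a)).Comp fun p => e p.1.1 p.1.2)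
    (hed : ∀ a κ, e a κ ≤ 2 * deg (h a)) (hy : Γ.Comp y) (hyq : ∀ a, y a ≤ prm (h a))
    (hi : Γ.Comp i) : Γ.Comp fun a =>
      ∑ κ ∈ clauseCodes k (h a) (F a) with rank k (h a) (F a) κ / deg (h a) = i a,
        u a κ * y a ^ e a κ := by
  classical
  have hv := E.comp_code
  have E' := E.lift fun a => numCodes k (h a)
  refine (Comp.sum E.comp_numCodes E.poly_numCodes (g := fun a κ =>
    ind (κ ∈ clauseCodes k (h a) (F a) ∧ rank k (h a) (F a) κ / deg (h a) = i a) *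
      (u a κ * y a ^ e a κ)) (Comp.mul ((E'.compP_clause hv fun p => p.2).and
        (CompP.eq ((E'.comp_rank hv fun p => p.2).div E'.comp_deg) (hi.lift _))).comp
      (hu.mul (comp_pow_deg E'.toPar (hy.lift _) (fun p => hyq p.1.1) he
        fun p => hed p.1.1 p.1.2)))).congr fun a => ?_
  have hsub : ∀ κ ∈ clauseCodes k (h a) (F a), κ ∈ Finset.range (numCodes k (h a)) :=
    fun κ hκ => (Finset.mem_filter.1 hκ).1
  rw [Finset.sum_filter]
  refine Finset.sum_subset_zero_on_sdiff hsub (fun κ hκ => ?_) fun κ hκ => ?_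
  · rw [ind_of_not fun hh => (Finset.mem_sdiff.1 hκ).2 hh.1, zero_mul]
  · rw [ind_eq_ite]
    simp [hκ]

theorem comp_msgA (E : Table Γ k h x F) {α y i : Γ.Idx → ℕ} (hα : Γ.Comp α) (hy : Γ.Comp y)
    (hyq : ∀ a, y a ≤ prm (h a)) (hi : Γ.Comp i) : Γ.Comp fun a =>
      Protocol.msgA (clauseCodes k (h a) (F a)) (rank k (h a) (F a)) (deg (h a))
        (missA k (h a) (α a)) (y a) (i a) := by
  have E' := E.lift fun a => numCodes k (h a)
  exact E.comp_message (comp_missA E'.toPar (hα.lift _) E.comp_code)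
    ((E'.comp_rank E.comp_code fun p => p.2).mod E'.comp_deg)
    (fun a κ => (Nat.mod_lt _ (E.good a).deg_pos).le.trans (by omega)) hy hyq hi

theorem comp_msgB (E : Table Γ k h x F) {β y i : Γ.Idx → ℕ} (hβ : Γ.Comp β) (hy : Γ.Comp y)
    (hyq : ∀ a, y a ≤ prm (h a)) (hi : Γ.Comp i) : Γ.Comp fun a =>
      Protocol.msgB (clauseCodes k (h a) (F a)) (rank k (h a) (F a)) (deg (h a))
        (missB k (h a) (β a)) (y a) (i a) := by
  have E' := E.lift fun a => numCodes k (h a)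
  exact E.comp_message (comp_missB E'.toPar (hβ.lift _) E.comp_code)
    (E'.comp_deg.sub ((E'.comp_rank E.comp_code fun p => p.2).mod E'.comp_deg))
    (fun a κ => (Nat.sub_le _ _).trans (by omega)) hy hyq hi

theorem comp_proofVal (E : Par Γ k h) {s y : Γ.Idx → ℕ} (hs : Γ.Comp s) (hy : Γ.Comp y)
    (hyq : ∀ a, y a ≤ prm (h a)) :
    Γ.Comp fun a => Protocol.proofVal (deg (h a)) (prm (h a)) (s a) (y a) := by
  have hb : Γ.Comp fun a => 2 * deg (h a) + 1 :=
    ((Comp.const 2).mul E.comp_deg).add (Comp.const 1)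
  have hj := Comp.loop_var hb.expB
  have E' := E.lift fun a => 2 * deg (h a) + 1
  have hjd : ∀ p : (Γ.loop fun a => 2 * deg (h a) + 1).Idx, p.1.2 ≤ 2 * deg (h p.1.1) :=
    fun p => Nat.lt_succ_iff.1 p.2
  exact Comp.sum hb (((PolyB.const 2).mul E.poly_deg).add (PolyB.const 1))
    (g := fun a j => (if j = deg (h a) then 0 else s a / prm (h a) ^ j % prm (h a)) * y a ^ j)
    ((CompP.ite (CompP.eq hj E'.comp_deg) (Comp.const 0) (((hs.lift _).div
      (comp_pow_deg E' E'.comp_prm (fun _ => le_rfl) hj hjd)).mod E'.comp_prm)).mul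
      (comp_pow_deg E' (hy.lift _) (fun p => hyq p.1.1) hj hjd))

/-! #### Entries of the vectors -/

variable {I J α β s : Γ.Idx → ℕ}

theorem comp_cellEntry (E : Table Γ k h x F) (hI : Γ.Comp I) :
    (Γ.loop fun a => blocks k (h a)).Comp fun p =>
      I p.1.1 / prm (h p.1.1) / prm (h p.1.1) ^ p.1.2 % prm (h p.1.1) := by
  have E' := E.lift fun a => blocks k (h a)
  exact (((hI.lift _).div E'.comp_prm).div (E'.comp_prm_pow (Comp.loop_var E.comp_blocks.expB)
    fun p => p.2.le.trans (Nat.le_succ _))).mod E'.comp_prm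

theorem mod_prm_le (E : Par Γ k h) (a : Γ.Idx) (I : ℕ) : I % prm (h a) ≤ prm (h a) :=
  (Nat.mod_lt _ (E.good a).prm_pos).le

theorem compP_cellA (E : Table Γ k h x F) (hα : Γ.Comp α) (hI : Γ.Comp I) : Γ.CompP fun a =>
    SignVec.CellA (prm (h a)) (blocks k (h a)) (Protocol.msgA (clauseCodes k (h a) (F a))
      (rank k (h a) (F a)) (deg (h a)) (missA k (h a) (α a))) (I a) := by
  have E' := E.lift fun a => blocks k (h a)
  have hv := Comp.loop_var E.comp_blocks.expB
  exact CompP.ball E.comp_blocks E.poly_blocks (CompP.eq (E.comp_cellEntry hI)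
    ((E'.comp_msgA (hα.lift _) ((hI.lift _).mod E'.comp_prm)
      (fun p => mod_prm_le E.toPar p.1.1 _) hv).mod E'.comp_prm))

theorem compP_cellB (E : Table Γ k h x F) (hs : Γ.Comp s) (hβ : Γ.Comp β) (hI : Γ.Comp I) :
    Γ.CompP fun a =>
      SignVec.CellB (prm (h a)) (blocks k (h a)) (Protocol.msgB (clauseCodes k (h a) (F a))
        (rank k (h a) (F a)) (deg (h a)) (missB k (h a) (β a)))
        (Protocol.proofVal (deg (h a)) (prm (h a)) (s a)) (I a) := by
  have E' := E.lift fun a => blocks k (h a)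
  have hv := Comp.loop_var E.comp_blocks.expB
  have hy := hI.mod E.comp_prm
  exact CompP.eq ((Comp.sum E.comp_blocks E.poly_blocks ((E.comp_cellEntry hI).mul
    (E'.comp_msgB (hβ.lift _) (hy.lift _) (fun p => mod_prm_le E.toPar p.1.1 _) hv))).mod
      E.comp_prm) ((comp_proofVal E.toPar hs hy fun a => mod_prm_le E.toPar a _).mod E.comp_prm)

theorem comp_negA (E : Table Γ k h x F) (hα : Γ.Comp α) (hI : Γ.Comp I) : Γ.Comp fun a =>
    SignVec.negA (prm (h a)) (blocks k (h a)) (Protocol.msgA (clauseCodes k (h a) (F a))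
      (rank k (h a) (F a)) (deg (h a)) (missA k (h a) (α a))) (I a) :=
  open Classical in CompP.ite ((E.compP_cellA hα (hI.div (Comp.const 4))).or
    (CompP.lt (hI.mod (Comp.const 4)) (Comp.const 2))) (Comp.const 0) (Comp.const 1)

theorem comp_negB (E : Table Γ k h x F) (hs : Γ.Comp s) (hβ : Γ.Comp β) (hI : Γ.Comp I) :
    Γ.Comp fun a => SignVec.negB (prm (h a)) (blocks k (h a))
      (Protocol.msgB (clauseCodes k (h a) (F a)) (rank k (h a) (F a)) (deg (h a))
        (missB k (h a) (β a))) (Protocol.proofVal (deg (h a)) (prm (h a)) (s a)) (I a) :=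
  open Classical in CompP.ite ((E.compP_cellB hs hβ (hI.div (Comp.const 4))).or
    (CompP.eq ((hI.mod (Comp.const 4)).mod (Comp.const 2)) (Comp.const 0)))
    (Comp.const 0) (Comp.const 1)

/-- The power `2 ^ I a` need not fit into a word, so the exponent is cut off at `h a`, beyond which
the bits of `α a` vanish anyway. -/
theorem comp_bit (E : Par Γ k h) (hα : Γ.Comp α) (hb : ∀ a, α a < 2 ^ h a) (hI : Γ.Comp I) :
    Γ.Comp fun a => α a / 2 ^ I a % 2 := by
  have hm : ∀ a, (if I a < h a then I a else h a) ≤ h a := fun a => by split_ifs <;> omega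
  refine ((hα.div (Comp.pow (Comp.const 2) (CompP.ite (CompP.lt hI E.comp) hI E.comp)
    (E.poly.le hm) (E.expB fun a => Nat.pow_le_pow_right (by norm_num) (hm a)))).mod
    (Comp.const 2)).congr fun a => ?_
  split_ifs with hlt
  · rfl
  · rw [Nat.div_eq_of_lt (hb a), Nat.div_eq_of_lt]
    exact (hb a).trans_le (Nat.pow_le_pow_right (by norm_num) (by omega))

theorem comp_loop_coord (E : Par Γ k h) (hJ : Γ.Comp J) :
    (Γ.loop fun a => reps (h a)).Comp fun p =>
      J p.1.1 / (4 * prm (h p.1.1) ^ (blocks k (h p.1.1) + 1)) ^ p.1.2 %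
        (4 * prm (h p.1.1) ^ (blocks k (h p.1.1) + 1)) := by
  have E' := E.lift fun a => reps (h a)
  exact ((hJ.lift _).div (E'.comp_coords_pow (Comp.loop_var E.comp_reps.expB)
    fun p => p.2.le)).mod E'.comp_coords

theorem comp_entA (E : Table Γ k h x F) (hα : Γ.Comp α) (hb : ∀ a, α a < 2 ^ h a)
    (hJ : Γ.Comp J) : Γ.Comp fun a => entA k (h a) (F a) (α a) (J a) := by
  have E' := E.lift fun a => reps (h a)
  have hP := E.comp_coords_pow E.comp_reps fun _ => le_rfl
  have hD := hJ.sub hP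
  exact CompP.ite (CompP.lt hJ hP) (Comp.sum E.comp_reps E.poly_reps
    (E'.comp_negA (hα.lift _) (comp_loop_coord E.toPar hJ)))
    (CompP.ite (CompP.lt (hD.mod (Comp.const 4)) (Comp.const 2))
      (comp_bit E.toPar hα hb (hD.div (Comp.const 4)))
      ((hD.mod (Comp.const 4)).sub (Comp.const 2)))

theorem comp_entB (E : Table Γ k h x F) (hs : Γ.Comp s) (hβ : Γ.Comp β)
    (hb : ∀ a, β a < 2 ^ h a) (hJ : Γ.Comp J) :
    Γ.Comp fun a => entB k (h a) (F a) (s a) (β a) (J a) := by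
  have E' := E.lift fun a => reps (h a)
  have hP := E.comp_coords_pow E.comp_reps fun _ => le_rfl
  have hD := hJ.sub hP
  exact CompP.ite (CompP.lt hJ hP) (Comp.sum E.comp_reps E.poly_reps
    (E'.comp_negB (hs.lift _) (hβ.lift _) (comp_loop_coord E.toPar hJ)))
    (CompP.ite (CompP.lt (hD.mod (Comp.const 4)) (Comp.const 2)) (hD.mod (Comp.const 4))
      (comp_bit E.toPar hβ hb (hD.div (Comp.const 4))))

end Table
end Red

/-! ### Encodings -/

theorem List.getD_flatten_ofFn {m k : ℕ} (f : Fin m → Fin k → ℕ) {i j : ℕ} (hi : i < m)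
    (hj : j < k) : (List.ofFn fun i => List.ofFn (f i)).flatten.getD (i * k + j) 0 =
      f ⟨i, hi⟩ ⟨j, hj⟩ := by
  have hk : 0 < k := by omega
  have hlt : i * k + j < m * k := by
    calc i * k + j < (i + 1) * k := by rw [add_mul]; omega
      _ ≤ _ := Nat.mul_le_mul_right _ hi
  have e1 : ∀ i j, j < k → (i * k + j) / k = i := fun i j hj => by
    rw [mul_comm, Nat.mul_add_div hk, Nat.div_eq_of_lt hj, add_zero]
  have e2 : ∀ i j, j < k → (i * k + j) % k = j := fun i j hj => by
    rw [mul_comm, Nat.mul_add_mod, Nat.mod_eq_of_lt hj]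
  have key : (List.ofFn fun i => List.ofFn (f i)).flatten = List.ofFn fun z : Fin (m * k) =>
      f ⟨z / k, (Nat.div_lt_iff_lt_mul hk).2 z.2⟩ ⟨z % k, Nat.mod_lt _ hk⟩ := by
    rw [List.ofFn_mul]
    congr 2
    ext1 i
    congr 1
    ext1 j
    congr
    · exact Fin.ext (e1 i j j.2).symm
    · exact Fin.ext (e2 i j j.2).symm
  rw [key, List.getD_eq_getElem _ _ (by simpa using hlt), List.getElem_ofFn]
  congr
  · exact e1 i j hj
  · exact e2 i j hj

theorem List.length_flatten_ofFn {m k : ℕ} (f : Fin m → Fin k → ℕ) :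
    (List.ofFn fun i => List.ofFn (f i)).flatten.length = m * k := by
  simp [Function.comp_def]

namespace KCNF

variable {k n : ℕ} (φ : KCNF k n)

theorem length_le : φ.clauses.length ≤ (2 * n) ^ k := by
  refine φ.nodup.length_le_card.trans (le_of_eq ?_)
  simp [mul_comm]

theorem encode_eq : φ.encode = n :: φ.clauses.length :: (List.ofFn fun i : Fin φ.clauses.length =>
    List.ofFn fun j => 2 * ((φ.clauses.get i j).1 : ℕ) + (φ.clauses.get i j).2.toNat).flatten := by
  unfold encode
  congr 3
  conv_lhs => rw [← List.ofFn_get φ.clauses, List.map_ofFn]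
  rfl

theorem getD_encode {i j : ℕ} (hi : i < φ.clauses.length) (hj : j < k) :
    φ.encode.getD (2 + (i * k + j)) 0 = 2 * ((φ.clauses.get ⟨i, hi⟩ ⟨j, hj⟩).1 : ℕ) +
      (φ.clauses.get ⟨i, hi⟩ ⟨j, hj⟩).2.toNat := by
  rw [encode_eq, add_comm, List.getD_cons_succ, List.getD_cons_succ,
    List.getD_flatten_ofFn _ hi hj]

theorem getD_encode_of_le {z : ℕ} (hz : 2 + (2 * n) ^ k * k ≤ z) : φ.encode.getD z 0 = 0 := by
  refine List.getD_eq_default _ _ ?_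
  rw [encode_eq, List.length_cons, List.length_cons, List.length_flatten_ofFn]
  have := Nat.mul_le_mul_right k φ.length_le
  omega

end KCNF

theorem getD_encodeSigns {N d : ℕ} (A : Fin N → Fin d → ℤˣ) {i j : ℕ} (hi : i < N) (hj : j < d) :
    (encodeSigns A).getD (i * d + j) 0 = if A ⟨i, hi⟩ ⟨j, hj⟩ = 1 then 1 else 0 :=
  List.getD_flatten_ofFn (fun i k => if A i k = 1 then 1 else 0) hi hj

theorem length_encodeSigns {N d : ℕ} (A : Fin N → Fin d → ℤˣ) :
    (encodeSigns A).length = N * d :=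
  List.length_flatten_ofFn fun i k => if A i k = 1 then 1 else 0

namespace Red

open Sparsify WordRAM WordRAM.Fam

variable {Γ : Fam} {k : ℕ} {h : Γ.Idx → ℕ}

/-- The input lists the literals of a clause in any order and with repetitions, so it is compared
with a code as a set, literal by literal. -/
theorem compP_formula (E : Par Γ k h) {n : Γ.Idx → ℕ} {φ : ∀ a, KCNF k (n a)}
    (hn : ∀ a, n a ≤ 2 * h a)
    (hmem : ∀ a, ∀ z < 2 + numCodes k (h a) * k, Γ.mem a z = (φ a).encode.getD z 0)
    {κ : Γ.Idx → ℕ} (hκ : Γ.Comp κ) :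
    Γ.CompP fun a => codeSet (4 * h a) k (κ a) ∈ formulaSets (φ a) := by
  have hlen : ∀ a, (φ a).clauses.length ≤ numCodes k (h a) := fun a =>
    (φ a).length_le.trans (Nat.pow_le_pow_left (by have := hn a; omega) _)
  have hm1 : ∀ a, Γ.mem a 1 = (φ a).clauses.length := fun a => by
    have h1 : 0 < numCodes k (h a) := Nat.pow_pos (by have := (E.good a).pos; omega)
    have h2 : 0 < numCodes k (h a) * k := Nat.mul_pos h1 E.pos
    rw [hmem a 1 (by omega)]
    rfl
  have hcell : ∀ a, ∀ i (hi : i < Γ.mem a 1), ∀ j (hj : j < k), Γ.mem a (2 + (i * k + j)) =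
      2 * (((φ a).clauses.get ⟨i, hm1 a ▸ hi⟩ ⟨j, hj⟩).1 : ℕ) +
        ((φ a).clauses.get ⟨i, hm1 a ▸ hi⟩ ⟨j, hj⟩).2.toNat := fun a i hi j hj => by
    have h3 : i * k + j < numCodes k (h a) * k := by
      calc i * k + j < (i + 1) * k := by rw [add_mul]; omega
        _ ≤ _ := Nat.mul_le_mul_right _ (Nat.succ_le_of_lt (hi.trans_le (hm1 a ▸ hlen a)))
    rw [hmem a _ (by omega), KCNF.getD_encode _ (hm1 a ▸ hi) hj]
  have hlit : ∀ a, ∀ i < Γ.mem a 1, ∀ j < k, Γ.mem a (2 + (i * k + j)) < 4 * h a :=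
    fun a i hi j hj => by
      rw [hcell a i hi j hj]
      have h4 := ((φ a).clauses.get ⟨i, hm1 a ▸ hi⟩ ⟨j, hj⟩).1.2
      have h5 := ((φ a).clauses.get ⟨i, hm1 a ▸ hi⟩ ⟨j, hj⟩).2.toNat_lt
      have h6 := hn a
      omega
  have hmB : Γ.PolyB fun a => Γ.mem a 1 := E.poly_numCodes.le fun a => hm1 a ▸ hlen a
  have hm : Γ.Comp fun a => Γ.mem a 1 := Comp.load (Comp.const 1) hmB.expB
  have hV : Γ.Comp fun a => 4 * h a := (Comp.const 4).mul E.comp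
  have hVP : Γ.PolyB fun a => 4 * h a := (PolyB.const 4).mul E.poly
  have E₁ := E.lift fun a => Γ.mem a 1
  have hi := Comp.loop_var hm.expB
  have hv := Comp.loop_var (hV.lift fun a => Γ.mem a 1).expB
  have hj := Comp.loop_var (Γ := (Γ.loop fun a => Γ.mem a 1).loop fun p => 4 * h p.1.1)
    (ExpB.const k)
  refine (CompP.bex hm hmB (P := fun a i => ∀ v < 4 * h a, v ∈ codeSet (4 * h a) k (κ a) ↔
    ∃ j < k, Γ.mem a (2 + (i * k + j)) = v) (CompP.ball (hV.lift _) (hVP.lift _)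
      (P := fun p v => v ∈ codeSet (4 * h p.1.1) k (κ p.1.1) ↔
        ∃ j < k, Γ.mem p.1.1 (2 + (p.1.2 * k + j)) = v)
      (((E₁.lift _).compP_mem ((hκ.lift _).lift _) hv).iff
        (CompP.bex (Γ := (Γ.loop fun a => Γ.mem a 1).loop fun p => 4 * h p.1.1)
          (Comp.const k) (PolyB.const k)
          (P := fun q j => Γ.mem q.1.1.1.1 (2 + (q.1.1.1.2 * k + j)) = q.1.2)
          (CompP.eq (Comp.load ((Comp.const 2).add ((((hi.lift _).lift _).mul (Comp.const k)).add
            hj)) ?_) (hv.lift _)))))).congr fun a => ?_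
  · exact (((hV.expB.lift _).lift _).lift _).le fun q =>
      (hlit q.1.1.1.1.1.1 _ q.1.1.1.1.2 _ q.2).le
  · have hs : ∀ v, v ∈ codeSet (4 * h a) k (κ a) → v < 4 * h a := fun v hv' =>
      Finset.mem_range.1 ((mem_sets.1 (codeSet_mem_sets
        (by have := (E.good a).pos; omega) E.pos (κ a))).1 hv')
    have key : ∀ i (hi : i < Γ.mem a 1), (∀ v < 4 * h a, v ∈ codeSet (4 * h a) k (κ a) ↔
        ∃ j < k, Γ.mem a (2 + (i * k + j)) = v) ↔
        clauseLits ((φ a).clauses.get ⟨i, hm1 a ▸ hi⟩) = codeSet (4 * h a) k (κ a) := by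
      intro i hi
      have hc : ∀ v, v ∈ clauseLits ((φ a).clauses.get ⟨i, hm1 a ▸ hi⟩) ↔
          ∃ j < k, Γ.mem a (2 + (i * k + j)) = v := by
        intro v
        simp only [clauseLits, Finset.mem_image, Finset.mem_univ, true_and]
        constructor
        · rintro ⟨j, rfl⟩
          exact ⟨j, j.2, hcell a i hi j j.2⟩
        · rintro ⟨j, hj, rfl⟩
          exact ⟨⟨j, hj⟩, (hcell a i hi j hj).symm⟩
      rw [Finset.ext_iff]
      refine ⟨fun H v => ⟨fun hv' => ?_, fun hv' => ?_⟩, fun H v _ => (H v).symm.trans (hc v)⟩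
      · obtain ⟨j, hj, rfl⟩ := (hc v).1 hv'
        exact (H _ (hlit a i hi j hj)).2 ⟨j, hj, rfl⟩
      · exact (hc v).2 ((H v (hs v hv')).1 hv')
    simp only [formulaSets, List.mem_toFinset, List.mem_map]
    constructor
    · rintro ⟨C, hC, he⟩
      obtain ⟨i, hi, rfl⟩ := List.getElem_of_mem hC
      exact ⟨i, (hm1 a).symm ▸ hi, (key i ((hm1 a).symm ▸ hi)).2 he⟩
    · rintro ⟨i, hi, H⟩
      exact ⟨_, List.getElem_mem _, (key i hi).1 H⟩

/-! ### Filling of a part of the memory -/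

/-- The memory `m`, where the cells `x, …, x + i - 1` have the contents `v 0, …, v (i - 1)`. -/
def overwrite (m : ℕ → ℕ) (x i : ℕ) (v : ℕ → ℕ) : ℕ → ℕ :=
  fun z => if x ≤ z ∧ z < x + i then v (z - x) else m z

theorem overwrite_add {m v : ℕ → ℕ} {x i z : ℕ} (hz : z < i) : overwrite m x i v (x + z) = v z := by
  rw [overwrite, if_pos (by omega), Nat.add_sub_cancel_left]

theorem overwrite_of_not {m v : ℕ → ℕ} {x i z : ℕ} (hz : z < x ∨ x + i ≤ z) :
    overwrite m x i v z = m z := if_neg (by omega)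

theorem update_overwrite (m v : ℕ → ℕ) (x i : ℕ) :
    Function.update (overwrite m x i v) (x + i) (v i) = overwrite m x (i + 1) v := by
  funext z
  by_cases hz : z = x + i
  · subst hz
    rw [Function.update_self, overwrite_add (by omega)]
  · rw [Function.update_of_ne hz, overwrite, overwrite]
    congr 1
    exact propext (by omega)

/-- The values may depend on the memory, but have to be computable while the block is partly
overwritten. -/
theorem Does.fill {x b : Γ.Idx → ℕ} {v : Γ.Idx → ℕ → ℕ} (hx : Γ.VComp x) (hb : Γ.Comp b)
    (hv : (Γ.memLoop b fun a i μ => μ = overwrite (Γ.mem a) (x a) i (v a)).Comp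
      fun p => v p.1.1.1.1 p.1.1.1.2) :
    Γ.Does (fun a => 2 * b a + 1) fun a μ => μ = overwrite (Γ.mem a) (x a) (b a) (v a) := by
  refine Does.weaken (Does.forLoop (tm := fun _ => 1) hb
    (fun a i μ => μ = overwrite (Γ.mem a) (x a) i (v a)) (fun a => ?_) ?_)
    (fun a => by omega) fun _ _ hQ => hQ
  · funext z
    rw [overwrite_of_not (by omega)]
  · refine Does.weaken (Does.store (((hx.memLoop b _).comp).add
      (VComp.memLoop_var hb.expB _).comp) hv) (fun _ => le_rfl) fun p μ hμ => ?_
    rw [hμ, ← update_overwrite]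
    congr 1
    exact p.2

end Red

/-! ### Further closure properties of `VComp` and `Does` -/

namespace WordRAM.Fam

variable {Γ : Fam}

theorem VComp.const (v : ℕ) : Γ.VComp fun _ => v := fun _ _ _ => Comp.const v

theorem VComp.add {f g : Γ.Idx → ℕ} (hf : Γ.VComp f) (hg : Γ.VComp g) :
    Γ.VComp fun a => f a + g a := fun α π m => (hf α π m).add (hg α π m)

theorem VComp.mul {f g : Γ.Idx → ℕ} (hf : Γ.VComp f) (hg : Γ.VComp g) :
    Γ.VComp fun a => f a * g a := fun α π m => (hf α π m).mul (hg α π m)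

/-- Polynomial factors of the time do not matter. -/
theorem Does.absorb {tm tm' f : Γ.Idx → ℕ} {Q : Γ.Idx → (ℕ → ℕ) → Prop} (h : Γ.Does tm Q)
    (hf : Γ.PolyB f) (ht : ∀ a, tm a ≤ f a * tm' a) : Γ.Does tm' Q := fun K loc hloc => by
  obtain ⟨p, C, hp⟩ := h K loc hloc
  obtain ⟨D, hD⟩ := hf
  refine ⟨p, C + D, fun a σ hσ => ?_⟩
  obtain ⟨t, τ, h1, h2, h3, h4⟩ := hp a σ hσ
  refine ⟨t, τ, h1.mono_word (word_mono (by omega) _), h2, h3, h4.trans ?_⟩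
  rw [pow_add, mul_assoc]
  exact Nat.mul_le_mul_left _ ((ht a).trans (Nat.mul_le_mul_right _ (hD a)))

end WordRAM.Fam

/-! ### The programs -/

namespace Red

open Sparsify WordRAM WordRAM.Fam

/-- Situations in which a large number `h` can be computed from the variables. -/
structure Base (Γ : Fam) (k : ℕ) (h : Γ.Idx → ℕ) : Prop where
  pos : 0 < k
  var : Γ.VComp h
  le : ∀ a, h a ≤ Γ.size a + 1
  good : ∀ a, Good k (h a)

variable {Γ : Fam} {k : ℕ} {h : Γ.Idx → ℕ}

namespace Base

theorem par (B : Base Γ k h) : Par Γ k h := ⟨B.pos, B.var.comp, B.le, B.good⟩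

theorem withMem (B : Base Γ k h) (Q : Γ.Idx → (ℕ → ℕ) → Prop) :
    Base (Γ.withMem Q) k fun p => h p.1.1 :=
  ⟨B.pos, B.var.withMem Q, fun p => B.le p.1.1, fun p => B.good p.1.1⟩

theorem memLoop (B : Base Γ k h) (b : Γ.Idx → ℕ) (Inv : Γ.Idx → ℕ → (ℕ → ℕ) → Prop) :
    Base (Γ.memLoop b Inv) k fun p => h p.1.1.1.1 :=
  ⟨B.pos, B.var.memLoop b Inv, fun p => B.le p.1.1.1.1, fun p => B.good p.1.1.1.1⟩

theorem vcomp (B : Base Γ k h) {f : ℕ → ℕ}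
    (H : ∀ (Γ' : Fam) (h' : Γ'.Idx → ℕ), Par Γ' k h' → Γ'.Comp fun a => f (h' a)) :
    Γ.VComp fun a => f (h a) := fun α π m =>
  H _ _ ⟨B.pos, B.var α π m, fun b => B.le (π b), fun b => B.good (π b)⟩

end Base

/-! #### The layout of the memory -/

/-- The address of the answer. -/
def ansAddr (k h : ℕ) : ℕ := 2 + numCodes k h * k

/-- The address of the result of a call. -/
def resAddr (k h : ℕ) : ℕ := ansAddr k h + 1

/-- The address of the tables. -/
def tabAddr (k h : ℕ) : ℕ := ansAddr k h + 2

/-- The end of the tables. -/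
def tabEnd (k h : ℕ) : ℕ := tabAddr k h + (numCodes k h + 1) * numCodes k h

/-- The amount of memory for a call. -/
def region (D h : ℕ) : ℕ := 2 ^ (D * (h + 1))

theorem comp_ansAddr (E : Par Γ k h) : Γ.Comp fun a => ansAddr k (h a) :=
  (Comp.const 2).add (E.comp_numCodes.mul (Comp.const k))

theorem comp_resAddr (E : Par Γ k h) : Γ.Comp fun a => resAddr k (h a) :=
  (comp_ansAddr E).add (Comp.const 1)

theorem comp_tabAddr (E : Par Γ k h) : Γ.Comp fun a => tabAddr k (h a) :=
  (comp_ansAddr E).add (Comp.const 2)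

theorem comp_region (E : Par Γ k h) (D : ℕ) : Γ.Comp fun a => region D (h a) :=
  Comp.pow (Comp.const 2) ((Comp.const D).mul (E.comp.add (Comp.const 1)))
    ((PolyB.const D).mul (E.poly.add (PolyB.const 1)))
    (ExpB.two_pow (C := 2 * D) fun a => by
      have := E.le a
      calc D * (h a + 1) ≤ D * (2 * (Γ.size a + 1)) := Nat.mul_le_mul_left _ (by omega)
        _ = _ := by ring)

/-! #### Tables -/

/-- Every step gets a table of its own, so table `s` stays intact while table `s + 1` is computed
from it. -/
theorem Does.tableStep (B : Base Γ k h) {g s : Γ.Idx → ℕ} (hg : Γ.VComp g) (hs : Γ.VComp s)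
    {F : Γ.Idx → Finset (Finset ℕ)} (hF : ∀ a, F a ⊆ sets (4 * h a) k)
    (hmem : ∀ a, ∀ κ < numCodes k (h a), Γ.mem a (tabAddr k (h a) + s a * numCodes k (h a) + κ) =
      ind (codeSet (4 * h a) k κ ∈ F a)) :
    Γ.Does (fun a => 2 * numCodes k (h a) + 1) fun a μ => μ = overwrite (Γ.mem a)
      (tabAddr k (h a) + (s a + 1) * numCodes k (h a)) (numCodes k (h a))
      fun κ => ind (codeSet (4 * h a) k κ ∈
        next (sel (thr (base k (h a))) (4 * h a) k) (F a) (bits k (h a) (g a) (s a))) := by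
  have hU := B.vcomp (f := numCodes k) fun _ _ E => E.comp_numCodes
  have ht := B.vcomp (f := tabAddr k) fun _ _ E => comp_tabAddr E
  have hx := ht.add (hs.mul hU)
  refine Does.fill (ht.add ((hs.add (VComp.const 1)).mul hU)) hU.comp ?_
  set b := fun a => numCodes k (h a)
  set Inv : Γ.Idx → ℕ → (ℕ → ℕ) → Prop := fun a i μ => μ = overwrite (Γ.mem a)
      (tabAddr k (h a) + (s a + 1) * numCodes k (h a)) i
      fun κ => ind (codeSet (4 * h a) k κ ∈
        next (sel (thr (base k (h a))) (4 * h a) k) (F a) (bits k (h a) (g a) (s a)))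
  have E : Table (Γ.memLoop b Inv) k (fun p => h p.1.1.1.1)
      (fun p => tabAddr k (h p.1.1.1.1) + s p.1.1.1.1 * numCodes k (h p.1.1.1.1))
      fun p => F p.1.1.1.1 :=
    { (B.memLoop b Inv).par with
      comp_pos := (hx.memLoop b Inv).comp
      subset := fun p => hF p.1.1.1.1
      mem := fun p κ hκ => by
        rw [show (Γ.memLoop b Inv).mem p = p.1.2 from rfl, show p.1.2 = _ from p.2,
          overwrite_of_not, hmem _ _ hκ]
        left
        rw [add_mul]
        omega }
  exact E.compP_next (hg.memLoop b Inv).comp (hs.memLoop b Inv).comp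
    (VComp.memLoop_var hU.comp.expB Inv).comp fun p => p.1.1.2

theorem Does.firstTable (B : Base Γ k h) {n : Γ.Idx → ℕ} {φ : ∀ a, KCNF k (n a)}
    (hn : ∀ a, n a ≤ 2 * h a)
    (hmem : ∀ a, ∀ z < ansAddr k (h a), Γ.mem a z = (φ a).encode.getD z 0) :
    Γ.Does (fun a => 2 * numCodes k (h a) + 1) fun a μ => μ = overwrite (Γ.mem a)
      (tabAddr k (h a)) (numCodes k (h a))
      fun κ => ind (codeSet (4 * h a) k κ ∈ formulaSets (φ a)) := by
  have hU := B.vcomp (f := numCodes k) fun _ _ E => E.comp_numCodes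
  have ht := B.vcomp (f := tabAddr k) fun _ _ E => comp_tabAddr E
  refine Does.fill ht hU.comp ?_
  refine compP_formula (B.memLoop _ _).par (n := fun p => n p.1.1.1.1) (φ := fun p => φ p.1.1.1.1)
    (fun p => hn _) (fun p z hz => ?_) (VComp.memLoop_var hU.comp.expB _).comp
  rw [← hmem _ z hz]
  refine (congrFun p.2 z).trans (overwrite_of_not (.inl ?_))
  change z < ansAddr _ _ at hz
  unfold tabAddr
  omega

theorem Does.tables (B : Base Γ k h) {n : Γ.Idx → ℕ} {φ : ∀ a, KCNF k (n a)}
    (hn : ∀ a, n a ≤ 2 * h a)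
    (hmem : ∀ a, ∀ z < ansAddr k (h a), Γ.mem a z = (φ a).encode.getD z 0)
    {g : Γ.Idx → ℕ} (hg : Γ.VComp g) : Γ.Does (fun _ => 1) fun a μ =>
      (∀ κ < numCodes k (h a), μ (tabAddr k (h a) + numCodes k (h a) * numCodes k (h a) + κ) =
        ind (codeSet (4 * h a) k κ ∈ final k (h a) (formulaSets (φ a)) (g a))) ∧
      ∀ z, z < tabAddr k (h a) ∨ tabEnd k (h a) ≤ z → μ z = Γ.mem a z := by
  have hU := B.vcomp (f := numCodes k) fun _ _ E => E.comp_numCodes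
  set Q : Γ.Idx → (ℕ → ℕ) → Prop := fun a μ => μ = overwrite (Γ.mem a)
      (tabAddr k (h a)) (numCodes k (h a))
      fun κ => ind (codeSet (4 * h a) k κ ∈ formulaSets (φ a))
  set b : (Γ.withMem Q).Idx → ℕ := fun p => numCodes k (h p.1.1) with hb
  set Inv : (Γ.withMem Q).Idx → ℕ → (ℕ → ℕ) → Prop := fun p s μ =>
    (∀ κ < numCodes k (h p.1.1),
      μ (tabAddr k (h p.1.1) + s * numCodes k (h p.1.1) + κ) =
        ind (codeSet (4 * h p.1.1) k κ ∈ fam k (h p.1.1) (formulaSets (φ p.1.1)) (g p.1.1) s)) ∧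
    ∀ z, z < tabAddr k (h p.1.1) ∨ tabEnd k (h p.1.1) ≤ z → μ z = Γ.mem p.1.1 z with hInv
  have h2 : (Γ.withMem Q).Does (fun p : (Γ.withMem Q).Idx =>
      b p * (2 * numCodes k (h p.1.1) + 1) + b p + 1) fun p μ => Inv p (b p) μ := by
    refine Does.forLoop (tm := fun p : (Γ.withMem Q).Idx => 2 * numCodes k (h p.1.1) + 1) (hU.withMem Q).comp Inv
      (fun p => ⟨fun κ hκ => ?_, fun z hz => ?_⟩) ?_
    · rw [show (Γ.withMem Q).mem p = p.1.2 from rfl, show p.1.2 = _ from p.2, zero_mul, add_zero,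
        overwrite_add hκ]
      rfl
    · rw [show (Γ.withMem Q).mem p = p.1.2 from rfl, show p.1.2 = _ from p.2, overwrite_of_not]
      unfold tabEnd at hz
      rw [add_mul, one_mul] at hz
      omega
    · refine Does.weaken (Does.tableStep (Γ := (Γ.withMem Q).memLoop b Inv)
        ((B.withMem Q).memLoop b Inv) ((hg.withMem Q).memLoop b Inv) (VComp.memLoop_var (hU.withMem Q).comp.expB Inv)
        (F := fun p : ((Γ.withMem Q).memLoop b Inv).Idx => fam k (h p.1.1.1.1.1.1) (formulaSets (φ p.1.1.1.1.1.1))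
          (g p.1.1.1.1.1.1) p.1.1.1.2)
        (fun p => fam_subset (B.good _) (formulaSets_subset B.pos (hn _) _) _ _)
        fun p => p.2.1) (fun p => le_rfl) fun p μ hμ => ⟨fun κ hκ => ?_, fun z hz => ?_⟩
      · rw [hμ, overwrite_add hκ]
        rfl
      · rw [hμ, overwrite_of_not, ← p.2.2 z hz]
        have hlt : p.1.1.1.2 + 1 ≤ numCodes k (h p.1.1.1.1.1.1) := p.1.1.2
        have := Nat.mul_le_mul_right (numCodes k (h p.1.1.1.1.1.1)) hlt
        unfold tabEnd at hz
        rw [add_mul, one_mul] at hz ⊢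
        rw [add_mul, one_mul] at this
        rcases hz with hz | hz
        · left; exact hz.trans_le (by omega)
        · right
          refine le_trans ?_ hz
          omega
  -- Constructing all tables takes time polynomial in `h`, which is absorbed into the implicit
  -- factor.
  refine Does.absorb (f := fun a => (2 * numCodes k (h a) + 1) + (numCodes k (h a) *
    (2 * numCodes k (h a) + 1) + numCodes k (h a) + 1))
    (Does.weaken (Does.seq (Does.firstTable B hn hmem)
      (tm₂ := fun a => numCodes k (h a) * (2 * numCodes k (h a) + 1) + numCodes k (h a) + 1) h2)
      (fun a => le_rfl) fun a μ hμ => ?_) ?_ fun a => by rw [mul_one]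
  · obtain ⟨ν, hν, h1⟩ := hμ
    exact h1
  · have hP := B.par.poly_numCodes
    have hP2 := ((PolyB.const 2).mul hP).add (PolyB.const 1)
    exact hP2.add (((hP.mul hP2).add hP).add (PolyB.const 1))

end Red

/-! ### The instances -/

theorem maxAbsIP_le_dim {N d : ℕ} (A B : Fin N → Fin d → ℤˣ) : maxAbsIP A B ≤ d := by
  refine Finset.sup_le fun p _ => ?_
  have h : |signedIP (A p.1) (B p.2)| ≤ d := by
    refine (Finset.abs_sum_le_sum_abs _ _).trans ?_
    refine (Finset.sum_le_card_nsmul _ _ 1 fun k _ => ?_).trans (by simp)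
    rcases Int.units_eq_one_or (A p.1 k) with h1 | h1 <;>
      rcases Int.units_eq_one_or (B p.2 k) with h2 | h2 <;> simp [h1, h2]
  rw [Int.abs_eq_natAbs] at h
  exact_mod_cast h

namespace Red

open Sparsify WordRAM WordRAM.Fam

variable {Γ : Fam} {k : ℕ} {h : Γ.Idx → ℕ}

/-- The length of an instance. -/
def instLen (h : ℕ) : ℕ := 2 + 2 * (2 ^ h * dim h)

/-- The `z`-th word of an instance. -/
noncomputable def instWord (k h : ℕ) (F : Finset (Finset ℕ)) (s z : ℕ) : ℕ :=
  if z = 0 then 2 ^ h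
  else if z = 1 then dim h
  else if z - 2 < 2 ^ h * dim h then
    if entA k h F ((z - 2) / dim h % 2 ^ h) ((z - 2) % dim h) % 2 = 0 then 1 else 0
  else
    if entB k h F s ((z - 2 - 2 ^ h * dim h) / dim h % 2 ^ h)
      ((z - 2 - 2 ^ h * dim h) % dim h) % 2 = 0 then 1 else 0

theorem getD_encode_vec (h : ℕ) (e : ℕ → ℕ → ℕ) {y : ℕ} (hy : y < 2 ^ h * dim h) :
    (encodeSigns fun α : Fin (2 ^ h) => SignVec.vec (dim h) (e α)).getD y 0 =
      if e (y / dim h % 2 ^ h) (y % dim h) % 2 = 0 then 1 else 0 := by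
  have hd : 0 < dim h := by unfold dim; positivity
  have h1 : y / dim h < 2 ^ h := (Nat.div_lt_iff_lt_mul hd).2 hy
  have h2 := getD_encodeSigns (fun α : Fin (2 ^ h) => SignVec.vec (dim h) (e α)) h1
    (Nat.mod_lt y hd)
  rw [mul_comm, Nat.div_add_mod] at h2
  rw [h2]
  simp only [SignVec.vec_eq_one_iff, Nat.mod_eq_of_lt h1]

theorem getD_encodeMaxIP (k h : ℕ) (F : Finset (Finset ℕ)) (s z : ℕ) :
    (encodeMaxIP (vecA k h F) (vecB k h F s)).getD z 0 =
      if z < instLen h then instWord k h F s z else 0 := by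
  have hA : (encodeSigns (vecA k h F)).length = 2 ^ h * dim h := length_encodeSigns _
  have hB : (encodeSigns (vecB k h F s)).length = 2 ^ h * dim h := length_encodeSigns _
  rcases z with _ | _ | y
  · rw [if_pos (by unfold instLen; omega)]
    rfl
  · rw [if_pos (by unfold instLen; omega)]
    rfl
  · have hw : instWord k h F s (y + 1 + 1) = if y < 2 ^ h * dim h then
        if entA k h F (y / dim h % 2 ^ h) (y % dim h) % 2 = 0 then 1 else 0
      else if entB k h F s ((y - 2 ^ h * dim h) / dim h % 2 ^ h)
        ((y - 2 ^ h * dim h) % dim h) % 2 = 0 then 1 else 0 := by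
      rw [instWord, if_neg (by omega), if_neg (by omega)]
      rfl
    unfold encodeMaxIP
    rw [List.getD_cons_succ, List.getD_cons_succ, hw]
    by_cases h1 : y < 2 ^ h * dim h
    · rw [if_pos (by unfold instLen; omega), if_pos h1, List.getD_append _ _ _ _ (by omega)]
      exact getD_encode_vec h (entA k h F) h1
    · rw [if_neg h1, List.getD_append_right _ _ _ _ (by omega), hA]
      by_cases h2 : y + 1 + 1 < instLen h
      · rw [if_pos h2]
        exact getD_encode_vec h (entB k h F s) (by unfold instLen at h2; omega)
      · rw [if_neg h2]
        exact List.getD_eq_default _ _ (by unfold instLen at h2; omega)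

theorem comp_instWord {x : Γ.Idx → ℕ} {F : Γ.Idx → Finset (Finset ℕ)} (E : Table Γ k h x F)
    {s z : Γ.Idx → ℕ} (hs : Γ.Comp s) (hz : Γ.Comp z) :
    Γ.Comp fun a => instWord k (h a) (F a) (s a) (z a) := by
  have hN := E.comp_two_pow
  have hd := E.comp_dim
  have h2 := hz.sub (Comp.const 2)
  have h3 := h2.sub (hN.mul hd)
  refine CompP.ite (CompP.eq hz (Comp.const 0)) hN (CompP.ite (CompP.eq hz (Comp.const 1)) hd
    (CompP.ite (CompP.lt h2 (hN.mul hd)) (CompP.ite (CompP.eq (Comp.mod ?_ (Comp.const 2))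
      (Comp.const 0)) (Comp.const 1) (Comp.const 0)) (CompP.ite (CompP.eq (Comp.mod ?_
      (Comp.const 2)) (Comp.const 0)) (Comp.const 1) (Comp.const 0))))
  · exact E.comp_entA ((h2.div hd).mod hN) (fun a => Nat.mod_lt _ (by positivity)) (h2.mod hd)
  · exact E.comp_entB hs ((h3.div hd).mod hN) (fun a => Nat.mod_lt _ (by positivity)) (h3.mod hd)

/-- The program `p` is good enough for the instances with `2 ^ h` vectors. -/
def Solver (p : Prog) (c : ℕ) (T : ℕ → ℕ) (h : ℕ) : Prop :=
  ∀ A B : Fin (2 ^ h) → Fin (dim h) → ℤˣ, Function.Injective A → Function.Injective B →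
    ∃ t out, Computes (c * (h + 1)) p (encodeMaxIP A B) t out ∧ t ≤ T h ∧ out ≤ maxAbsIP A B ∧
      ((4 * prm h) ^ reps h ≤ maxAbsIP A B → (8 * deg h) ^ reps h < out)

/-- There is enough space for the instances, and for the program. -/
def Layout (k c D : ℕ) : Prop :=
  ∀ h, Good k h → tabEnd k h ≤ region D h ∧ instLen h ≤ region D h ∧ 2 ^ (c * (h + 1)) ≤ region D h

/-- The number of the call. -/
noncomputable def callIdx (h g s : ℕ) : ℕ := g * numProof h + s

/-- Each call works in a region that has never been used and so is still zero behind the instance.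
Clearing a used region could cost more than the calls themselves; fresh ones only cost a constant
factor in the word length. -/
theorem Does.instance (B : Base Γ k h) {p : Prog} {c D : ℕ} {T : ℕ → ℕ} (hD : Layout k c D)
    (hp : ∀ a, Solver p c T (h a)) {g s : Γ.Idx → ℕ} (hg : Γ.VComp g) (hs : Γ.VComp s)
    {F : Γ.Idx → Finset (Finset ℕ)} (hF : ∀ a, F a ⊆ sets (4 * h a) k)
    (hmem : ∀ a, ∀ κ < numCodes k (h a),
      Γ.mem a (tabAddr k (h a) + numCodes k (h a) * numCodes k (h a) + κ) =
        ind (codeSet (4 * h a) k κ ∈ F a))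
    (hzero : ∀ a, ∀ z, (callIdx (h a) (g a) (s a) + 1) * region D (h a) ≤ z → Γ.mem a z = 0) :
    Γ.Does (fun a => 2 * instLen (h a) + 1 + (T (h a) + 1)) fun a μ =>
      μ (resAddr k (h a)) ≤ maxAbsIP (vecA k (h a) (F a)) (vecB k (h a) (F a) (s a)) ∧
      ((4 * prm (h a)) ^ reps (h a) ≤
          maxAbsIP (vecA k (h a) (F a)) (vecB k (h a) (F a) (s a)) →
        (8 * deg (h a)) ^ reps (h a) < μ (resAddr k (h a))) ∧
      ∀ z, z ≠ resAddr k (h a) → (z < (callIdx (h a) (g a) (s a) + 1) * region D (h a) ∨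
        (callIdx (h a) (g a) (s a) + 2) * region D (h a) ≤ z) → μ z = Γ.mem a z := by
  have hU := B.vcomp (f := numCodes k) fun _ _ E => E.comp_numCodes
  have ht := B.vcomp (f := tabAddr k) fun _ _ E => comp_tabAddr E
  have hr := B.vcomp (f := resAddr k) fun _ _ E => comp_resAddr E
  have hW := B.vcomp (f := region D) fun _ _ E => comp_region E D
  have hP := B.vcomp (f := numProof) fun _ _ E => E.comp_numProof
  have hL := B.vcomp (f := instLen) fun _ _ E =>
    (Comp.const 2).add ((Comp.const 2).mul (E.comp_two_pow.mul E.comp_dim))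
  have hbase : Γ.VComp fun a => (callIdx (h a) (g a) (s a) + 1) * region D (h a) :=
    (((hg.mul hP).add hs).add (VComp.const 1)).mul hW
  have hend : ∀ a, tabEnd k (h a) ≤ (callIdx (h a) (g a) (s a) + 1) * region D (h a) := fun a =>
    (hD _ (B.good a)).1.trans (Nat.le_mul_of_pos_left _ (Nat.succ_pos _))
  set x : Γ.Idx → ℕ := fun a => (callIdx (h a) (g a) (s a) + 1) * region D (h a) with hx
  set v : Γ.Idx → ℕ → ℕ := fun a z => instWord k (h a) (F a) (s a) z with hv
  set Inv : Γ.Idx → ℕ → (ℕ → ℕ) → Prop := fun a i μ => μ = overwrite (Γ.mem a) (x a) i (v a)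
    with hInv
  set b : Γ.Idx → ℕ := fun a => instLen (h a) with hb
  have E : Table (Γ.memLoop b Inv) k (fun p => h p.1.1.1.1)
      (fun p => tabAddr k (h p.1.1.1.1) + numCodes k (h p.1.1.1.1) * numCodes k (h p.1.1.1.1))
      fun p => F p.1.1.1.1 :=
    { (B.memLoop b Inv).par with
      comp_pos := ((ht.add (hU.mul hU)).memLoop b Inv).comp
      subset := fun p => hF p.1.1.1.1
      mem := fun p κ hκ => by
        rw [show (Γ.memLoop b Inv).mem p = p.1.2 from rfl, show p.1.2 = _ from p.2,
          overwrite_of_not, hmem _ _ hκ]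
        left
        refine lt_of_lt_of_le ?_ (hend _)
        unfold tabEnd
        rw [add_mul]
        omega }
  have h1 : Γ.Does (fun a => 2 * instLen (h a) + 1) fun a μ =>
      μ = overwrite (Γ.mem a) (x a) (b a) (v a) :=
    Does.fill hbase hL.comp (comp_instWord E (hs.memLoop b Inv).comp
      (VComp.memLoop_var hL.comp.expB Inv).comp)
  set Q : Γ.Idx → (ℕ → ℕ) → Prop := fun a μ => μ = overwrite (Γ.mem a) (x a) (b a) (v a)
  have h2 := Does.call (Γ := Γ.withMem Q) p (base := fun q => x q.1.1)
    (res := fun q => resAddr k (h q.1.1)) (tm := fun q => T (h q.1.1))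
    (wp := fun q => c * (h q.1.1 + 1))
    (inp := fun q => encodeMaxIP (vecA k (h q.1.1) (F q.1.1)) (vecB k (h q.1.1) (F q.1.1) (s q.1.1)))
    (Good := fun q out =>
      out ≤ maxAbsIP (vecA k (h q.1.1) (F q.1.1)) (vecB k (h q.1.1) (F q.1.1) (s q.1.1)) ∧
      ((4 * prm (h q.1.1)) ^ reps (h q.1.1) ≤
          maxAbsIP (vecA k (h q.1.1) (F q.1.1)) (vecB k (h q.1.1) (F q.1.1) (s q.1.1)) →
        (8 * deg (h q.1.1)) ^ reps (h q.1.1) < out))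
    (hbase.withMem Q).comp (hr.withMem Q).comp
    (((hbase.withMem Q).add (hW.withMem Q)).comp.expB.le fun q =>
      Nat.add_le_add_left (hD _ (B.good _)).2.2 _)
    (fun q y hy => ?_) (fun q => ?_)
  · refine Does.weaken (Does.seq h1 (tm₂ := fun a => T (h a) + 1) h2) (fun _ => le_rfl) ?_
    rintro a μ ⟨ν, hν, out, ⟨hg1, hg2⟩, rfl, hm⟩
    refine ⟨hg1, hg2, fun z hz1 hz2 => ?_⟩
    have h3 := (hD _ (B.good a)).2.2
    have h4 := (hD _ (B.good a)).2.1
    have h5 : (callIdx (h a) (g a) (s a) + 2) * region D (h a) = x a + region D (h a) := by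
      rw [hx]
      ring
    rw [h5] at hz2
    have h6 : x a = (callIdx (h a) (g a) (s a) + 1) * region D (h a) := rfl
    have h7 : b a = instLen (h a) := rfl
    rw [← h6] at hz2
    rw [hm z hz1 (by dsimp only; omega)]
    exact (congrFun hν z).trans (overwrite_of_not (by omega))
  · have hq : q.1.2 = _ := q.2
    change q.1.2 _ = _
    rw [hq, getD_encodeMaxIP]
    split_ifs with hlt
    · rw [overwrite_add hlt]
    · rw [overwrite_of_not (by right; dsimp only [b]; omega)]
      exact hzero _ _ (by dsimp only [x]; omega)
  · obtain ⟨t, out, h3, h4, h5⟩ := hp q.1.1 _ _ ((B.good q.1.1).vecA_injective (F q.1.1))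
      ((B.good q.1.1).vecB_injective (F q.1.1) (s q.1.1))
    exact ⟨t, out, h3, h4, h5⟩

end Red

/-! ### The loops -/

namespace Red

open Sparsify WordRAM WordRAM.Fam

variable {Γ : Fam} {k : ℕ} {h : Γ.Idx → ℕ}

/-- The vectors of the `i`-th call have a large inner product. -/
def Wins (k h : ℕ) (F₀ : Finset (Finset ℕ)) (i : ℕ) : Prop :=
  (4 * prm h) ^ reps h ≤ maxAbsIP (vecA k h (final k h F₀ (i / numProof h)))
    (vecB k h (final k h F₀ (i / numProof h)) (i % numProof h))

/-- The contents of the memory after `m` calls. -/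
structure Stage (k D h : ℕ) {n : ℕ} (φ : KCNF k n) (m : ℕ) (μ : ℕ → ℕ) : Prop where
  input : ∀ z < ansAddr k h, μ z = φ.encode.getD z 0
  zero : ∀ z, (m + 1) * region D h ≤ z → μ z = 0
  le_one : μ (ansAddr k h) ≤ 1
  sound : μ (ansAddr k h) = 1 → φ.Satisfiable
  complete : ∀ i < m, Wins k h (formulaSets φ) i → μ (ansAddr k h) = 1

/-- The answer is set to 1 if the result exceeds `(8 * deg h) ^ reps h`. By `maxAbsIP_le` this
happens only for satisfiable formulas, as the result is at most the optimum. -/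
theorem Does.round (B : Base Γ k h) {p : Prog} {c D : ℕ} {T : ℕ → ℕ} (hD : Layout k c D)
    (hp : ∀ a, Solver p c T (h a)) {n : Γ.Idx → ℕ} {φ : ∀ a, KCNF k (n a)}
    (hn : ∀ a, n a ≤ 2 * h a) {g s : Γ.Idx → ℕ} (hg : Γ.VComp g) (hs : Γ.VComp s)
    (hsb : ∀ a, s a < numProof (h a))
    (hmem : ∀ a, ∀ κ < numCodes k (h a),
      Γ.mem a (tabAddr k (h a) + numCodes k (h a) * numCodes k (h a) + κ) =
        ind (codeSet (4 * h a) k κ ∈ final k (h a) (formulaSets (φ a)) (g a)))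
    (hst : ∀ a, Stage k D (h a) (φ a) (callIdx (h a) (g a) (s a)) (Γ.mem a)) :
    Γ.Does (fun a => 2 * instLen (h a) + 1 + (T (h a) + 1) + 1) fun a μ =>
      Stage k D (h a) (φ a) (callIdx (h a) (g a) (s a) + 1) μ ∧
      ∀ z, tabAddr k (h a) ≤ z → z < tabEnd k (h a) → μ z = Γ.mem a z := by
  have hF : ∀ a, final k (h a) (formulaSets (φ a)) (g a) ⊆ sets (4 * h a) k := fun a =>
    fam_subset (B.good a) (formulaSets_subset B.pos (hn a) _) _ _
  have hA := B.vcomp (f := ansAddr k) fun _ _ E => comp_ansAddr E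
  have hr := B.vcomp (f := resAddr k) fun _ _ E => comp_resAddr E
  have hend : ∀ a, tabEnd k (h a) ≤ (callIdx (h a) (g a) (s a) + 1) * region D (h a) := fun a =>
    (hD _ (B.good a)).1.trans (Nat.le_mul_of_pos_left _ (Nat.succ_pos _))
  have htab : ∀ a, tabAddr k (h a) ≤ tabEnd k (h a) := fun a => Nat.le_add_right _ _
  have h1 := Does.instance B hD hp hg hs hF hmem fun a => (hst a).zero
  set Q : Γ.Idx → (ℕ → ℕ) → Prop := fun a μ =>
    μ (resAddr k (h a)) ≤ maxAbsIP (vecA k (h a) (final k (h a) (formulaSets (φ a)) (g a)))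
        (vecB k (h a) (final k (h a) (formulaSets (φ a)) (g a)) (s a)) ∧
      ((4 * prm (h a)) ^ reps (h a) ≤
          maxAbsIP (vecA k (h a) (final k (h a) (formulaSets (φ a)) (g a)))
            (vecB k (h a) (final k (h a) (formulaSets (φ a)) (g a)) (s a)) →
        (8 * deg (h a)) ^ reps (h a) < μ (resAddr k (h a))) ∧
      ∀ z, z ≠ resAddr k (h a) → (z < (callIdx (h a) (g a) (s a) + 1) * region D (h a) ∨
        (callIdx (h a) (g a) (s a) + 2) * region D (h a) ≤ z) → μ z = Γ.mem a z
  have hans : ∀ a μ, Q a μ → μ (ansAddr k (h a)) = Γ.mem a (ansAddr k (h a)) := fun a μ hQ => by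
    refine hQ.2.2 _ (by unfold resAddr; omega) (.inl ?_)
    have := hend a
    have := htab a
    unfold tabAddr at this
    omega
  have B' := (B.withMem Q).par
  have h2 : (Γ.withMem Q).Does (fun _ => 1) fun q μ => μ = Function.update q.1.2
      (ansAddr k (h q.1.1)) (if (8 * deg (h q.1.1)) ^ reps (h q.1.1) < q.1.2 (resAddr k (h q.1.1))
        then 1 else q.1.2 (ansAddr k (h q.1.1))) := by
    refine Does.store (hA.withMem Q).comp (CompP.ite (CompP.lt B'.comp_gap
      (Comp.load (hr.withMem Q).comp ?_)) (Comp.const 1) (Comp.load (hA.withMem Q).comp ?_))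
    -- The result of the call fits into a word, being at most the optimum and thus at most the
    -- dimension.
    · exact B'.expB fun q => (q.2.1.trans (maxAbsIP_le_dim _ _)).trans
        (B.good q.1.1).dim_le_two_pow
    · exact (ExpB.const 1).le fun q => (hans _ _ q.2).trans_le (hst q.1.1).le_one
  refine Does.weaken (Does.seq h1 (tm₂ := fun _ => 1) h2) (fun _ => le_rfl) ?_
  rintro a μ ⟨ν, hν, rfl⟩
  dsimp only
  have hreg := hend a
  have hta := htab a
  have hS := hst a
  have hν' := hans a ν hν
  obtain ⟨hν1, hν2, hν3⟩ := hν
  have hwin : (8 * deg (h a)) ^ reps (h a) < ν (resAddr k (h a)) → (φ a).Satisfiable := fun hlt => by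
    by_contra hcon
    exact absurd (hlt.trans_le (hν1.trans (maxAbsIP_le (B.good a) B.pos (hn a) hcon _ _)))
      (lt_irrefl _)
  have hout : ∀ z, z ≠ ansAddr k (h a) → ∀ v, Function.update ν (ansAddr k (h a)) v z = ν z :=
    fun z hz v => Function.update_of_ne hz _ _
  have hnext : (callIdx (h a) (g a) (s a) + 2) * region D (h a) =
      (callIdx (h a) (g a) (s a) + 1) * region D (h a) + region D (h a) := by ring
  unfold tabAddr at hta
  refine ⟨⟨fun z hz => ?_, fun z hz => ?_, ?_, ?_, fun i hi hw => ?_⟩, fun z hz1 hz2 => ?_⟩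
  · rw [hout _ hz.ne, hν3 z (by unfold resAddr; omega) (.inl (by omega)), hS.input z hz]
  · have hz' : (callIdx (h a) (g a) (s a) + 2) * region D (h a) ≤ z := hz
    rw [hout _ (by omega), hν3 z (by unfold resAddr; omega) (.inr hz'), hS.zero z (by omega)]
  · rw [Function.update_self]
    split_ifs
    · exact le_rfl
    · exact hν'.trans_le hS.le_one
  · rw [Function.update_self]
    split_ifs with hlt
    · exact fun _ => hwin hlt
    · exact fun h1 => hS.sound (hν'.symm.trans h1)
  · rw [Function.update_self]
    split_ifs with hlt
    · rfl
    · rcases Nat.lt_succ_iff_lt_or_eq.1 hi with hi | rfl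
      · exact hν'.trans (hS.complete i hi hw)
      · refine absurd (hν2 ?_) hlt
        have hpos : 0 < numProof (h a) := (Nat.zero_le _).trans_lt (hsb a)
        have e1 : callIdx (h a) (g a) (s a) / numProof (h a) = g a := by
          rw [callIdx, mul_comm, Nat.mul_add_div hpos, Nat.div_eq_of_lt (hsb a), add_zero]
        have e2 : callIdx (h a) (g a) (s a) % numProof (h a) = s a := by
          rw [callIdx, mul_comm, Nat.mul_add_mod, Nat.mod_eq_of_lt (hsb a)]
        rwa [Wins, e1, e2] at hw
  · unfold tabAddr at hz1
    rw [hout _ (by omega), hν3 z (by unfold resAddr; omega) (.inl (by omega))]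

/-- The time for all calls with the same sparse formula. -/
noncomputable def guessTime (T : ℕ → ℕ) (h : ℕ) : ℕ :=
  1 + (numProof h * (2 * instLen h + 1 + (T h + 1) + 1) + numProof h + 1)

/-- The tables occupy cells that `Stage` does not mention, so rebuilding them for a new guess keeps
the stage. The calls are numbered consecutively across guesses, and no region is used twice. -/
theorem Does.guess (B : Base Γ k h) {p : Prog} {c D : ℕ} {T : ℕ → ℕ} (hD : Layout k c D)
    (hp : ∀ a, Solver p c T (h a)) {n : Γ.Idx → ℕ} {φ : ∀ a, KCNF k (n a)}
    (hn : ∀ a, n a ≤ 2 * h a) {g : Γ.Idx → ℕ} (hg : Γ.VComp g)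
    (hst : ∀ a, Stage k D (h a) (φ a) (g a * numProof (h a)) (Γ.mem a)) :
    Γ.Does (fun a => guessTime T (h a)) fun a μ =>
      Stage k D (h a) (φ a) ((g a + 1) * numProof (h a)) μ := by
  have hP := B.vcomp (f := numProof) fun _ _ E => E.comp_numProof
  have h1 := Does.tables B hn (fun a => (hst a).input) hg
  set Q : Γ.Idx → (ℕ → ℕ) → Prop := fun a μ =>
      (∀ κ < numCodes k (h a), μ (tabAddr k (h a) + numCodes k (h a) * numCodes k (h a) + κ) =
        ind (codeSet (4 * h a) k κ ∈ final k (h a) (formulaSets (φ a)) (g a))) ∧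
      ∀ z, z < tabAddr k (h a) ∨ tabEnd k (h a) ≤ z → μ z = Γ.mem a z
  set b : (Γ.withMem Q).Idx → ℕ := fun q => numProof (h q.1.1) with hb
  set Inv : (Γ.withMem Q).Idx → ℕ → (ℕ → ℕ) → Prop := fun q s μ =>
    (∀ κ < numCodes k (h q.1.1),
      μ (tabAddr k (h q.1.1) + numCodes k (h q.1.1) * numCodes k (h q.1.1) + κ) =
        ind (codeSet (4 * h q.1.1) k κ ∈ final k (h q.1.1) (formulaSets (φ q.1.1)) (g q.1.1))) ∧
      Stage k D (h q.1.1) (φ q.1.1) (callIdx (h q.1.1) (g q.1.1) s) μ with hInv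
  have h2 : (Γ.withMem Q).Does (fun q : (Γ.withMem Q).Idx =>
      b q * (2 * instLen (h q.1.1) + 1 + (T (h q.1.1) + 1) + 1) + b q + 1)
      fun q μ => Inv q (b q) μ := by
    refine Does.forLoop
      (tm := fun q : (Γ.withMem Q).Idx => 2 * instLen (h q.1.1) + 1 + (T (h q.1.1) + 1) + 1)
      (hP.withMem Q).comp Inv (fun q => ⟨q.2.1, ?_⟩) ?_
    · have hS := hst q.1.1
      have hans : q.1.2 (ansAddr k (h q.1.1)) = Γ.mem q.1.1 (ansAddr k (h q.1.1)) :=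
        q.2.2 _ (.inl (by unfold tabAddr; omega))
      refine ⟨fun z hz => ?_, fun z hz => ?_, ?_, ?_, ?_⟩
      · rw [← hS.input z hz]
        exact q.2.2 z (.inl (by unfold tabAddr; omega))
      · rw [← hS.zero z hz]
        refine q.2.2 z (.inr (le_trans ?_ hz))
        exact (hD _ (B.good _)).1.trans (Nat.le_mul_of_pos_left _ (Nat.succ_pos _))
      · exact hans.trans_le hS.le_one
      · exact fun h1 => hS.sound (hans.symm.trans h1)
      · exact fun i hi hw => hans.trans (hS.complete i hi hw)
    · refine Does.weaken (Does.round (Γ := (Γ.withMem Q).memLoop b Inv)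
        ((B.withMem Q).memLoop b Inv) hD (fun q => hp _) (φ := fun q => φ q.1.1.1.1.1.1)
        (fun q => hn _) ((hg.withMem Q).memLoop b Inv)
        (VComp.memLoop_var (hP.withMem Q).comp.expB Inv) (fun q => q.1.1.2) (fun q => q.2.1)
        fun q => q.2.2) (fun _ => le_rfl) fun q μ hμ => ⟨fun κ hκ => ?_, hμ.1⟩
      refine (hμ.2 _ (by rw [add_assoc]; exact Nat.le_add_right _ _) ?_).trans (q.2.1 κ hκ)
      unfold tabEnd
      rw [add_mul]
      omega
  refine Does.weaken (Does.seq h1 (tm₂ := fun a => numProof (h a) *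
    (2 * instLen (h a) + 1 + (T (h a) + 1) + 1) + numProof (h a) + 1) h2) (fun _ => le_rfl) ?_
  rintro a μ ⟨ν, hν, -, h3⟩
  rwa [add_mul, one_mul]

theorem Does.allGuesses (B : Base Γ k h) {p : Prog} {c D : ℕ} {T : ℕ → ℕ} (hD : Layout k c D)
    (hp : ∀ a, Solver p c T (h a)) {n : Γ.Idx → ℕ} {φ : ∀ a, KCNF k (n a)}
    (hn : ∀ a, n a ≤ 2 * h a) (hmem : ∀ a z, Γ.mem a z = (φ a).encode.getD z 0) :
    Γ.Does (fun a => numGuess k (h a) * guessTime T (h a) + numGuess k (h a) + 1) fun a μ =>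
      μ (ansAddr k (h a)) = ind (φ a).Satisfiable := by
  have hG := B.vcomp (f := numGuess k) fun _ _ E => E.comp_numGuess
  set Inv : Γ.Idx → ℕ → (ℕ → ℕ) → Prop := fun a g μ =>
    Stage k D (h a) (φ a) (g * numProof (h a)) μ with hInv
  refine Does.weaken (Does.forLoop (tm := fun a => guessTime T (h a)) hG.comp Inv (fun a => ?_)
    (Does.guess (Γ := Γ.memLoop (fun a => numGuess k (h a)) Inv) (B.memLoop _ Inv) hD
      (fun q => hp _) (φ := fun q => φ q.1.1.1.1) (fun q => hn _)
      (VComp.memLoop_var hG.comp.expB Inv) fun q => q.2)) (fun _ => le_rfl) fun a μ hμ => ?_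
  · have hlen : ∀ z, ansAddr k (h a) ≤ z → Γ.mem a z = 0 := fun z hz => by
      rw [hmem, KCNF.getD_encode_of_le]
      refine le_trans ?_ hz
      have : (2 * n a) ^ k ≤ numCodes k (h a) := Nat.pow_le_pow_left (by have := hn a; omega) _
      exact Nat.add_le_add_left (Nat.mul_le_mul_right _ this) _
    have h0 := hlen _ le_rfl
    refine ⟨fun z _ => hmem a z, fun z hz => hlen z ?_, by omega, by omega, by
      rw [zero_mul]; exact fun i hi => absurd hi (Nat.not_lt_zero i)⟩
    have h1 := (hD _ (B.good a)).1
    rw [zero_mul, zero_add, one_mul] at hz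
    unfold tabEnd tabAddr at h1
    omega
  · have hμ' : Stage k D (h a) (φ a) (numGuess k (h a) * numProof (h a)) μ := hμ
    by_cases hsat : (φ a).Satisfiable
    · rw [ind_of hsat]
      obtain ⟨g, hg, s, hs, hw⟩ := exists_le_maxAbsIP (B.good a) B.pos (hn a) hsat
      have hpos : 0 < numProof (h a) := (Nat.zero_le _).trans_lt hs
      refine hμ'.complete (callIdx (h a) g s) ?_ ?_
      · calc callIdx (h a) g s < (g + 1) * numProof (h a) := by
              rw [callIdx, add_mul, one_mul]; omega
          _ ≤ _ := Nat.mul_le_mul_right _ hg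
      · have e1 : callIdx (h a) g s / numProof (h a) = g := by
          rw [callIdx, mul_comm, Nat.mul_add_div hpos, Nat.div_eq_of_lt hs, add_zero]
        have e2 : callIdx (h a) g s % numProof (h a) = s := by
          rw [callIdx, mul_comm, Nat.mul_add_mod, Nat.mod_eq_of_lt hs]
        rwa [Wins, e1, e2]
    · rw [ind_of_not hsat]
      have h1 := hμ'.le_one
      have h2 : μ (ansAddr k (h a)) ≠ 1 := fun h1 => hsat (hμ'.sound h1)
      omega

end Red

/-! ### The algorithm for satisfiability -/

namespace Red

open Sparsify WordRAM WordRAM.Fam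

variable {Γ : Fam} {k : ℕ} {h : Γ.Idx → ℕ}

theorem exists_layout (k c : ℕ) : ∃ D, Layout k c D := by
  -- An auxiliary family indexed by `h`, which makes the rules for `PolyB` and `ExpB` available.
  set Γ : Fam := ⟨ℕ, id, 0, fun _ _ => 0, fun _ _ => 0⟩
  have hU : Γ.PolyB fun h : ℕ => numCodes k h := ((PolyB.const 4).mul (PolyB.size (Γ := Γ))).pow k
  have hT : Γ.PolyB fun h : ℕ => tabEnd k h := (((PolyB.const 2).add (hU.mul
    (PolyB.const k))).add (PolyB.const 2)).add ((hU.add (PolyB.const 1)).mul hU)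
  obtain ⟨C, hC⟩ := hT.expB
  refine ⟨C + c + 2, fun h hg => ⟨?_, ?_, ?_⟩⟩
  · exact (hC h).le.trans (Nat.pow_le_pow_right two_pos (word_mono (by omega) _))
  · calc instLen h ≤ 2 + 2 * (2 ^ h * 2 ^ h) := by
          unfold instLen
          have := hg.dim_le_two_pow
          gcongr
      _ ≤ 2 ^ (2 * (h + 1)) := by
          have h2 : 2 ^ (2 * (h + 1)) = 4 * (2 ^ h * 2 ^ h) := by ring
          have h1 : 1 ≤ 2 ^ h := Nat.one_le_two_pow
          nlinarith
      _ ≤ _ := Nat.pow_le_pow_right two_pos (word_mono (by omega) _)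
  · exact Nat.pow_le_pow_right two_pos (word_mono (by omega) _)

theorem satisfiable_iff_exists_lt {n : ℕ} (φ : KCNF k n) : φ.Satisfiable ↔
    ∃ α < 2 ^ n, ∀ i < φ.clauses.length, ∃ j < k, α / 2 ^ (φ.encode.getD (2 + (i * k + j)) 0 / 2) % 2 =
      φ.encode.getD (2 + (i * k + j)) 0 % 2 := by
  have e1 : ∀ (x : ℕ) (b : Bool), (2 * x + b.toNat) / 2 = x := fun x b => by
    have := b.toNat_lt
    omega
  have e2 : ∀ (x : ℕ) (b : Bool), (2 * x + b.toNat) % 2 = b.toNat := fun x b => by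
    have := b.toNat_lt
    omega
  constructor
  · rintro ⟨x, hx⟩
    obtain ⟨α, hα, hd⟩ := exists_digits 2 n
      (fun i => if hi : i < n then (x ⟨i, hi⟩).toNat else 0) fun i _ => by
        split_ifs
        exact Bool.toNat_lt _
    refine ⟨α, hα, fun i hi => ?_⟩
    obtain ⟨j, hj⟩ := hx _ (List.getElem_mem hi)
    refine ⟨j, j.2, ?_⟩
    rw [φ.getD_encode hi j.2, e1, e2, hd _ (Fin.is_lt _), dif_pos (Fin.is_lt _)]
    exact congrArg Bool.toNat hj
  · rintro ⟨α, -, H⟩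
    refine ⟨fun i => decide (α / 2 ^ (i : ℕ) % 2 = 1), fun C hC => ?_⟩
    obtain ⟨i, hi, rfl⟩ := List.getElem_of_mem hC
    obtain ⟨j, hj, he⟩ := H i hi
    rw [φ.getD_encode hi hj, e1, e2] at he
    refine ⟨⟨j, hj⟩, ?_⟩
    beta_reduce
    change decide (α / 2 ^ ((φ.clauses.get ⟨i, hi⟩ ⟨j, hj⟩).1 : ℕ) % 2 = 1) =
      (φ.clauses.get ⟨i, hi⟩ ⟨j, hj⟩).2
    rw [he]
    cases (φ.clauses.get ⟨i, hi⟩ ⟨j, hj⟩).2 <;> rfl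

/-- Brute force over all assignments, for the finitely many `n` that are too small for the
reduction. All loop bounds are constants that depend on `m` and `k`. -/
theorem compP_satisfiable {n : Γ.Idx → ℕ} {φ : ∀ a, KCNF k (n a)} {m : ℕ}
    (hn : Γ.Comp n) (hnm : ∀ a, n a < m) (hmem : ∀ a z, Γ.mem a z = (φ a).encode.getD z 0) :
    Γ.CompP fun a => (φ a).Satisfiable := by
  have hm1 : ∀ a, Γ.mem a 1 = (φ a).clauses.length := fun a => by rw [hmem]; rfl
  have hlen : ∀ a, Γ.mem a 1 ≤ (2 * m) ^ k := fun a => by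
    rw [hm1]
    exact (φ a).length_le.trans (Nat.pow_le_pow_left (by have := hnm a; omega) _)
  have hl : Γ.Comp fun a => Γ.mem a 1 := Comp.load (Comp.const 1) ((ExpB.const ((2 * m) ^ k)).le hlen)
  have hlit : ∀ a, ∀ i < Γ.mem a 1, ∀ j < k, Γ.mem a (2 + (i * k + j)) < 2 * m :=
    fun a i hi j hj => by
      rw [hmem, (φ a).getD_encode (hm1 a ▸ hi) hj]
      have h4 := ((φ a).clauses.get ⟨i, hm1 a ▸ hi⟩ ⟨j, hj⟩).1.2
      have h5 := ((φ a).clauses.get ⟨i, hm1 a ▸ hi⟩ ⟨j, hj⟩).2.toNat_lt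
      have h6 := hnm a
      omega
  have h2n : ∀ a, 2 ^ n a ≤ 2 ^ m := fun a => Nat.pow_le_pow_right two_pos (hnm a).le
  have hN : Γ.Comp fun a => 2 ^ n a := Comp.pow (Comp.const 2) hn
    ((PolyB.const m).le fun a => (hnm a).le) ((ExpB.const (2 ^ m)).le h2n)
  have hα := Comp.loop_var hN.expB
  have hi := Comp.loop_var (hl.lift fun a => 2 ^ n a).expB
  set Γ' := ((Γ.loop fun a => 2 ^ n a).loop fun p => Γ.mem p.1.1 1).loop fun _ => k
  have hj : Γ'.Comp fun q => q.1.2 := Comp.loop_var (ExpB.const k)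
  have hL : ∀ q : Γ'.Idx,
      Γ.mem q.1.1.1.1.1.1 (2 + (q.1.1.1.2 * k + q.1.2)) < 2 * m := fun q =>
    hlit _ _ q.1.1.2 _ q.2
  have hcell : Γ'.Comp fun q => Γ.mem q.1.1.1.1.1.1 (2 + (q.1.1.1.2 * k + q.1.2)) :=
    Comp.load ((Comp.const 2).add (((hi.lift _).mul (Comp.const k)).add hj))
      ((ExpB.const (2 * m)).le fun q => (hL q).le)
  have hexp : ∀ q : Γ'.Idx, Γ.mem q.1.1.1.1.1.1 (2 + (q.1.1.1.2 * k + q.1.2)) / 2 ≤ m := fun q => by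
    have := hL q
    omega
  refine (CompP.bex hN ((PolyB.const (2 ^ m)).le h2n) (P := fun a α => ∀ i < Γ.mem a 1, ∃ j < k,
    α / 2 ^ (Γ.mem a (2 + (i * k + j)) / 2) % 2 = Γ.mem a (2 + (i * k + j)) % 2)
    (CompP.ball (hl.lift _) ((PolyB.const ((2 * m) ^ k)).le fun p => hlen p.1.1)
      (P := fun p i => ∃ j < k, p.1.2 / 2 ^ (Γ.mem p.1.1 (2 + (i * k + j)) / 2) % 2 =
        Γ.mem p.1.1 (2 + (i * k + j)) % 2)
      (CompP.bex (Γ := (Γ.loop fun a => 2 ^ n a).loop fun p => Γ.mem p.1.1 1) (Comp.const k)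
        (PolyB.const k) (CompP.eq ((((hα.lift _).lift _).div (Comp.pow (Comp.const 2)
          (hcell.div (Comp.const 2)) ((PolyB.const m).le hexp) ((ExpB.const (2 ^ m)).le fun q =>
            Nat.pow_le_pow_right two_pos (hexp q)))).mod (Comp.const 2))
          (hcell.mod (Comp.const 2)))))).congr fun a => ?_
  rw [satisfiable_iff_exists_lt]
  simp only [hm1, hmem]

/-- Half of the number of variables. -/
def half (n : ℕ) : ℕ := (n + 1) / 2

/-- The time of the algorithm, up to a polynomial factor. -/
noncomputable def satTime (k : ℕ) (T : ℕ → ℕ) (n : ℕ) : ℕ :=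
  numGuess k (half n) * guessTime T (half n) + numGuess k (half n) + 2

/-- Brute force for `n < 2 * h₀`, and the reduction otherwise. Both branches leave the answer in
cell `0`, from where it is loaded into the output register. -/
theorem exists_satProg {p : Prog} {c h₀ : ℕ} {T : ℕ → ℕ} (hk : 0 < k)
    (hgood : ∀ h, h₀ ≤ h → Good k h) (hp : ∀ h, h₀ ≤ h → Solver p c T h) :
    ∃ q C, ∀ n (φ : KCNF k n), ∃ t, Computes (C * (n + 1)) q φ.encode t (ind φ.Satisfiable) ∧
      t ≤ (n + 2) ^ C * (satTime k T n + 1) := by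
  obtain ⟨D, hD⟩ := exists_layout k c
  set Γ₀ : Fam := ⟨Σ n, KCNF k n, fun a => a.1, 0, fun _ _ => 0, fun a z => a.2.encode.getD z 0⟩
    with hΓ₀
  set n : Γ₀.Idx → ℕ := fun a => a.1 with hn
  have hnE : Γ₀.ExpB n := (PolyB.size (Γ := Γ₀)).expB
  have hn0 : Γ₀.Comp n := Comp.load (Γ := Γ₀) (Comp.const 0) hnE
  set Q : Γ₀.Idx → (ℕ → ℕ) → Prop := fun a μ => μ 0 = ind a.2.Satisfiable with hQ
  have hv : (Γ₀.push n).VComp n := VComp.push_var hnE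
  have key : Γ₀.Does (fun a => satTime k T (n a)) Q := by
    refine Does.letVar hn0 (fun a => by unfold satTime; omega)
      (Does.cond (Γ := Γ₀.push n) (c := fun a : Γ₀.Idx => ind (n a < 2 * h₀)) (CompP.lt hv.comp (Comp.const (2 * h₀)))
        (fun a => by unfold satTime; omega) ?_ ?_)
    · refine Does.weaken (Does.store (Comp.const 0) (compP_satisfiable (m := 2 * h₀)
        (n := fun a : {a : Γ₀.Idx // ind (n a < 2 * h₀) ≠ 0} => n a.1)
        (φ := fun a : {a : Γ₀.Idx // ind (n a < 2 * h₀) ≠ 0} => a.1.2) (hv.comp.pull _)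
        (fun a => ind_ne_zero.1 a.2) fun a z => rfl)) (fun a => by unfold satTime; omega) ?_
      intro a μ hμ
      rw [hQ, hμ]
      exact Function.update_self _ _ _
    · set Γ := (Γ₀.push n).pull fun a : {a : Γ₀.Idx // ind (n a < 2 * h₀) = 0} => a.1 with hΓ
      have hlt : ∀ a : Γ.Idx, h₀ ≤ half (n a.1) := fun a => by
        have := ind_eq_zero.1 a.2
        unfold half
        omega
      have B : Base Γ k fun a => half (n a.1) :=
        ⟨hk, fun α π m => ((hv.pull _ α π m).add (Comp.const 1)).div (Comp.const 2),
          fun a => by change (n a.1 + 1) / 2 ≤ n a.1 + 1; omega, fun a => hgood _ (hlt a)⟩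
      have h1 := Does.allGuesses B hD (fun a => hp _ (hlt a)) (n := fun a => n a.1)
        (φ := fun a => a.1.2) (fun a => by unfold half; omega) fun a z => rfl
      have hA := B.vcomp (f := ansAddr k) fun _ _ E => comp_ansAddr E
      refine Does.weaken (Does.seq h1 (tm₂ := fun _ => 1) (Does.store (Comp.const 0)
        (Comp.load (hA.withMem _).comp ((ExpB.const 1).le fun q => ?_)))) (fun a => le_rfl) ?_
      · exact (show q.1.2 (ansAddr k (half (n q.1.1.1))) = _ from q.2).trans_le (ind_le_one _)
      · rintro a μ ⟨ν, hν, rfl⟩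
        exact (Function.update_self _ _ _).trans hν
  obtain ⟨q, C, hq⟩ := Does.computes rfl key (f := fun a : Γ₀.Idx => ind a.2.Satisfiable)
    (g := fun r : (Γ₀.withMem Q).Idx => r.1.2 0) (Comp.load (Comp.const 0) ((ExpB.const 1).le fun r =>
      (show r.1.2 0 = _ from r.2).trans_le (ind_le_one _))) fun r => r.2
  refine ⟨q, C, fun n' φ => ?_⟩
  obtain ⟨t, τ, h1, h2, h3⟩ := hq ⟨n', φ⟩ (initState φ.encode) rfl
  exact ⟨t, ⟨τ, h1, h2⟩, h3⟩

end Red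

/-! ### The running time -/

namespace Red

open WordRAM

/-- An `M`-th root; it converts the bounds for all powers into `2 ^ (θ * h)` with small `θ`. -/
theorem le_rpow_of_pow_le {X h M : ℕ} (hM : 0 < M) (hX : X ^ M ≤ 2 ^ h) {θ : ℝ}
    (hθ : 1 ≤ M * θ) : (X : ℝ) ≤ 2 ^ (θ * h) := by
  have h1 : (X : ℝ) ^ M ≤ 2 ^ h := by exact_mod_cast hX
  refine le_of_pow_le_pow_left₀ hM.ne' (by positivity) (h1.trans ?_)
  rw [← Real.rpow_natCast _ M, ← Real.rpow_mul (by norm_num), ← Real.rpow_natCast]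
  refine Real.rpow_le_rpow_of_exponent_le (by norm_num) ?_
  have : (0 : ℝ) ≤ h := Nat.cast_nonneg h
  nlinarith

theorem eventually_pow_poly_le (C M : ℕ) : ∀ᶠ h in atTop, ((2 * h + 2) ^ C) ^ M ≤ 2 ^ h := by
  filter_upwards [eventually_pow_le_two_pow (2 * (C * M)), eventually_ge_atTop 4] with h h1 h2
  calc ((2 * h + 2) ^ C) ^ M = (2 * h + 2) ^ (C * M) := by rw [pow_mul]
    _ ≤ (h ^ 2) ^ (C * M) := Nat.pow_le_pow_left (by nlinarith) _
    _ = h ^ (2 * (C * M)) := by rw [← pow_mul]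
    _ ≤ _ := h1

theorem satTime_le {k : ℕ} {T : ℕ → ℕ} {n : ℕ} (hP : 1 ≤ numProof (half n)) :
    satTime k T n + 1 ≤ numGuess k (half n) * (numProof (half n) *
      (dim (half n) * (20 * 2 ^ half n + T (half n)))) := by
  unfold satTime guessTime instLen
  generalize hh : half n = h at *
  have hG : 1 ≤ numGuess k h := Nat.one_le_pow _ _ (Nat.succ_pos _)
  have hd : 1 ≤ dim h := Nat.one_le_two_pow
  have hN : 1 ≤ 2 ^ h := Nat.one_le_two_pow
  generalize numGuess k h = G at *
  generalize numProof h = P at *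
  generalize dim h = d at *
  generalize 2 ^ h = N at *
  generalize T h = t
  have i1 : 1 ≤ N * d := Nat.mul_pos hN hd
  have i2 : t ≤ d * t := Nat.le_mul_of_pos_left _ hd
  have i3 : 2 * (2 + 2 * (N * d)) + 1 + (t + 1) + 1 ≤ 11 * (N * d) + d * t := by omega
  have i4 : P * (2 * (2 + 2 * (N * d)) + 1 + (t + 1) + 1) ≤ P * (11 * (N * d) + d * t) :=
    Nat.mul_le_mul_left _ i3
  have i5 : P ≤ P * (N * d) := Nat.le_mul_of_pos_right _ i1
  have i6 : 1 + (P * (2 * (2 + 2 * (N * d)) + 1 + (t + 1) + 1) + P + 1) ≤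
      P * (14 * (N * d) + d * t) := by
    have e1 : P * (14 * (N * d) + d * t) = P * (11 * (N * d) + d * t) + 3 * (P * (N * d)) := by ring
    omega
  have i7 := Nat.mul_le_mul_left G i6
  have i8 : G ≤ G * (P * (N * d)) := Nat.le_mul_of_pos_right _ (Nat.mul_pos hP i1)
  have e2 : G * (P * (d * (20 * N + t))) =
      G * (P * (14 * (N * d) + d * t)) + 6 * (G * (P * (N * d))) := by ring
  omega

/-- Four overheads, namely the polynomial factor, the guesses, Merlin's polynomials and the
dimension, are at most `2 ^ (ε / 8 * h)` each. Together with `2 ^ ((2 - ε) * h)` they give `2 ^ ((2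
- ε / 2) * h)`, and `h ≤ (n + 1) / 2`. -/
theorem exists_time_le (k C : ℕ) {ε K : ℝ} (hε : 0 < ε) (hε1 : ε ≤ 1) (hK : 0 ≤ K) {T : ℕ → ℕ}
    (hT : ∀ h, (T h : ℝ) ≤ K * ((2 ^ h : ℕ) : ℝ) ^ (2 - ε)) :
    ∃ K' : ℝ, ∀ n : ℕ, (((n + 2) ^ C * (satTime k T n + 1) : ℕ) : ℝ) ≤
      K' * 2 ^ ((1 - ε / 4) * (n : ℝ)) := by
  obtain ⟨M, hM⟩ := exists_nat_ge (8 / ε)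
  have hMε : 1 ≤ M * (ε / 8) := by
    rw [div_le_iff₀ hε] at hM
    linarith
  have hM0 : 0 < M := by
    rcases Nat.eq_zero_or_pos M with rfl | hM'
    · norm_num at hMε
    · exact hM'
  have hev := ((eventually_good k).and ((numProof_pow_le M).and ((numGuess_pow_le k M).and
    ((dim_pow_le M).and (eventually_pow_poly_le C M)))))
  obtain ⟨h₁, hh₁⟩ := eventually_atTop.1 hev
  set f : ℕ → ℕ := fun n => (n + 2) ^ C * (satTime k T n + 1) with hf
  -- Takes care of the finitely many small `n`.
  set K₀ : ℝ := ∑ n ∈ Finset.range (2 * h₁), (f n : ℝ)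
  have hK₀ : 0 ≤ K₀ := Finset.sum_nonneg fun _ _ => Nat.cast_nonneg _
  refine ⟨K₀ + 2 * (20 + K), fun n => ?_⟩
  have hexp : 0 ≤ (1 - ε / 4) * (n : ℝ) := mul_nonneg (by linarith) (Nat.cast_nonneg n)
  by_cases hn : n < 2 * h₁
  · have h1 : (f n : ℝ) ≤ K₀ := Finset.single_le_sum (f := fun n => (f n : ℝ))
      (fun _ _ => Nat.cast_nonneg _) (Finset.mem_range.2 hn)
    have h2 : (1 : ℝ) ≤ 2 ^ ((1 - ε / 4) * (n : ℝ)) := Real.one_le_rpow (by norm_num) hexp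
    calc (f n : ℝ) ≤ K₀ + 2 * (20 + K) := by linarith
      _ ≤ _ := le_mul_of_one_le_right (by linarith) h2
  · obtain ⟨hg, hP, hG, hd, hC⟩ := hh₁ (half n) (by unfold half; omega)
    have hprf : 1 ≤ numProof (half n) := Nat.one_le_pow _ _ hg.prm_pos
    have h1 : f n ≤ (2 * half n + 2) ^ C * (numGuess k (half n) * (numProof (half n) *
        (dim (half n) * (20 * 2 ^ half n + T (half n))))) :=
      Nat.mul_le_mul (Nat.pow_le_pow_left (by unfold half; omega) _) (satTime_le hprf)
    have hhn : ((half n : ℕ) : ℝ) ≤ ((n : ℝ) + 1) / 2 := by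
      rw [le_div_iff₀ (by norm_num)]
      exact_mod_cast Nat.div_mul_le_self (n + 1) 2
    generalize half n = h at *
    have e1 := le_rpow_of_pow_le hM0 hC hMε
    have e2 := le_rpow_of_pow_le hM0 hG hMε
    have e3 := le_rpow_of_pow_le hM0 hP hMε
    have e4 := le_rpow_of_pow_le hM0 hd hMε
    have e5 : (20 : ℝ) * 2 ^ h + T h ≤ (20 + K) * 2 ^ ((2 - ε) * (h : ℝ)) := by
      have h2 := hT h
      rw [Nat.cast_pow, Nat.cast_two, ← Real.rpow_natCast, ← Real.rpow_mul (by norm_num),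
        mul_comm (h : ℝ)] at h2
      have h3 : (2 : ℝ) ^ h ≤ 2 ^ ((2 - ε) * (h : ℝ)) := by
        rw [← Real.rpow_natCast]
        refine Real.rpow_le_rpow_of_exponent_le (by norm_num) ?_
        have : (0 : ℝ) ≤ h := Nat.cast_nonneg h
        nlinarith
      nlinarith
    have h2 : (f n : ℝ) ≤ ((2 * h + 2) ^ C : ℕ) * ((numGuess k h : ℝ) * ((numProof h : ℝ) *
        ((dim h : ℝ) * (20 * 2 ^ h + T h)))) := by exact_mod_cast h1
    calc (f n : ℝ) ≤ 2 ^ (ε / 8 * (h : ℝ)) * (2 ^ (ε / 8 * (h : ℝ)) * (2 ^ (ε / 8 * (h : ℝ)) *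
          (2 ^ (ε / 8 * (h : ℝ)) * ((20 + K) * 2 ^ ((2 - ε) * (h : ℝ)))))) := by
          refine h2.trans ?_
          gcongr
      _ = (20 + K) * 2 ^ ((2 - ε / 2) * (h : ℝ)) := by
          rw [show (2 - ε / 2) * (h : ℝ) = ε / 8 * h + (ε / 8 * h + (ε / 8 * h + (ε / 8 * h +
            (2 - ε) * h))) by ring]
          simp only [Real.rpow_add two_pos]
          ring
      _ ≤ (20 + K) * (2 * 2 ^ ((1 - ε / 4) * (n : ℝ))) := by
          refine mul_le_mul_of_nonneg_left ?_ (by linarith)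
          calc (2 : ℝ) ^ ((2 - ε / 2) * (h : ℝ)) ≤ 2 ^ (1 + (1 - ε / 4) * (n : ℝ)) := by
                refine Real.rpow_le_rpow_of_exponent_le (by norm_num) ?_
                have : (2 - ε / 2) * (h : ℝ) ≤ (2 - ε / 2) * (((n : ℝ) + 1) / 2) :=
                  mul_le_mul_of_nonneg_left hhn (by linarith)
                linarith
            _ = _ := by rw [Real.rpow_add two_pos, Real.rpow_one]
      _ ≤ (K₀ + 2 * (20 + K)) * 2 ^ ((1 - ε / 4) * (n : ℝ)) := by
          have : 0 ≤ K₀ * (2 : ℝ) ^ ((1 - ε / 4) * (n : ℝ)) := by positivity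
          linarith

/-- If the optimum is at least `(4 * prm h) ^ reps h` but the output at most `(8 * deg h) ^ reps h`,
then the optimum is below `(16 * deg h) ^ reps h`, contrary to `4 * deg h ≤ prm h`. -/
theorem solver_of_approximates {ε K : ℝ} {p : Prog} {c : ℕ} {f : ℕ → ℝ}
    (hp : ∀ N : ℕ, 1 ≤ N → ∀ A B : Fin N → Fin (dim (Nat.log 2 N)) → ℤˣ,
      Function.Injective A → Function.Injective B → ∃ t out : ℕ,
        Computes (c * (Nat.log 2 N + 1)) p (encodeMaxIP A B) t out ∧
        (t : ℝ) ≤ K * (N : ℝ) ^ (2 - ε) ∧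
        out ≤ maxAbsIP A B ∧ (maxAbsIP A B : ℝ) ≤ f N * (out : ℝ))
    {k h : ℕ} (hg : Good k h) (hf : f (2 ^ h) < 2 ^ reps h) {ε' : ℝ} (hε : ε' ≤ ε) :
    Solver p c (fun h => ⌊|K| * ((2 ^ h : ℕ) : ℝ) ^ (2 - ε')⌋₊) h := by
  have H := hp (2 ^ h) Nat.one_le_two_pow
  rw [Nat.log_pow one_lt_two] at H
  intro A B hA hB
  obtain ⟨t, out, h1, h2, h3, h4⟩ := H A B hA hB
  refine ⟨t, out, h1, Nat.le_floor (h2.trans ?_), h3, fun hw => ?_⟩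
  · have hN : (1 : ℝ) ≤ ((2 ^ h : ℕ) : ℝ) := by exact_mod_cast Nat.one_le_two_pow
    calc K * ((2 ^ h : ℕ) : ℝ) ^ (2 - ε) ≤ |K| * ((2 ^ h : ℕ) : ℝ) ^ (2 - ε) :=
          mul_le_mul_of_nonneg_right (le_abs_self K) (by positivity)
      _ ≤ _ := mul_le_mul_of_nonneg_left
          (Real.rpow_le_rpow_of_exponent_le hN (by linarith)) (abs_nonneg K)
  · by_contra! hcon
    have hpos : 0 < (4 * prm h) ^ reps h := Nat.pow_pos (by have := hg.prm_pos; omega)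
    have h5 : (((4 * prm h) ^ reps h : ℕ) : ℝ) ≤ f (2 ^ h) * out :=
      le_trans (by exact_mod_cast hw) h4
    have hout : (0 : ℝ) < out := by
      rcases Nat.eq_zero_or_pos out with rfl | ho
      · rw [Nat.cast_zero, mul_zero] at h5
        have : (0 : ℝ) < ((4 * prm h) ^ reps h : ℕ) := by exact_mod_cast hpos
        linarith
      · exact_mod_cast ho
    have h6 : (((4 * prm h) ^ reps h : ℕ) : ℝ) < ((2 ^ reps h * (8 * deg h) ^ reps h : ℕ) : ℝ) := by
      calc (((4 * prm h) ^ reps h : ℕ) : ℝ) ≤ f (2 ^ h) * out := h5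
        _ < 2 ^ reps h * out := mul_lt_mul_of_pos_right hf hout
        _ ≤ _ := by
          push_cast
          refine mul_le_mul_of_nonneg_left ?_ (by positivity)
          exact_mod_cast hcon
    rw [← mul_pow] at h6
    have h7 : (4 * prm h) ^ reps h < (2 * (8 * deg h)) ^ reps h := by exact_mod_cast h6
    have h8 := hg.four_deg_le
    exact absurd (Nat.pow_le_pow_left (show 2 * (8 * deg h) ≤ 4 * prm h by omega) _) h7.not_ge

end Red

/-! ### The main theorem -/

theorem mainTheorem8 (hSETH : SETH) :
    ∃ (d : ℕ → ℕ) (δ η : ℕ → ℝ),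
      Tendsto δ atTop (𝓝 0) ∧ Tendsto η atTop (𝓝 0) ∧
      (∀ N : ℕ, 2 ≤ N → (d N : ℝ) = (N : ℝ) ^ δ N) ∧
      ∀ ε : ℝ, 0 < ε → ∀ (p : WordRAM.Prog) (f : ℕ → ℝ),
        ApproximatesMaxIPInTime d ε f p →
          ∃ᶠ N : ℕ in atTop, (2 : ℝ) ^ (Real.logb 2 (N : ℝ) ^ (1 - η N)) ≤ f N := by
  refine ⟨fun N => Red.dim (Nat.log 2 N), Red.dimRate, Red.gapRate, Red.tendsto_dimRate,
    Red.tendsto_gapRate, fun N hN => Red.rpow_dimRate hN, fun ε hε p f ⟨c, K, hp⟩ => ?_⟩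
  by_contra hcon
  rw [not_frequently] at hcon
  -- A smaller `ε` only weakens the time bound, and with `ε ≤ 1` the exponents in `exists_time_le`
  -- have the right signs.
  have hε1 : 0 < min ε 1 := lt_min hε one_pos
  obtain ⟨k, hk, hno⟩ := hSETH (min ε 1 / 4) (by linarith)
  have hpow : Tendsto (fun h : ℕ => 2 ^ h) atTop atTop :=
    tendsto_pow_atTop_atTop_of_one_lt one_lt_two
  -- Only powers of 2 are needed as numbers of vectors; there the gap is exactly `2 ^ reps h`.
  obtain ⟨h₀, hh₀⟩ := eventually_atTop.1
    ((Red.eventually_good k).and ((hpow.eventually hcon).and (eventually_ge_atTop 2)))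
  obtain ⟨q, C, hq⟩ := Red.exists_satProg (k := k) (p := p) (c := c) (h₀ := h₀)
    (T := fun h => ⌊|K| * ((2 ^ h : ℕ) : ℝ) ^ (2 - min ε 1)⌋₊) (by omega)
    (fun h hh => (hh₀ h hh).1) fun h hh => by
      obtain ⟨hg, hlt, h2⟩ := hh₀ h hh
      rw [Red.rpow_gapRate h2, not_le] at hlt
      exact Red.solver_of_approximates hp hg hlt (min_le_left _ _)
  obtain ⟨K', hK'⟩ := Red.exists_time_le k C (T := fun h =>
    ⌊|K| * ((2 ^ h : ℕ) : ℝ) ^ (2 - min ε 1)⌋₊) hε1 (min_le_right _ _) (abs_nonneg K)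
    fun h => Nat.floor_le (by positivity)
  refine hno ⟨q, C, K', fun n φ => ?_⟩
  obtain ⟨t, h1, h2⟩ := hq n φ
  exact ⟨t, _, h1, le_trans (by exact_mod_cast h2) (hK' n), WordRAM.ind_eq_one⟩
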